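/- Let $\Omega\subset\mathbb{R}^2$ be a convex polygonal domain, and let $\|\cdot\|$, $\|\cdot\|_1$, $|\cdot|_1$ denote the $L^2(\Omega)$ norm, the $H^1(\Omega)$ norm and the $H^1(\Omega)$ semi-norm. Let $\mathcal{T}_h$ be a quasi-uniform triangulation of $\Omega$ with mesh size $h<1$, let $V_h$ be the space of continuous functions on $\overline\Omega$ that are polynomials of degree at most $k$ ($k\ge 1$) on each triangle, and let $I_h:L^2(\Omega)\to V_h$ be the $L^2$-orthogonal projection. Let $C_P>0$ satisfy $\|w\|\le C_P|w|_1$ for all $w\in H^1_0(\Omega)$, and let $C_A>0$ satisfy $\|I_hw-w\|\le C_A h|w|_1$ for all $w\in H^1(\Omega)$. For constants $0<q_0$ and $q_1$ put $\mathcal{Q}=\{q\in H^1(\Omega): q_0\le q\le q_1 \text{ a.e.}\}$. Let $T,\mu>0$, $q\in\mathcal{Q}$, $b,\tilde b\in H^1(\Omega)^2$, $c,\tilde c\in L^\infty(\Omega)$ with $0\le c,\tilde c\le c_1$ a.e., $f,\tilde f,u_0\in L^2(\Omega)$. A solution of one of the equations below means a weak solution $y$ with $y\in L^2(0,T;H^2(\Omega)\cap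 H^1_0(\Omega))$ and $\frac{d}{dt}y\in L^2(0,T;H^1_0(\Omega))$, taken in its representative that is continuous from $[0,T]$ to $H^1(\Omega)$. Let $u$ be a solution of $$u_t-\nabla\cdot(q\nabla u)+\nabla\cdot(bu)+cu=f \text{ in }(0,T]\times\Omega,\qquad u=0\text{ on }[0,T]\times\partial\Omega,\qquad u(0)=u_0,$$ and, for $\tilde q\in\mathcal{Q}$, let $v_{\tilde q}$ denote a solution of the assimilation equation $$v_t-\nabla\cdot(\tilde q\nabla v)+\nabla\cdot(\tilde b v)+\tilde c v=\tilde f+\mu I_h(u-v) \text{ in }(0,T]\times\Omega,\qquad v=0\text{ on }[0,T]\times\partial\Omega,\qquad v(0)=0.$$ Assume $h^2\le \dfrac{q_0}{2C_A^2\mu^2}$, and let $\mathcal{A}$ be the set of all $\tilde q\in\mathcal{Q}$ with $$\mu\ \ge\ 2+\frac{4}{q_0}\Bigl((1+C_P)^2\|\tilde b\|_1^2+2c_1C_P+|\tilde q|_1^2\Bigr).$$ Then for every fixed $t\in(0,T]$ the map $\tilde q\mapsto v_{\tilde q}(t)$ is locally Lipschitz continuous from $H^1(\Omega)$ to $H^1(\Omega)$: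 for every $\hat q\in\mathcal{A}$ there are $r>0$ and $C_t>0$ such that for all $\tilde q_1,\tilde q_2\in\mathcal{A}$ with $\|\tilde q_i-\hat q\|_1<r$ ($i=1,2$) and all corresponding solutions $v_{\tilde q_1},v_{\tilde q_2}$, $$\|v_{\tilde q_1}(t)-v_{\tilde q_2}(t)\|_1^2\ \le\ (1+C_A^2)\,C_t\,\frac{\|\tilde q_1-\tilde q_2\|_1^2}{q_0}.$$ -/

import Mathlib

open MeasureTheory Set

noncomputable section

namespace CDA

/-- The Euclidean plane. -/
abbrev Plane : Type := EuclideanSpace ℝ (Fin 2)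

/-- A (nonempty, open) convex polygonal domain: the interior of the convex hull of finitely many
points of the plane. -/
def IsConvexPolygonalDomain (Ω : Set Plane) : Prop :=
  Ω.Nonempty ∧ ∃ S : Finset Plane, Ω = interior (convexHull ℝ (S : Set Plane))

/-- Lebesgue measure on `Ω`. -/
abbrev vol (Ω : Set Plane) : Measure Plane := (volume : Measure Plane).restrict Ω

/-- The Lebesgue space `L²(Ω)`. -/
abbrev L2 (Ω : Set Plane) : Type := Lp ℝ 2 (vol Ω)

/-- The Lebesgue space `L^∞(Ω)`. -/
abbrev LInf (Ω : Set Plane) : Type := Lp ℝ ⊤ (vol Ω)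

/-- Test functions: the elements of `C_c^∞(Ω)`. -/
def IsTest (Ω : Set Plane) (φ : Plane → ℝ) : Prop :=
  ContDiff ℝ (⊤ : ℕ∞) φ ∧ HasCompactSupport φ ∧ tsupport φ ⊆ Ω

/-- The classical partial derivative `∂φ/∂xᵢ`. -/
def pderiv (i : Fin 2) (φ : Plane → ℝ) (x : Plane) : ℝ :=
  fderiv ℝ φ x (EuclideanSpace.single i (1 : ℝ))

/-- `g` is the weak (distributional) derivative of `u` in the direction `xᵢ` on `Ω`. -/
def IsWeakDeriv (Ω : Set Plane) (i : Fin 2) (u g : L2 Ω) : Prop :=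
  ∀ φ : Plane → ℝ, IsTest Ω φ →
    ∫ x in Ω, u x * pderiv i φ x = - ∫ x in Ω, g x * φ x

theorem IsTest.memLp {Ω : Set Plane} {φ : Plane → ℝ} (hφ : IsTest Ω φ) :
    MemLp φ 2 (vol Ω) :=
  hφ.1.continuous.memLp_of_hasCompactSupport hφ.2.1

theorem IsTest.memLp_pderiv {Ω : Set Plane} {φ : Plane → ℝ} (hφ : IsTest Ω φ) (i : Fin 2) :
    MemLp (pderiv i φ) 2 (vol Ω) := by
  have h1 : Continuous (pderiv i φ) :=
    (hφ.1.continuous_fderiv (by simp)).clm_apply continuous_const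
  have h2 : HasCompactSupport (pderiv i φ) := hφ.2.1.fderiv_apply (𝕜 := ℝ) _
  exact h1.memLp_of_hasCompactSupport h2

theorem integral_mul_eq_inner {Ω : Set Plane} {ψ : Plane → ℝ} (hψ : MemLp ψ 2 (vol Ω))
    (u : L2 Ω) : ∫ x in Ω, u x * ψ x = inner ℝ (hψ.toLp ψ) u := by
  rw [L2.inner_def]
  refine integral_congr_ae ?_
  filter_upwards [hψ.coeFn_toLp] with x hx
  simp [hx]

theorem isWeakDeriv_iff {Ω : Set Plane} {i : Fin 2} {u g : L2 Ω} :
    IsWeakDeriv Ω i u g ↔ ∀ (φ : Plane → ℝ) (hφ : IsTest Ω φ),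
      inner ℝ ((hφ.memLp_pderiv i).toLp _) u + inner ℝ (hφ.memLp.toLp _) g = 0 := by
  refine forall₂_congr fun φ hφ => ?_
  rw [integral_mul_eq_inner (hφ.memLp_pderiv i), integral_mul_eq_inner hφ.memLp,
    eq_neg_iff_add_eq_zero]

theorem IsWeakDeriv.zero {Ω : Set Plane} {i : Fin 2} : IsWeakDeriv Ω i 0 0 := by
  rw [isWeakDeriv_iff]; simp

theorem IsWeakDeriv.add {Ω : Set Plane} {i : Fin 2} {u g u' g' : L2 Ω}
    (h : IsWeakDeriv Ω i u g) (h' : IsWeakDeriv Ω i u' g') :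
    IsWeakDeriv Ω i (u + u') (g + g') := by
  rw [isWeakDeriv_iff] at *
  intro φ hφ
  have := h φ hφ
  have := h' φ hφ
  simp only [inner_add_right]
  linarith

theorem IsWeakDeriv.smul {Ω : Set Plane} {i : Fin 2} {u g : L2 Ω} (a : ℝ)
    (h : IsWeakDeriv Ω i u g) : IsWeakDeriv Ω i (a • u) (a • g) := by
  rw [isWeakDeriv_iff] at *
  intro φ hφ
  simp only [inner_smul_right, ← mul_add, h φ hφ, mul_zero]

/-- The Sobolev space `H¹(Ω)`: pairs `(u, (∂₁u, ∂₂u))` of an `L²` function and its weak gradient.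
The inherited norm is `‖u‖₁ = (‖u‖² + ‖∂₁u‖² + ‖∂₂u‖²)^{1/2}`. -/
def H1Submodule (Ω : Set Plane) : Submodule ℝ (WithLp 2 (L2 Ω × PiLp 2 (fun _ : Fin 2 => L2 Ω))) where
  carrier := {w | ∀ i, IsWeakDeriv Ω i w.fst (w.snd i)}
  zero_mem' := fun _ => IsWeakDeriv.zero
  add_mem' := fun h h' i => (h i).add (h' i)
  smul_mem' := fun a _ h i => (h i).smul a

/-- `H¹(Ω)` as a normed space. -/
abbrev H1 (Ω : Set Plane) : Type := H1Submodule Ω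

/-- The underlying `L²` function of an `H¹` function. -/
def H1.fn {Ω : Set Plane} (w : H1 Ω) : L2 Ω := w.1.fst

/-- The weak gradient of an `H¹` function. -/
def H1.grad {Ω : Set Plane} (w : H1 Ω) : PiLp 2 (fun _ : Fin 2 => L2 Ω) := w.1.snd

/-- The semi-norm `|w|₁ = (‖∂₁w‖² + ‖∂₂w‖²)^{1/2}`. -/
def H1.seminorm {Ω : Set Plane} (w : H1 Ω) : ℝ := ‖w.grad‖

/-- `H¹₀(Ω)`: the closure of `C_c^∞(Ω)` in `H¹(Ω)`. -/
def H10 (Ω : Set Plane) : Submodule ℝ (H1 Ω) :=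
  (Submodule.span ℝ {w : H1 Ω | ∃ φ : Plane → ℝ, IsTest Ω φ ∧ w.fn =ᵐ[vol Ω] φ}).topologicalClosure

/-- The Sobolev space `H²(Ω)`: the pairs `(u, (∂₁u, ∂₂u))` with `∂₁u, ∂₂u ∈ H¹(Ω)`. The inherited
norm is `‖u‖₂ = (‖u‖² + ∑ᵢ ‖∂ᵢu‖² + ∑ᵢⱼ ‖∂ⱼ∂ᵢu‖²)^{1/2}`. -/
def H2Submodule (Ω : Set Plane) : Submodule ℝ (WithLp 2 (L2 Ω × PiLp 2 (fun _ : Fin 2 => H1 Ω))) where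
  carrier := {w | ∀ i, IsWeakDeriv Ω i w.fst (w.snd i).fn}
  zero_mem' := fun _ => IsWeakDeriv.zero
  add_mem' := fun h h' i => (h i).add (h' i)
  smul_mem' := fun a _ h i => (h i).smul a

/-- `H²(Ω)` as a normed space. -/
abbrev H2 (Ω : Set Plane) : Type := H2Submodule Ω

/-- The underlying `L²` function of an `H²` function. -/
def H2.fn {Ω : Set Plane} (w : H2 Ω) : L2 Ω := w.1.fst

/-- `H¹(Ω)` is complete, so that Bochner integrals of `H¹`-valued functions are meaningful. -/
theorem isClosed_H1Submodule (Ω : Set Plane) :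
    IsClosed (H1Submodule Ω : Set (WithLp 2 (L2 Ω × PiLp 2 (fun _ : Fin 2 => L2 Ω)))) := by
  have : (H1Submodule Ω : Set (WithLp 2 (L2 Ω × PiLp 2 (fun _ : Fin 2 => L2 Ω)))) =
      ⋂ (i : Fin 2) (φ : Plane → ℝ) (hφ : IsTest Ω φ),
        {w | inner ℝ ((hφ.memLp_pderiv i).toLp _) w.fst
          + inner ℝ (hφ.memLp.toLp _) (w.snd i) = 0} := by
    ext w
    simp only [mem_iInter, mem_ofPred_eq]
    exact forall_congr' fun i => isWeakDeriv_iff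
  rw [this]
  refine isClosed_iInter fun i => isClosed_iInter fun φ => isClosed_iInter fun hφ => ?_
  refine isClosed_eq ?_ continuous_const
  have h1 : Continuous fun w : WithLp 2 (L2 Ω × PiLp 2 (fun _ : Fin 2 => L2 Ω)) => w.fst :=
    continuous_fst.comp (WithLp.prod_continuous_ofLp 2 _ _)
  have h2 : Continuous fun w : WithLp 2 (L2 Ω × PiLp 2 (fun _ : Fin 2 => L2 Ω)) => w.snd i :=
    (PiLp.continuous_apply 2 _ i).comp
      (continuous_snd.comp (WithLp.prod_continuous_ofLp 2 _ _))
  exact (continuous_const.inner h1).add (continuous_const.inner h2)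

instance (Ω : Set Plane) : CompleteSpace (H1 Ω) := (isClosed_H1Submodule Ω).completeSpace_coe

/-- The set `𝒬` of admissible conductivities: `q ∈ H¹(Ω)` with `q₀ ≤ q ≤ q₁` a.e. in `Ω`. -/
def Conductivities (Ω : Set Plane) (q₀ q₁ : ℝ) : Set (H1 Ω) :=
  {q | ∀ᵐ x ∂(vol Ω), q₀ ≤ q.fn x ∧ q.fn x ≤ q₁}

/-! ### Finite elements -/

/-- A (conforming) subdivision of `Ω` into triangles; a triangle is given by its three vertices. -/
structure Triangulation (Ω : Set Plane) where
  triangles : Finset (Finset Plane)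
  card_eq : ∀ S ∈ triangles, S.card = 3
  affineIndependent : ∀ S ∈ triangles, AffineIndependent ℝ ((↑) : S → Plane)
  cover : ⋃ S ∈ triangles, convexHull ℝ (S : Set Plane) = closure Ω
  conforming : ∀ S ∈ triangles, ∀ S' ∈ triangles,
    convexHull ℝ (S : Set Plane) ∩ convexHull ℝ (S' : Set Plane) =
      convexHull ℝ ((S : Set Plane) ∩ (S' : Set Plane))

/-- The mesh size `h`: the largest diameter of a triangle. -/
def Triangulation.meshSize {Ω : Set Plane} (𝒯 : Triangulation Ω) : ℝ :=
  sSup ((fun S : Finset Plane => Metric.diam (convexHull ℝ (S : Set Plane))) '' 𝒯.triangles)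

/-- Quasi-uniformity with parameter `ρ`: every triangle contains a disc of radius `ρ h`. -/
def Triangulation.IsQuasiUniform {Ω : Set Plane} (𝒯 : Triangulation Ω) (ρ : ℝ) : Prop :=
  ∀ S ∈ 𝒯.triangles, ∃ z : Plane,
    Metric.closedBall z (ρ * 𝒯.meshSize) ⊆ convexHull ℝ (S : Set Plane)

/-- `g` is a Lagrange finite element function of order `k`: it is continuous on the closure of `Ω`
and coincides on each triangle with a polynomial of degree at most `k`. -/
def Triangulation.IsLagrange {Ω : Set Plane} (𝒯 : Triangulation Ω) (k : ℕ) (g : Plane → ℝ) :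
    Prop :=
  ContinuousOn g (closure Ω) ∧
    ∀ S ∈ 𝒯.triangles, ∃ p ∈ MvPolynomial.restrictTotalDegree (Fin 2) ℝ k,
      ∀ x ∈ convexHull ℝ (S : Set Plane), g x = MvPolynomial.eval (fun i => x i) p

/-- The finite element space `V_h = 𝒫_k(𝒯_h)` as a subspace of `L²(Ω)`. -/
def Triangulation.Vh {Ω : Set Plane} (𝒯 : Triangulation Ω) (k : ℕ) : Submodule ℝ (L2 Ω) where
  carrier := {w | ∃ g : Plane → ℝ, 𝒯.IsLagrange k g ∧ w =ᵐ[vol Ω] g}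
  zero_mem' := ⟨0, ⟨continuousOn_const, fun _ _ => ⟨0, Submodule.zero_mem _, by simp⟩⟩,
    Lp.coeFn_zero _ _ _⟩
  add_mem' := by
    rintro w w' ⟨g, ⟨hc, hg⟩, hw⟩ ⟨g', ⟨hc', hg'⟩, hw'⟩
    refine ⟨g + g', ⟨hc.add hc', fun S hS => ?_⟩, (Lp.coeFn_add w w').trans (hw.add hw')⟩
    obtain ⟨p, hp, h⟩ := hg S hS
    obtain ⟨p', hp', h'⟩ := hg' S hS
    exact ⟨p + p', Submodule.add_mem _ hp hp', fun x hx => by simp [h x hx, h' x hx]⟩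
  smul_mem' := by
    rintro a w ⟨g, ⟨hc, hg⟩, hw⟩
    refine ⟨a • g, ⟨hc.const_smul a, fun S hS => ?_⟩,
      (Lp.coeFn_smul a w).trans (hw.const_smul a)⟩
    obtain ⟨p, hp, h⟩ := hg S hS
    exact ⟨a • p, Submodule.smul_mem _ a hp, fun x hx => by simp [h x hx]⟩

open Classical in
/-- Auxiliary: a family of polynomials, one for each triangle, glued to a function on the plane. -/
def Triangulation.glue {Ω : Set Plane} (𝒯 : Triangulation Ω) (k : ℕ) :
    (𝒯.triangles → MvPolynomial.restrictTotalDegree (Fin 2) ℝ k) →ₗ[ℝ] (Plane → ℝ) where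
  toFun p x := if h : ∃ S : 𝒯.triangles, x ∈ convexHull ℝ (S.1 : Set Plane) then
    MvPolynomial.eval (fun i => x i) (p h.choose).1 else 0
  map_add' p p' := by
    ext x
    by_cases h : ∃ S : 𝒯.triangles, x ∈ convexHull ℝ (S.1 : Set Plane)
    · simp only [dif_pos h, Pi.add_apply, Submodule.coe_add, map_add]
    · simp only [dif_neg h, Pi.add_apply, add_zero]
  map_smul' a p := by
    ext x
    by_cases h : ∃ S : 𝒯.triangles, x ∈ convexHull ℝ (S.1 : Set Plane)
    · simp only [dif_pos h, Pi.smul_apply, Submodule.coe_smul, MvPolynomial.smul_eval,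
        RingHom.id_apply, smul_eq_mul]
    · simp only [dif_neg h, Pi.smul_apply, smul_zero]

instance Triangulation.finiteDimensional_Vh {Ω : Set Plane} (𝒯 : Triangulation Ω) (k : ℕ) :
    FiniteDimensional ℝ (𝒯.Vh k) := by
  let toG : (Plane → ℝ) →ₗ[ℝ] Filter.Germ (ae (vol Ω)) ℝ :=
    { toFun := fun f => (f : Filter.Germ (ae (vol Ω)) ℝ)
      map_add' := fun _ _ => rfl
      map_smul' := fun _ _ => rfl }
  let R := LinearMap.range (toG.comp (𝒯.glue k))
  have key : ∀ w : 𝒯.Vh k, toG (w.1 : Plane → ℝ) ∈ R := by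
    intro w
    obtain ⟨g, hg, hw⟩ := w.2
    have hg := hg.2
    choose! p hp hpg using hg
    refine ⟨fun S => ⟨p S.1, hp S.1 S.2⟩, ?_⟩
    refine Filter.Germ.coe_eq.2 ?_
    have hmem : ∀ᵐ x ∂(vol Ω), x ∈ closure Ω := by
      have h1 : ∀ᵐ x ∂((volume : Measure Plane).restrict (closure Ω)), x ∈ closure Ω :=
        ae_restrict_mem isClosed_closure.measurableSet
      exact ae_mono (Measure.restrict_mono subset_closure le_rfl) h1
    filter_upwards [hw, hmem] with x hx hxm
    rw [← 𝒯.cover] at hxm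
    have h : ∃ S : 𝒯.triangles, x ∈ convexHull ℝ (S.1 : Set Plane) := by
      simpa using hxm
    rw [hx]
    exact (dif_pos h).trans (hpg _ h.choose.2 x h.choose_spec).symm
  let Ψ : 𝒯.Vh k →ₗ[ℝ] R :=
    { toFun := fun w => ⟨toG (w.1 : Plane → ℝ), key w⟩
      map_add' := fun w w' => Subtype.ext (Filter.Germ.coe_eq.2 (Lp.coeFn_add w.1 w'.1))
      map_smul' := fun a w => Subtype.ext (Filter.Germ.coe_eq.2 (Lp.coeFn_smul a w.1)) }
  refine FiniteDimensional.of_injective Ψ fun w w' h => ?_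
  exact Subtype.ext (Lp.ext (Filter.Germ.coe_eq.1 (congrArg Subtype.val h)))

/-- The `L²`-orthogonal projection `I_h : L²(Ω) → V_h`. -/
def Triangulation.Ih {Ω : Set Plane} (𝒯 : Triangulation Ω) (k : ℕ) : L2 Ω →L[ℝ] L2 Ω :=
  (𝒯.Vh k).starProjection

/-- `C_P` is a constant in Poincaré's inequality on `H¹₀(Ω)`. -/
def IsPoincareConst (Ω : Set Plane) (C_P : ℝ) : Prop :=
  0 < C_P ∧ ∀ w ∈ H10 Ω, ‖w.fn‖ ≤ C_P * w.seminorm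

/-- `C_A` is a constant in the approximation property `‖I_h w - w‖ ≤ C_A h |w|₁` of `I_h`. -/
def Triangulation.IsApproxConst {Ω : Set Plane} (𝒯 : Triangulation Ω) (k : ℕ) (C_A : ℝ) : Prop :=
  0 < C_A ∧ ∀ w : H1 Ω, ‖𝒯.Ih k w.fn - w.fn‖ ≤ C_A * 𝒯.meshSize * w.seminorm

/-! ### The parabolic equations -/

/-- The bilinear form of `-∇·(q∇v) + ∇·(b v) + c v`:
`∫ q ∇v·∇φ - ∫ v b·∇φ + ∫ c v φ`. -/
def form {Ω : Set Plane} (q : H1 Ω) (b : Fin 2 → H1 Ω) (c : LInf Ω) (v φ : H1 Ω) : ℝ :=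
  (∫ x in Ω, q.fn x * ∑ i, v.grad i x * φ.grad i x)
    - (∫ x in Ω, v.fn x * ∑ i, (b i).fn x * φ.grad i x)
    + ∫ x in Ω, c x * v.fn x * φ.fn x

/-- `y ∈ L²(0,T; H²(Ω) ∩ H¹₀(Ω))`, `dy/dt ∈ L²(0,T; H¹₀(Ω))`, where `y` is the (absolutely)
continuous representative, and `y` is the solution of
`y_t - ∇·(q∇y) + ∇·(b y) + c y = F` in `(0,T] × Ω`, `y = 0` on `[0,T] × ∂Ω`, `y(0) = y₀`. -/
structure IsSolution {Ω : Set Plane} (T : ℝ) (q : H1 Ω) (b : Fin 2 → H1 Ω) (c : LInf Ω)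
    (F : ℝ → L2 Ω) (y₀ : L2 Ω) (y : ℝ → H1 Ω) : Prop where
  mem_H2 : ∃ Y : ℝ → H2 Ω, MemLp Y 2 (volume.restrict (Ioo 0 T)) ∧
    ∀ᵐ s ∂(volume.restrict (Ioo 0 T)), (Y s).fn = (y s).fn
  mem_H10 : ∀ᵐ s ∂(volume.restrict (Ioo 0 T)), y s ∈ H10 Ω
  initial : (y 0).fn = y₀
  equation : ∃ y' : ℝ → H1 Ω, MemLp y' 2 (volume.restrict (Ioo 0 T)) ∧
    (∀ᵐ s ∂(volume.restrict (Ioo 0 T)), y' s ∈ H10 Ω) ∧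
    (∀ s ∈ Icc 0 T, y s = y 0 + ∫ r in (0 : ℝ)..s, y' r) ∧
    ∀ᵐ s ∂(volume.restrict (Ioo 0 T)), ∀ φ ∈ H10 Ω,
      inner ℝ (y' s).fn φ.fn + form q b c (y s) φ = inner ℝ (F s) φ.fn

/-- The assimilation equation, started from zero: `v` solves
`v_t - ∇·(q̃∇v) + ∇·(b̃ v) + c̃ v = f̃ + μ I_h(u - v)`, `v = 0` on `∂Ω`, `v(0) = 0`. -/
def IsAssimilationSolution {Ω : Set Plane} (𝒯 : Triangulation Ω) (k : ℕ) (T μ : ℝ)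
    (u : ℝ → H1 Ω) (bt : Fin 2 → H1 Ω) (ct : LInf Ω) (ft : L2 Ω) (qt : H1 Ω) (v : ℝ → H1 Ω) :
    Prop :=
  IsSolution T qt bt ct (fun s => ft + μ • 𝒯.Ih k ((u s).fn - (v s).fn)) 0 v

/-- The coefficients `q̃ ∈ 𝒬` for which `μ` is large enough, that is
`μ ≥ 2 + 4((1 + C_P)²‖b̃‖₁² + 2 c₁ C_P + |q̃|₁²)/q₀`. -/
def AdmissibleCoeffs (Ω : Set Plane) (q₀ q₁ c₁ C_P μ : ℝ) (bt : Fin 2 → H1 Ω) : Set (H1 Ω) :=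
  {qt | qt ∈ Conductivities Ω q₀ q₁ ∧
    2 + 4 * ((1 + C_P) ^ 2 * (∑ i, ‖bt i‖ ^ 2) + 2 * c₁ * C_P + qt.seminorm ^ 2) / q₀ ≤ μ}

end CDA

end

open CDA MeasureTheory

noncomputable section

namespace CDA

open Filter Topology

/-! ### Abstract evolution equations: weighted energy estimates. -/

section Evolution

open intervalIntegral

variable {V H : Type*} [NormedAddCommGroup V] [InnerProductSpace ℝ V]
  [NormedAddCommGroup H] [InnerProductSpace ℝ H]

/-! The difference `w = v₁ - v₂` of two assimilation solutions solves the equation with coefficient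
`q̃₁`, zero initial value and source `φ ↦ ∫ d ∇v₂·∇φ`, where `d = q̃₂ - q̃₁`. In the plane `H¹` does
not embed into `L^∞`, so smallness of `d` in `H¹` does not by itself make this source small. The
missing estimate is recovered from the equation for `v₂`.

At a fixed time `v₂` solves an elliptic equation with some right-hand side `g` in `L²`. A De
Giorgi–Stampacchia iteration (`ae_le_of_form_eq`, `ae_abs_le_of_form_eq`) bounds `|v₂|` pointwise by
a multiple of `‖g‖ + ‖v₂‖`, and testing with `d² v₂` then yields `‖d ∇v₂‖ ≤ C ‖d‖₁ (‖g‖ + ‖v₂‖)`,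
with no `L^∞` norm of `d` in the constant (`sqrt_sum_norm_sq_bmul_grad_le`,
`exists_bmul_grad_bound`). The analytic input to both is the inequality `W₀^{1,1} ⊂ L²`, which also
shows that a product of an `H¹₀` and an `H¹` function lies in `L²`.

An `H¹` bound for `w` at a single time needs an `L²` bound for `w_t`: coercivity controls `‖w‖₁²` by
the source, by `(w_t, w)` and by `‖w‖²`. To bound `w_t` the equation is differenced in time. The
source then contains `d ∇` of a time difference quotient of `v₂`, and the elliptic estimate for that
quotient involves a second time difference of `v₂`. All these quantities are estimated through
difference quotients with the weight `s²`, which vanishes at time zero (`dq_bound`). The regularity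
is handed on in a chain: from `u`, whose source is constant in time (`exists_second_dq_bound`), to
the forcing `f̃ + μ I_h u`, from there to `v₂` (`exists_regularity_bound`), and finally to `w`
(`exists_lipschitz_bound`). The initial value zero makes `v₂` grow at most linearly in `L²`
(`norm_le_mul_time`), so its first difference quotients are bounded up to time zero without a
weight.

The feedback `-μ I_h v` is moved into the bilinear form, where it is nonnegative. The Gårding
inequality (`coercive_formL`) and all later constants are therefore uniform over the conductivities
between `q₀` and `q₁`. -/

/-- A strong solution `y` on `[0,T]`, with time derivative `y'`, of the abstract evolution equation
`(J y', J φ) + a(y, φ) = L(φ)`. -/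
structure IsEvol (J : V →L[ℝ] H) (a : V →L[ℝ] V →L[ℝ] ℝ) (L : ℝ → V →L[ℝ] ℝ) (T : ℝ)
    (y y' : ℝ → V) : Prop where
  memLp : MemLp y' 2 (volume.restrict (Ioc 0 T))
  eq_integral : ∀ s ∈ Icc 0 T, y s = y 0 + ∫ r in (0 : ℝ)..s, y' r
  weak : ∀ᵐ s, s ∈ Ioc 0 T → ∀ φ, inner ℝ (J (y' s)) (J φ) + a (y s) φ = L s φ

/-- The forward difference quotient. -/
def dq {E : Type*} [AddCommGroup E] [Module ℝ E] (h : ℝ) (y : ℝ → E) (s : ℝ) : E :=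
  h⁻¹ • (y (s + h) - y s)

/-- Absolute continuity only sees increments, so it is inherited from any absolutely continuous
function with larger increments. It will be applied with a primitive of a multiple of `‖y'‖` as `g`.
-/
theorem absolutelyContinuousOnInterval_of_dist_le {f g : ℝ → ℝ} {a b : ℝ}
    (hg : AbsolutelyContinuousOnInterval g a b)
    (h : ∀ x ∈ uIcc a b, ∀ y ∈ uIcc a b, dist (f x) (f y) ≤ dist (g x) (g y)) :
    AbsolutelyContinuousOnInterval f a b := by
  rw [absolutelyContinuousOnInterval_iff] at *
  intro ε hε
  obtain ⟨δ, hδ, H⟩ := hg ε hε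
  refine ⟨δ, hδ, fun E hE hs => lt_of_le_of_lt (Finset.sum_le_sum fun i hi => ?_) (H E hE hs)⟩
  have := hE.1 i hi
  exact h _ this.1 _ this.2

namespace IsEvol

variable {J : V →L[ℝ] H} {a : V →L[ℝ] V →L[ℝ] ℝ} {L : ℝ → V →L[ℝ] ℝ} {T : ℝ} {y y' : ℝ → V}

theorem integrableOn (hy : IsEvol J a L T y y') : IntegrableOn y' (Ioc 0 T) :=
  hy.memLp.integrable (by norm_num)

theorem intervalIntegrable (hy : IsEvol J a L T y y') {s r : ℝ} (hs : s ∈ Icc 0 T)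
    (hr : r ∈ Icc 0 T) : IntervalIntegrable y' volume s r := by
  rw [intervalIntegrable_iff]
  refine hy.integrableOn.mono_set fun x hx => ?_
  rcases le_total s r with h | h
  · rw [uIoc_of_le h] at hx; exact ⟨hs.1.trans_lt hx.1, hx.2.trans hr.2⟩
  · rw [uIoc_of_ge h] at hx; exact ⟨hr.1.trans_lt hx.1, hx.2.trans hs.2⟩

theorem intervalIntegrable_norm_sq (hy : IsEvol J a L T y y') {s r : ℝ} (hs : s ∈ Icc 0 T)
    (hr : r ∈ Icc 0 T) : IntervalIntegrable (fun x => ‖y' x‖ ^ 2) volume s r := by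
  rw [intervalIntegrable_iff]
  have h := hy.memLp.integrable_norm_pow (by norm_num)
  refine IntegrableOn.mono_set (t := Ioc 0 T) (by simpa [IntegrableOn] using h) fun x hx => ?_
  rcases le_total s r with h | h
  · rw [uIoc_of_le h] at hx; exact ⟨hs.1.trans_lt hx.1, hx.2.trans hr.2⟩
  · rw [uIoc_of_ge h] at hx; exact ⟨hr.1.trans_lt hx.1, hx.2.trans hs.2⟩

theorem sub_eq (hy : IsEvol J a L T y y') {s r : ℝ} (hs : s ∈ Icc 0 T)
    (hr : r ∈ Icc 0 T) : y r - y s = ∫ x in s..r, y' x := by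
  have h0 : (0 : ℝ) ∈ Icc 0 T := ⟨le_rfl, hs.1.trans hs.2⟩
  rw [hy.eq_integral s hs, hy.eq_integral r hr, add_sub_add_left_eq_sub,
    integral_interval_sub_left (hy.intervalIntegrable h0 hr) (hy.intervalIntegrable h0 hs)]

theorem dist_le (hy : IsEvol J a L T y y') {s r : ℝ} (hs : s ∈ Icc 0 T)
    (hr : r ∈ Icc 0 T) : ‖y r - y s‖ ≤ |∫ x in s..r, ‖y' x‖| := by
  rw [hy.sub_eq hs hr]; exact norm_integral_le_abs_integral_norm

theorem continuousOn (hy : IsEvol J a L T y y') : ContinuousOn y (Icc 0 T) := by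
  refine ContinuousOn.congr ?_ hy.eq_integral
  refine continuousOn_const.add ?_
  rcases le_or_gt 0 T with hT | hT
  · have := continuousOn_primitive_interval (μ := volume) (f := y') (a := 0) (b := T)
      (by rw [uIcc_of_le hT, integrableOn_Icc_iff_integrableOn_Ioc]; exact hy.integrableOn)
    rwa [uIcc_of_le hT] at this
  · rw [Icc_eq_empty (not_le.2 hT)]; exact continuousOn_empty _

theorem ae_hasDerivAt [CompleteSpace V] (hy : IsEvol J a L T y y') :
    ∀ᵐ s, s ∈ Ioo 0 T → HasDerivAt y (y' s) s := by
  rcases le_or_gt 0 T with hT | hT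
  · have h0 : (0 : ℝ) ∈ Icc 0 T := ⟨le_rfl, hT⟩
    have h1 : T ∈ Icc 0 T := ⟨hT, le_rfl⟩
    filter_upwards [(hy.intervalIntegrable h0 h1).ae_hasDerivAt_integral] with s hs hs'
    rw [uIcc_of_le hT] at hs
    have := (hs ⟨hs'.1.le, hs'.2.le⟩ 0 h0).const_add (y 0)
    refine this.congr_of_eventuallyEq ?_
    filter_upwards [Ioo_mem_nhds hs'.1 hs'.2] with x hx
    exact hy.eq_integral x ⟨hx.1.le, hx.2.le⟩
  · rw [Ioo_eq_empty (not_lt.2 hT.le)]; simp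

/-- On a compact interval `‖y‖` has a bound `B`. Factoring the difference of squares, increments of
`‖J y‖²` are at most those of the primitive of `2 B ‖J‖² ‖y'‖`. -/
theorem absolutelyContinuous_normSq (hy : IsEvol J a L T y y') {s : ℝ} (hs : s ∈ Icc 0 T) :
    AbsolutelyContinuousOnInterval (fun r => ‖J (y r)‖ ^ 2) 0 s := by
  have h0 : (0 : ℝ) ∈ Icc 0 T := ⟨le_rfl, hs.1.trans hs.2⟩
  obtain ⟨B, hB⟩ := isCompact_Icc.exists_bound_of_continuousOn hy.continuousOn
  have hB0 : 0 ≤ B := (norm_nonneg _).trans (hB 0 h0)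
  have hg := ((hy.intervalIntegrable h0 hs).norm.const_mul
    (2 * B * ‖J‖ ^ 2)).absolutelyContinuousOnInterval_intervalIntegral (c := 0) (by simp)
  refine absolutelyContinuousOnInterval_of_dist_le hg fun x hx r hr => ?_
  rw [uIcc_of_le hs.1] at hx hr
  have hx' : x ∈ Icc 0 T := ⟨hx.1, hx.2.trans hs.2⟩
  have hr' : r ∈ Icc 0 T := ⟨hr.1, hr.2.trans hs.2⟩
  have hi := (hy.intervalIntegrable h0 hx').norm.const_mul (2 * B * ‖J‖ ^ 2)
  have hi' := (hy.intervalIntegrable h0 hr').norm.const_mul (2 * B * ‖J‖ ^ 2)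
  rw [Real.dist_eq, Real.dist_eq, integral_interval_sub_left hi hi', intervalIntegral.integral_const_mul, abs_mul,
    abs_of_nonneg (by positivity : (0:ℝ) ≤ 2 * B * ‖J‖ ^ 2)]
  have h1 : ‖J (y x) - J (y r)‖ ≤ ‖J‖ * |∫ t in r..x, ‖y' t‖| := by
    rw [← map_sub]
    exact (J.le_opNorm _).trans (by gcongr; exact hy.dist_le hr' hx')
  have h2 : ∀ z ∈ Icc 0 T, ‖J (y z)‖ ≤ ‖J‖ * B := fun z hz =>
    (J.le_opNorm _).trans (by gcongr; exact hB z hz)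
  have h3 : ‖J (y x)‖ ^ 2 - ‖J (y r)‖ ^ 2 =
      (‖J (y x)‖ - ‖J (y r)‖) * (‖J (y x)‖ + ‖J (y r)‖) := by ring
  rw [h3, abs_mul]
  calc _ ≤ (‖J‖ * |∫ t in r..x, ‖y' t‖|) * (‖J‖ * B + ‖J‖ * B) := by
        refine mul_le_mul ((abs_norm_sub_norm_le _ _).trans h1) ?_ (abs_nonneg _) (by positivity)
        rw [abs_of_nonneg (by positivity)]
        exact add_le_add (h2 x hx') (h2 r hr')
    _ = _ := by ring

/-- Integration by parts for two absolutely continuous functions. By Lebesgue differentiation `y`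
has derivative `y'` almost everywhere, which identifies the derivative of `‖J y‖²`. The free weight
`θ` serves both for Gronwall factors and for weights vanishing at time zero. -/
theorem energy_identity [CompleteSpace V] (hy : IsEvol J a L T y y') {s : ℝ} (hs : s ∈ Icc 0 T) {θ θ' : ℝ → ℝ}
    (hθ : ∀ x, HasDerivAt θ (θ' x) x) (hθ' : Continuous θ') :
    IntervalIntegrable (fun r => θ' r * ‖J (y r)‖ ^ 2 + θ r * (2 * inner ℝ (J (y' r)) (J (y r))))
      volume 0 s ∧
    ∫ r in (0:ℝ)..s, (θ' r * ‖J (y r)‖ ^ 2 + θ r * (2 * inner ℝ (J (y' r)) (J (y r)))) =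
      θ s * ‖J (y s)‖ ^ 2 - θ 0 * ‖J (y 0)‖ ^ 2 := by
  have hC : ContDiff ℝ 1 θ := by
    rw [contDiff_one_iff_deriv]
    exact ⟨fun x => (hθ x).differentiableAt, by rwa [funext fun x => (hθ x).deriv]⟩
  have hAC : AbsolutelyContinuousOnInterval θ 0 s :=
    hC.contDiffOn.absolutelyContinuousOnInterval
  have hN := hy.absolutelyContinuous_normSq hs
  have hne : ∀ᵐ x : ℝ, x ≠ T := by simp [ae_iff, measure_singleton]
  have hae : ∀ᵐ r, r ∈ uIoc 0 s → deriv θ r * ‖J (y r)‖ ^ 2 +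
      θ r * deriv (fun r => ‖J (y r)‖ ^ 2) r =
      θ' r * ‖J (y r)‖ ^ 2 + θ r * (2 * inner ℝ (J (y' r)) (J (y r))) := by
    filter_upwards [hy.ae_hasDerivAt, hne] with r hr hrT hr'
    rw [uIoc_of_le hs.1] at hr'
    have h1 := (J.hasFDerivAt.comp_hasDerivAt r
      (hr ⟨hr'.1, lt_of_le_of_ne (hr'.2.trans hs.2) hrT⟩)).norm_sq
    have h2 : HasDerivAt (fun x => ‖J (y x)‖ ^ 2) (2 * inner ℝ (J (y r)) (J (y' r))) r := h1
    rw [(hθ r).deriv, h2.deriv, real_inner_comm]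
  constructor
  · refine IntervalIntegrable.congr_ae (f := fun r => deriv θ r * ‖J (y r)‖ ^ 2 +
      θ r * deriv (fun r => ‖J (y r)‖ ^ 2) r) ?_ ((ae_restrict_iff' measurableSet_uIoc).2 hae)
    exact (hAC.intervalIntegrable_deriv.mul_continuousOn hN.continuousOn).add
      (hN.intervalIntegrable_deriv.continuousOn_mul hAC.continuousOn)
  · rw [← hAC.integral_deriv_mul_eq_sub hN]
    exact (integral_congr_ae hae).symm

/-- The weighted energy inequality, with the weight `exp (-2βs) ψ(s)`. -/
theorem energy_le [CompleteSpace V] (hy : IsEvol J a L T y y') {α β : ℝ}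
    (ha : ∀ v, α * ‖v‖ ^ 2 ≤ a v v + β * ‖J v‖ ^ 2) {ψ ψ' k : ℝ → ℝ}
    (hψ : ∀ x, HasDerivAt ψ (ψ' x) x) (hψ' : Continuous ψ') (hψ0 : ∀ x, 0 ≤ ψ x)
    {s : ℝ} (hs : s ∈ Icc 0 T) (hk : IntervalIntegrable k volume 0 s)
    (hb : ∀ᵐ r, r ∈ Ioc 0 s →
      ψ' r * ‖J (y r)‖ ^ 2 + ψ r * (2 * L r (y r)) - ψ r * (2 * α * ‖y r‖ ^ 2) ≤ k r) :
    Real.exp (-2 * β * s) * (ψ s * ‖J (y s)‖ ^ 2) ≤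
      ψ 0 * ‖J (y 0)‖ ^ 2 + ∫ r in (0:ℝ)..s, Real.exp (-2 * β * r) * k r := by
  -- The derivative of the exponential factor cancels the term `β ‖J v‖²` of the Gårding inequality,
  -- so no separate Gronwall argument is needed.
  have hθ : ∀ x, HasDerivAt (fun x => Real.exp (-2 * β * x) * ψ x)
      (Real.exp (-2 * β * x) * (-2 * β) * ψ x + Real.exp (-2 * β * x) * ψ' x) x := fun x => by
    have h1 : HasDerivAt (fun x => Real.exp (-2 * β * x)) (Real.exp (-2 * β * x) * (-2 * β)) x := by
      simpa using ((hasDerivAt_id x).const_mul (-2 * β)).exp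
    exact h1.mul (hψ x)
  have hψc : Continuous ψ := continuous_iff_continuousAt.2 fun x => (hψ x).continuousAt
  obtain ⟨hi, he⟩ := hy.energy_identity hs hθ (by fun_prop)
  have hmono := integral_mono_ae_restrict (μ := volume) hs.1 hi
    (hk.continuousOn_mul (g := fun r => Real.exp (-2 * β * r))
      (Continuous.continuousOn (by fun_prop))) ?_
  · simp only [mul_zero, Real.exp_zero, one_mul] at he
    rw [he] at hmono
    linarith
  · have hne : ∀ᵐ x : ℝ, x ≠ 0 := by simp [ae_iff, measure_singleton]
    refine (ae_restrict_iff' measurableSet_Icc).2 ?_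
    filter_upwards [hb, hy.weak, hne] with r hr hw hr0 hr'
    have hrm : r ∈ Ioc 0 s := ⟨lt_of_le_of_ne hr'.1 (Ne.symm hr0), hr'.2⟩
    have h1 := hr hrm
    have h2 := hw ⟨hrm.1, hrm.2.trans hs.2⟩ (y r)
    have h3 := mul_le_mul_of_nonneg_left (ha (y r)) (hψ0 r)
    have h4 : inner ℝ (J (y' r)) (J (y r)) = L r (y r) - a (y r) (y r) := by linarith
    rw [h4]
    calc _ = Real.exp (-2 * β * r) * (ψ' r * ‖J (y r)‖ ^ 2 + ψ r * (2 * L r (y r))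
          - 2 * (ψ r * (a (y r) (y r) + β * ‖J (y r)‖ ^ 2))) := by ring
      _ ≤ Real.exp (-2 * β * r) * k r := by
        gcongr
        linarith

/-- The basic energy estimate. -/
theorem energy_bound [CompleteSpace V] (hy : IsEvol J a L T y y') (hT : 0 ≤ T) {α β : ℝ}
    (hα : 0 < α) (hβ : 0 ≤ β) (ha : ∀ v, α * ‖v‖ ^ 2 ≤ a v v + β * ‖J v‖ ^ 2) {m : ℝ → ℝ}
    (hm2 : IntervalIntegrable (fun r => m r ^ 2) volume 0 T)
    (hm : ∀ᵐ r, r ∈ Ioc 0 T → ∀ φ, |L r φ| ≤ m r * ‖φ‖) :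
    (∀ s ∈ Icc 0 T, ‖J (y s)‖ ^ 2 ≤
      Real.exp (2 * β * T) * (‖J (y 0)‖ ^ 2 + α⁻¹ * ∫ r in (0:ℝ)..T, m r ^ 2)) ∧
    α * ∫ r in (0:ℝ)..T, ‖y r‖ ^ 2 ≤
      Real.exp (2 * β * T) * (‖J (y 0)‖ ^ 2 + α⁻¹ * ∫ r in (0:ℝ)..T, m r ^ 2) := by
  have hyi : IntervalIntegrable (fun r => ‖y r‖ ^ 2) volume 0 T := by
    apply ContinuousOn.intervalIntegrable
    rw [uIcc_of_le hT]
    exact (hy.continuousOn.norm).pow 2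
  have key : ∀ s ∈ Icc 0 T, Real.exp (-2 * β * T) * ‖J (y s)‖ ^ 2 +
      Real.exp (-2 * β * T) * (α * ∫ r in (0:ℝ)..s, ‖y r‖ ^ 2) ≤
      ‖J (y 0)‖ ^ 2 + α⁻¹ * ∫ r in (0:ℝ)..T, m r ^ 2 := by
    intro s hs
    have hsub : uIcc 0 s ⊆ uIcc 0 T := by
      rw [uIcc_of_le hT, uIcc_of_le hs.1]; exact Icc_subset_Icc le_rfl hs.2
    have hm2s := hm2.mono_set hsub
    have hyis := hyi.mono_set hsub
    -- Young's inequality spends only half of the coercive term `2 α ‖y‖²` on the source. The other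
    -- half stays inside `k` and produces the bound on `∫ ‖y‖²`.
    have h := hy.energy_le ha (ψ := fun _ => 1) (ψ' := fun _ => 0)
      (k := fun r => α⁻¹ * m r ^ 2 - α * ‖y r‖ ^ 2)
      (fun x => hasDerivAt_const x 1) continuous_const (fun _ => zero_le_one) hs
      ((hm2s.const_mul _).sub (hyis.const_mul _)) ?_
    · have hexp : Continuous fun r : ℝ => Real.exp (-2 * β * r) := by fun_prop
      have e1 : ∫ r in (0:ℝ)..s, Real.exp (-2 * β * r) * (α⁻¹ * m r ^ 2 - α * ‖y r‖ ^ 2) =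
          α⁻¹ * (∫ r in (0:ℝ)..s, Real.exp (-2 * β * r) * m r ^ 2) -
          α * ∫ r in (0:ℝ)..s, Real.exp (-2 * β * r) * ‖y r‖ ^ 2 := by
        rw [← intervalIntegral.integral_const_mul, ← intervalIntegral.integral_const_mul,
          ← intervalIntegral.integral_sub
            ((hm2s.continuousOn_mul hexp.continuousOn).const_mul _)
            ((hyis.continuousOn_mul hexp.continuousOn).const_mul _)]
        congr 1; ext r; ring
      have e2 : ∫ r in (0:ℝ)..s, Real.exp (-2 * β * r) * m r ^ 2 ≤
          ∫ r in (0:ℝ)..T, m r ^ 2 := by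
        calc _ ≤ ∫ r in (0:ℝ)..s, m r ^ 2 := by
              refine integral_mono_on hs.1 (hm2s.continuousOn_mul hexp.continuousOn) hm2s ?_
              intro r hr
              refine mul_le_of_le_one_left (sq_nonneg _) (Real.exp_le_one_iff.2 ?_)
              have := mul_nonneg hβ hr.1; linarith
          _ ≤ _ := integral_mono_interval le_rfl hs.1 hs.2
              (Eventually.of_forall fun r => sq_nonneg _) hm2
      have e3 : Real.exp (-2 * β * T) * ∫ r in (0:ℝ)..s, ‖y r‖ ^ 2 ≤
          ∫ r in (0:ℝ)..s, Real.exp (-2 * β * r) * ‖y r‖ ^ 2 := by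
        rw [← intervalIntegral.integral_const_mul]
        refine integral_mono_on hs.1 (hyis.const_mul _)
          (hyis.continuousOn_mul hexp.continuousOn) fun r hr => ?_
        have : β * r ≤ β * T := mul_le_mul_of_nonneg_left (hr.2.trans hs.2) hβ
        gcongr ?_ * _
        exact Real.exp_le_exp.2 (by linarith)
      have e4 : Real.exp (-2 * β * T) * ‖J (y s)‖ ^ 2 ≤
          Real.exp (-2 * β * s) * ‖J (y s)‖ ^ 2 := by
        have : β * s ≤ β * T := mul_le_mul_of_nonneg_left hs.2 hβ
        gcongr ?_ * _
        exact Real.exp_le_exp.2 (by linarith)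
      rw [e1] at h
      simp only [one_mul] at h
      have e5 := mul_le_mul_of_nonneg_left e2 (inv_nonneg.2 hα.le)
      have e6 := mul_le_mul_of_nonneg_left e3 hα.le
      linarith
    · filter_upwards [hm] with r hr hr'
      have h1 := (le_abs_self _).trans (hr ⟨hr'.1, hr'.2.trans hs.2⟩ (y r))
      have h2 : 2 * (m r * ‖y r‖) ≤ α⁻¹ * m r ^ 2 + α * ‖y r‖ ^ 2 := by
        have : 0 ≤ α⁻¹ * (m r - α * ‖y r‖) ^ 2 := by positivity
        have e : α⁻¹ * (m r - α * ‖y r‖) ^ 2 =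
          α⁻¹ * m r ^ 2 - 2 * (m r * ‖y r‖) + α * ‖y r‖ ^ 2 := by field_simp; ring
        linarith
      linarith
  have hE : Real.exp (2 * β * T) * Real.exp (-2 * β * T) = 1 := by
    rw [← Real.exp_add]; ring_nf; exact Real.exp_zero
  constructor
  · intro s hs
    have h := mul_le_mul_of_nonneg_left (key s hs) (Real.exp_pos (2 * β * T)).le
    have h0 : 0 ≤ ∫ r in (0:ℝ)..s, ‖y r‖ ^ 2 :=
      integral_nonneg hs.1 fun r _ => by positivity
    rw [mul_add, ← mul_assoc, ← mul_assoc, hE] at h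
    have := mul_nonneg hα.le h0
    linarith
  · have h := mul_le_mul_of_nonneg_left (key T ⟨hT, le_rfl⟩) (Real.exp_pos (2 * β * T)).le
    rw [mul_add, ← mul_assoc, ← mul_assoc, hE] at h
    have : 0 ≤ ‖J (y T)‖ ^ 2 := by positivity
    linarith

/-- Solutions starting from zero grow at most linearly. -/
theorem norm_le_mul_time [CompleteSpace V] (hy : IsEvol J a L T y y') {α β : ℝ}
    (hα : 0 < α) (hβ : 0 ≤ β) (ha : ∀ v, α * ‖v‖ ^ 2 ≤ a v v + β * ‖J v‖ ^ 2) {B : ℝ}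
    (hB : 0 ≤ B) (hL : ∀ r ∈ Icc 0 T, ∀ φ, |L r φ| ≤ B * ‖J φ‖) (h0 : J (y 0) = 0)
    {s : ℝ} (hs : s ∈ Icc 0 T) : ‖J (y s)‖ ≤ Real.exp (2 * β * T) * (2 * B) * s := by
  have hcont : ContinuousOn (fun r => ‖J (y r)‖) (Icc 0 s) :=
    (J.continuous.comp_continuousOn (hy.continuousOn.mono (Icc_subset_Icc le_rfl hs.2))).norm
  -- Evaluating the energy inequality at a maximum point `z` gives `M² ≤ const · M · s`. Division by
  -- `M` yields a bound linear in `s`, where a Young splitting would only give the square root of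
  -- `s`.
  obtain ⟨z, hz, hmax⟩ := isCompact_Icc.exists_isMaxOn ⟨0, le_rfl, hs.1⟩ hcont
  have hmax' : ∀ r ∈ Icc 0 s, ‖J (y r)‖ ≤ ‖J (y z)‖ := fun r hr => hmax hr
  set M := ‖J (y z)‖ with hM
  refine (hmax' s ⟨hs.1, le_rfl⟩).trans ?_
  have hzT : z ∈ Icc 0 T := ⟨hz.1, hz.2.trans hs.2⟩
  have hM0 : 0 ≤ M := norm_nonneg _
  have h := hy.energy_le ha (ψ := fun _ => 1) (ψ' := fun _ => 0)
      (k := fun r => 2 * B * M)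
      (fun x => hasDerivAt_const x 1) continuous_const (fun _ => zero_le_one) hzT
      intervalIntegrable_const (Eventually.of_forall fun r hr => ?_)
  · simp only [one_mul, h0, norm_zero, ne_eq, OfNat.ofNat_ne_zero, not_false_eq_true, zero_pow,
      zero_add, ← hM] at h
    have e1 : ∫ r in (0:ℝ)..z, Real.exp (-2 * β * r) * (2 * B * M) ≤ 2 * B * M * s := by
      calc _ ≤ ∫ r in (0:ℝ)..z, 2 * B * M := by
            refine integral_mono_on hz.1 (Continuous.intervalIntegrable (by fun_prop) _ _)
              intervalIntegrable_const fun r hr => ?_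
            refine mul_le_of_le_one_left (by positivity) (Real.exp_le_one_iff.2 ?_)
            have := mul_nonneg hβ hr.1; linarith
        _ = 2 * B * M * z := by simp; ring
        _ ≤ _ := by gcongr; exact hz.2
    have e2 : Real.exp (-2 * β * T) * M ^ 2 ≤ Real.exp (-2 * β * z) * M ^ 2 := by
      have : β * z ≤ β * T := mul_le_mul_of_nonneg_left hzT.2 hβ
      gcongr ?_ * _
      exact Real.exp_le_exp.2 (by linarith)
    have e3 := mul_le_mul_of_nonneg_left (e2.trans (h.trans e1)) (Real.exp_pos (2 * β * T)).le
    have hE : Real.exp (2 * β * T) * Real.exp (-2 * β * T) = 1 := by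
      rw [← Real.exp_add]; ring_nf; exact Real.exp_zero
    rw [← mul_assoc, hE] at e3
    rcases hM0.eq_or_lt with h' | h'
    · rw [← h']; have := hs.1; positivity
    · refine le_of_mul_le_mul_right ?_ h'
      calc M * M = 1 * M ^ 2 := by ring
        _ ≤ _ := e3
        _ = _ := by ring
  · have h1 := (le_abs_self _).trans (hL r ⟨hr.1.le, hr.2.trans hzT.2⟩ (y r))
    have h2 := mul_le_mul_of_nonneg_left (hmax' r ⟨hr.1.le, hr.2.trans hz.2⟩) hB
    have h3 : 0 ≤ α * ‖y r‖ ^ 2 := by positivity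
    linarith

/-- The form does not depend on time, so difference quotients solve the same kind of equation on a
shorter interval. This replaces differentiating the equation in time, for which `y'` is not regular
enough. -/
theorem differenceQuotient (hy : IsEvol J a L T y y') {h : ℝ} (hh : 0 < h) (hT : h ≤ T) :
    IsEvol J a (dq h L) (T - h) (dq h y) (dq h y') where
  memLp := by
    have h1 : MemLp (fun s => y' (s + h)) 2 (volume.restrict (Ioc 0 (T - h))) := by
      have hp := (measurePreserving_add_right (volume : Measure ℝ) h).restrict_preimage
        (measurableSet_Ioc (a := h) (b := T))
      have he : (fun x => x + h) ⁻¹' Ioc h T = Ioc 0 (T - h) := by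
        ext x; simp only [mem_preimage, mem_Ioc]; constructor <;> rintro ⟨_, _⟩ <;>
          constructor <;> linarith
      rw [he] at hp
      exact (hy.memLp.mono_measure
        (Measure.restrict_mono (Ioc_subset_Ioc_left hh.le) le_rfl)).comp_measurePreserving hp
    have h2 : MemLp y' 2 (volume.restrict (Ioc 0 (T - h))) :=
      hy.memLp.mono_measure (Measure.restrict_mono (Ioc_subset_Ioc_right (by linarith)) le_rfl)
    exact (h1.sub h2).const_smul h⁻¹
  eq_integral := by
    intro s hs
    have m0 : (0:ℝ) ∈ Icc 0 T := ⟨le_rfl, hh.le.trans hT⟩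
    have mh : h ∈ Icc 0 T := ⟨hh.le, hT⟩
    have ms : s ∈ Icc 0 T := ⟨hs.1, by linarith [hs.2]⟩
    have msh : s + h ∈ Icc 0 T := ⟨by linarith [hs.1], by linarith [hs.2]⟩
    have hi : IntervalIntegrable (fun x => y' (x + h)) volume 0 s := by
      have := (hy.intervalIntegrable mh msh).comp_add_right h
      simpa using this
    simp only [dq]
    rw [intervalIntegral.integral_smul, intervalIntegral.integral_sub hi
      (hy.intervalIntegrable m0 ms), intervalIntegral.integral_comp_add_right (fun x => y' x) h,
      zero_add, ← hy.sub_eq mh msh, ← hy.sub_eq m0 ms, ← smul_add]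
    congr 1; abel
  weak := by
    have hs : ∀ᵐ s, s + h ∈ Ioc 0 T → ∀ φ,
        inner ℝ (J (y' (s + h))) (J φ) + a (y (s + h)) φ = L (s + h) φ :=
      (measurePreserving_add_right (volume : Measure ℝ) h).quasiMeasurePreserving.ae hy.weak
    filter_upwards [hy.weak, hs] with s h1 h2 hs φ
    have e1 := h1 ⟨hs.1, by linarith [hs.2]⟩ φ
    have e2 := h2 ⟨by linarith [hs.1], by linarith [hs.2]⟩ φ
    simp only [dq, map_smul, map_sub, inner_smul_left, inner_sub_left, smul_eq_mul,
      smul_apply, sub_apply, ← e1, ← e2]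
    simp only [conj_trivial]
    ring

end IsEvol
end Evolution

/-! ### Time averages and weighted bounds for difference quotients. -/

section Evolution

open intervalIntegral

/-- The variance `∫ (f - c)²` about the average `c` is nonnegative; expanding it gives the claim. -/
theorem sq_average_le {f : ℝ → ℝ} {s h : ℝ} (hh : 0 < h)
    (hf : IntervalIntegrable f volume s (s + h))
    (hf2 : IntervalIntegrable (fun r => f r ^ 2) volume s (s + h)) :
    (h⁻¹ * ∫ r in s..s + h, f r) ^ 2 ≤ h⁻¹ * ∫ r in s..s + h, f r ^ 2 := by
  set c := h⁻¹ * ∫ r in s..s + h, f r with hc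
  have h0 : 0 ≤ ∫ r in s..s + h, (f r - c) ^ 2 :=
    integral_nonneg (by linarith) fun _ _ => sq_nonneg _
  have e : ∫ r in s..s + h, (f r - c) ^ 2 =
      (∫ r in s..s + h, f r ^ 2) - 2 * c * (∫ r in s..s + h, f r) + h * c ^ 2 := by
    rw [← intervalIntegral.integral_const_mul, ← intervalIntegral.integral_sub hf2
      (hf.const_mul _), show h * c ^ 2 = ∫ r in s..s + h, c ^ 2 by simp,
      ← intervalIntegral.integral_add (hf2.sub (hf.const_mul _)) intervalIntegrable_const]
    congr 1; ext r; ring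
  have e2 : ∫ r in s..s + h, f r = h * c := by rw [hc]; field_simp
  rw [e, e2] at h0
  rw [← sub_nonneg]
  have : h⁻¹ * (∫ r in s..s + h, f r ^ 2) - c ^ 2 = h⁻¹ * ((∫ r in s..s + h, f r ^ 2) -
      2 * c * (h * c) + h * c ^ 2) := by field_simp; ring
  rw [this]; positivity

theorem continuousOn_average {f : ℝ → ℝ} {T h : ℝ} (hh : 0 < h) (hT : h ≤ T)
    (hf : IntervalIntegrable f volume 0 T) :
    ContinuousOn (fun s => h⁻¹ * ∫ r in s..s + h, f r) (Icc 0 (T - h)) := by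
  have hT0 : 0 ≤ T := hh.le.trans hT
  have hF : ContinuousOn (fun s => ∫ r in (0:ℝ)..s, f r) (Icc 0 T) := by
    have := continuousOn_primitive_interval (μ := volume) (f := f) (a := 0) (b := T)
      (by rw [uIcc_of_le hT0, integrableOn_Icc_iff_integrableOn_Ioc]
          exact (intervalIntegrable_iff_integrableOn_Ioc_of_le hT0).1 hf)
    rwa [uIcc_of_le hT0] at this
  have hsub : ∀ x ∈ Icc 0 T, IntervalIntegrable f volume 0 x := fun x hx =>
    hf.mono_set (by rw [uIcc_of_le hT0, uIcc_of_le hx.1]; exact Icc_subset_Icc le_rfl hx.2)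
  have h1 : ContinuousOn (fun s => (∫ r in (0:ℝ)..(s + h), f r) - ∫ r in (0:ℝ)..s, f r)
      (Icc 0 (T - h)) := by
    refine (hF.comp (Continuous.continuousOn (by fun_prop)) ?_).sub (hF.mono ?_)
    · intro x hx; exact ⟨by linarith [hx.1], by linarith [hx.2]⟩
    · exact Icc_subset_Icc le_rfl (by linarith)
  refine ((continuousOn_const (c := h⁻¹)).mul h1).congr fun s hs => ?_
  rw [Pi.mul_apply, integral_interval_sub_left (hsub _ ⟨by linarith [hs.1], by linarith [hs.2]⟩)
    (hsub _ ⟨hs.1, by linarith [hs.2]⟩)]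

/-- In terms of the primitive `F` of `f`, the double integral telescopes to `h⁻¹ (∫_{T-h}^T F -
∫_0^h F)`. Since `F` is nonnegative and increasing, this is at most `F T`. No exchange of integrals
is involved. -/
theorem integral_average_le {f : ℝ → ℝ} {T h : ℝ} (hh : 0 < h) (hT : h ≤ T) (h0 : ∀ r, 0 ≤ f r)
    (hf : IntervalIntegrable f volume 0 T) :
    ∫ s in (0:ℝ)..(T - h), h⁻¹ * ∫ r in s..s + h, f r ≤ ∫ r in (0:ℝ)..T, f r := by
  have hT0 : 0 ≤ T := hh.le.trans hT
  set F : ℝ → ℝ := fun s => ∫ r in (0:ℝ)..s, f r with hFdef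
  have hF : ContinuousOn F (Icc 0 T) := by
    have := continuousOn_primitive_interval (μ := volume) (f := f) (a := 0) (b := T)
      (by rw [uIcc_of_le hT0, integrableOn_Icc_iff_integrableOn_Ioc]
          exact (intervalIntegrable_iff_integrableOn_Ioc_of_le hT0).1 hf)
    rwa [uIcc_of_le hT0] at this
  have hFi : ∀ x ∈ Icc 0 T, ∀ z ∈ Icc 0 T, IntervalIntegrable F volume x z := fun x hx z hz =>
    (hF.mono (ordConnected_Icc.uIcc_subset hx hz)).intervalIntegrable
  have hsub : ∀ x ∈ Icc 0 T, IntervalIntegrable f volume 0 x := fun x hx =>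
    hf.mono_set (by rw [uIcc_of_le hT0, uIcc_of_le hx.1]; exact Icc_subset_Icc le_rfl hx.2)
  have m0 : (0:ℝ) ∈ Icc 0 T := ⟨le_rfl, hT0⟩
  have mT : T ∈ Icc 0 T := ⟨hT0, le_rfl⟩
  have mh : h ∈ Icc 0 T := ⟨hh.le, hT⟩
  have mTh : T - h ∈ Icc 0 T := ⟨by linarith, by linarith⟩
  have hshift : IntervalIntegrable (fun s => F (s + h)) volume 0 (T - h) := by
    have := (hFi h mh T mT).comp_add_right h
    simpa using this
  have e : ∫ s in (0:ℝ)..(T - h), h⁻¹ * ∫ r in s..s + h, f r =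
      h⁻¹ * ((∫ s in (T - h)..T, F s) - ∫ s in (0:ℝ)..h, F s) := by
    rw [intervalIntegral.integral_const_mul]
    congr 1
    have : ∫ s in (0:ℝ)..(T - h), ∫ r in s..s + h, f r =
        ∫ s in (0:ℝ)..(T - h), (F (s + h) - F s) := by
      refine integral_congr fun s hs => ?_
      rw [uIcc_of_le (by linarith : (0:ℝ) ≤ T - h)] at hs
      exact (integral_interval_sub_left (hsub _ ⟨by linarith [hs.1], by linarith [hs.2]⟩)
        (hsub _ ⟨hs.1, by linarith [hs.2]⟩)).symm
    rw [this, intervalIntegral.integral_sub hshift (hFi 0 m0 _ mTh),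
      intervalIntegral.integral_comp_add_right (fun x => F x) h, zero_add, sub_add_cancel]
    have e1 := integral_add_adjacent_intervals (hFi 0 m0 h mh) (hFi h mh T mT)
    have e2 := integral_add_adjacent_intervals (hFi 0 m0 _ mTh) (hFi _ mTh T mT)
    linarith
  rw [e]
  have hF0 : ∀ s ∈ Icc 0 T, 0 ≤ F s := fun s hs => integral_nonneg hs.1 fun r _ => h0 r
  have hFT : ∀ s ∈ Icc 0 T, F s ≤ F T := fun s hs =>
    integral_mono_interval le_rfl hs.1 hs.2 (Eventually.of_forall h0) hf
  have b1 : 0 ≤ ∫ s in (0:ℝ)..h, F s :=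
    integral_nonneg hh.le fun s hs => hF0 s ⟨hs.1, hs.2.trans hT⟩
  have b2 : ∫ s in (T - h)..T, F s ≤ h * F T := by
    calc _ ≤ ∫ s in (T - h)..T, F T :=
          integral_mono_on (by linarith) (hFi _ mTh _ mT) intervalIntegrable_const fun s hs =>
            hFT s ⟨by linarith [hs.1], hs.2⟩
      _ = _ := by simp
  calc h⁻¹ * ((∫ s in (T - h)..T, F s) - ∫ s in (0:ℝ)..h, F s) ≤ h⁻¹ * (h * F T) := by
        gcongr; linarith
    _ = F T := by field_simp

theorem integral_sq_average_le {f : ℝ → ℝ} {T h : ℝ} (hh : 0 < h) (hT : h ≤ T)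
    (hf : IntervalIntegrable f volume 0 T)
    (hf2 : IntervalIntegrable (fun r => f r ^ 2) volume 0 T) :
    ∫ s in (0:ℝ)..(T - h), (h⁻¹ * ∫ r in s..s + h, f r) ^ 2 ≤ ∫ r in (0:ℝ)..T, f r ^ 2 := by
  refine le_trans ?_ (integral_average_le hh hT (fun r => sq_nonneg (f r)) hf2)
  have h0 : 0 ≤ T - h := by linarith
  refine integral_mono_on h0 ?_ ?_ fun s hs => ?_
  · apply ContinuousOn.intervalIntegrable
    rw [uIcc_of_le h0]
    exact (continuousOn_average hh hT hf).pow 2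
  · apply ContinuousOn.intervalIntegrable
    rw [uIcc_of_le h0]
    exact continuousOn_average hh hT hf2
  · have hsub : uIcc s (s + h) ⊆ uIcc 0 T := by
      rw [uIcc_of_le (by linarith), uIcc_of_le (by linarith)]
      exact Icc_subset_Icc hs.1 (by linarith [hs.2])
    exact sq_average_le hh (hf.mono_set hsub) (hf2.mono_set hsub)

variable {V H : Type*} [NormedAddCommGroup V] [InnerProductSpace ℝ V]
  [NormedAddCommGroup H] [InnerProductSpace ℝ H]

namespace IsEvol

variable {J : V →L[ℝ] H} {a : V →L[ℝ] V →L[ℝ] ℝ} {L : ℝ → V →L[ℝ] ℝ} {T : ℝ} {y y' : ℝ → V}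

theorem norm_dq_le (hy : IsEvol J a L T y y') {h s : ℝ} (hh : 0 < h) (hs : 0 ≤ s)
    (hsT : s + h ≤ T) : ‖dq h y s‖ ≤ h⁻¹ * ∫ r in s..s + h, ‖y' r‖ := by
  have m1 : s ∈ Icc 0 T := ⟨hs, by linarith⟩
  have m2 : s + h ∈ Icc 0 T := ⟨by linarith, hsT⟩
  rw [dq, norm_smul, Real.norm_of_nonneg (by positivity), hy.sub_eq m1 m2]
  gcongr
  exact norm_integral_le_integral_norm (by linarith)

/-- A difference quotient is the average of `y'` over `[s, s + h]`, and averaging does not increase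
the `L²` norm. The bound is uniform in `h`. -/
theorem integral_norm_dq_sq_le (hy : IsEvol J a L T y y') {h : ℝ} (hh : 0 < h) (hT : h ≤ T) :
    ∫ s in (0:ℝ)..(T - h), ‖dq h y s‖ ^ 2 ≤ ∫ r in (0:ℝ)..T, ‖y' r‖ ^ 2 := by
  have m0 : (0:ℝ) ∈ Icc 0 T := ⟨le_rfl, hh.le.trans hT⟩
  have mT : T ∈ Icc 0 T := ⟨hh.le.trans hT, le_rfl⟩
  have hi := (hy.intervalIntegrable m0 mT).norm
  refine le_trans ?_ (integral_sq_average_le hh hT hi (hy.intervalIntegrable_norm_sq m0 mT))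
  have h0 : 0 ≤ T - h := by linarith
  refine integral_mono_on h0 ?_ ?_ fun s hs => ?_
  · apply ContinuousOn.intervalIntegrable
    rw [uIcc_of_le h0]
    exact ((hy.differenceQuotient hh hT).continuousOn.norm).pow 2
  · apply ContinuousOn.intervalIntegrable
    rw [uIcc_of_le h0]
    exact (continuousOn_average hh hT hi).pow 2
  · exact pow_le_pow_left₀ (norm_nonneg _)
      (hy.norm_dq_le hh hs.1 (by linarith [hs.2])) 2

/-- The `H`-norm of a difference quotient is controlled through the equation. -/
theorem normSq_dq_le [CompleteSpace V] (hy : IsEvol J a L T y y') {A : ℝ}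
    (hA : ∀ v φ, |a v φ| ≤ A * ‖v‖ * ‖φ‖) {m : ℝ → ℝ} (hmi : IntervalIntegrable m volume 0 T)
    (hm : ∀ᵐ r, r ∈ Ioc 0 T → ∀ φ, |L r φ| ≤ m r * ‖φ‖) {h s : ℝ} (hh : 0 < h) (hs : 0 ≤ s)
    (hsT : s + h ≤ T) : ‖J (dq h y s)‖ ^ 2 ≤
      ‖dq h y s‖ * (h⁻¹ * ∫ r in s..s + h, (m r + A * ‖y r‖)) := by
  have m1 : s ∈ Icc 0 T := ⟨hs, by linarith⟩
  have m2 : s + h ∈ Icc 0 T := ⟨by linarith, hsT⟩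
  set φ := dq h y s with hφ
  have hsub : uIcc s (s + h) ⊆ uIcc 0 T := by
    rw [uIcc_of_le (by linarith), uIcc_of_le (by linarith)]
    exact Icc_subset_Icc hs hsT
  have hyi : IntervalIntegrable (fun r => ‖y r‖) volume s (s + h) := by
    apply ContinuousOn.intervalIntegrable
    rw [uIcc_of_le (by linarith)]
    exact (hy.continuousOn.mono (Icc_subset_Icc hs hsT)).norm
  -- One factor of the square is written as an average of `J (y' r)` while the other is kept as a
  -- fixed test function. The weak equation then replaces `y'` by the source and the form, so no
  -- bound on `y'` enters.
  have e1 : ‖J φ‖ ^ 2 = h⁻¹ * ∫ r in s..s + h, inner ℝ (J φ) (J (y' r)) := by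
    have := ((innerSL ℝ (J φ)).comp J).intervalIntegral_comp_comm (hy.intervalIntegrable m1 m2)
    simp only [ContinuousLinearMap.comp_apply, innerSL_apply_apply] at this
    rw [this, ← hy.sub_eq m1 m2, ← real_inner_self_eq_norm_sq]
    nth_rw 2 [hφ]
    rw [dq, map_smul, inner_smul_right]
  rw [e1, mul_left_comm, ← intervalIntegral.integral_const_mul ‖φ‖]
  refine mul_le_mul_of_nonneg_left ?_ (by positivity)
  refine (le_abs_self _).trans ((Real.norm_eq_abs _).symm.le.trans ?_)
  refine norm_integral_le_of_norm_le (by linarith) ?_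
    (((hmi.mono_set hsub).add (hyi.const_mul A)).const_mul _)
  filter_upwards [hm, hy.weak] with r h1 h2 hr
  have hr' : r ∈ Ioc 0 T := ⟨hs.trans_lt hr.1, hr.2.trans hsT⟩
  have e2 := h2 hr' φ
  have e3 := h1 hr' φ
  have e4 := hA (y r) φ
  rw [real_inner_comm, Real.norm_eq_abs,
    show inner ℝ (J (y' r)) (J φ) = L r φ - a (y r) φ by linarith]
  refine (abs_sub _ _).trans ?_
  linarith

/-- Parabolic smoothing: a weighted bound for difference quotients. -/
theorem dq_bound [CompleteSpace V] (hy : IsEvol J a L T y y') {α β A : ℝ}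
    (hα : 0 < α) (hβ : 0 ≤ β) (ha : ∀ v, α * ‖v‖ ^ 2 ≤ a v v + β * ‖J v‖ ^ 2)
    (hA : ∀ v φ, |a v φ| ≤ A * ‖v‖ * ‖φ‖) {m n : ℝ → ℝ}
    (hmi : IntervalIntegrable m volume 0 T)
    (hm2 : IntervalIntegrable (fun r => (m r + A * ‖y r‖) ^ 2) volume 0 T)
    (hm : ∀ᵐ r, r ∈ Ioc 0 T → ∀ φ, |L r φ| ≤ m r * ‖φ‖) {h : ℝ} (hh : 0 < h) (hT : h ≤ T)
    (hn2 : IntervalIntegrable (fun r => n r ^ 2) volume 0 (T - h))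
    (hn : ∀ᵐ r, r ∈ Ioc 0 (T - h) → ∀ φ, r * |dq h L r φ| ≤ n r * ‖φ‖)
    {s : ℝ} (hs : s ∈ Icc 0 (T - h)) :
    s ^ 2 * ‖J (dq h y s)‖ ^ 2 ≤ Real.exp (2 * β * T) * (α⁻¹ *
      ((∫ r in (0:ℝ)..T, (m r + A * ‖y r‖) ^ 2) + ∫ r in (0:ℝ)..(T - h), n r ^ 2)) := by
  have h0T : 0 ≤ T := hh.le.trans hT
  have h0 : 0 ≤ T - h := by linarith
  have hyi : IntervalIntegrable (fun r => ‖y r‖) volume 0 T := by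
    apply ContinuousOn.intervalIntegrable
    rw [uIcc_of_le h0T]
    exact hy.continuousOn.norm
  set p : ℝ → ℝ := fun s => h⁻¹ * ∫ r in s..s + h, (m r + A * ‖y r‖) with hp
  have hpi := hmi.add (hyi.const_mul A)
  have hpc : ContinuousOn p (Icc 0 (T - h)) := continuousOn_average hh hT hpi
  have hp2 : IntervalIntegrable (fun r => p r ^ 2) volume 0 (T - h) := by
    apply ContinuousOn.intervalIntegrable
    rw [uIcc_of_le h0]
    exact hpc.pow 2
  have hpI : ∫ r in (0:ℝ)..(T - h), p r ^ 2 ≤ ∫ r in (0:ℝ)..T, (m r + A * ‖y r‖) ^ 2 :=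
    integral_sq_average_le hh hT hpi hm2
  have hki := ((hp2.add hn2).const_mul α⁻¹)
  have hsub : uIcc 0 s ⊆ uIcc 0 (T - h) := by
    rw [uIcc_of_le hs.1, uIcc_of_le h0]; exact Icc_subset_Icc le_rfl hs.2
  -- The weight `x²` vanishes at zero and removes the initial value of the difference quotient. Its
  -- price is the term `2 r ‖J (dq h y r)‖²`, which `normSq_dq_le` bounds by `2 r ‖dq h y r‖ p r`.
  have hen := (hy.differenceQuotient hh hT).energy_le ha (ψ := fun x => x ^ 2)
    (ψ' := fun x => 2 * x) (k := fun r => α⁻¹ * (p r ^ 2 + n r ^ 2))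
    (fun x => by simpa using hasDerivAt_pow 2 x) (by fun_prop) (fun x => sq_nonneg x) hs
    (hki.mono_set hsub) ?_
  · have e1 : ∫ r in (0:ℝ)..s, Real.exp (-2 * β * r) * (α⁻¹ * (p r ^ 2 + n r ^ 2)) ≤
        α⁻¹ * ((∫ r in (0:ℝ)..T, (m r + A * ‖y r‖) ^ 2) + ∫ r in (0:ℝ)..(T - h), n r ^ 2) := by
      have hexp : Continuous fun r : ℝ => Real.exp (-2 * β * r) := by fun_prop
      calc _ ≤ ∫ r in (0:ℝ)..s, α⁻¹ * (p r ^ 2 + n r ^ 2) := by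
            refine integral_mono_on hs.1 ((hki.mono_set hsub).continuousOn_mul hexp.continuousOn)
              (hki.mono_set hsub) fun r hr => ?_
            refine mul_le_of_le_one_left (by positivity) (Real.exp_le_one_iff.2 ?_)
            have := mul_nonneg hβ hr.1; linarith
        _ ≤ ∫ r in (0:ℝ)..(T - h), α⁻¹ * (p r ^ 2 + n r ^ 2) :=
            integral_mono_interval le_rfl hs.1 hs.2
              (Eventually.of_forall fun r => by simp only [Pi.zero_apply]; positivity) hki
        _ = α⁻¹ * ((∫ r in (0:ℝ)..(T - h), p r ^ 2) + ∫ r in (0:ℝ)..(T - h), n r ^ 2) := by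
            rw [intervalIntegral.integral_const_mul, intervalIntegral.integral_add hp2 hn2]
        _ ≤ _ := by gcongr
    have e2 : Real.exp (-2 * β * T) * (s ^ 2 * ‖J (dq h y s)‖ ^ 2) ≤
        Real.exp (-2 * β * s) * (s ^ 2 * ‖J (dq h y s)‖ ^ 2) := by
      have : β * s ≤ β * T := mul_le_mul_of_nonneg_left (by linarith [hs.2]) hβ
      gcongr ?_ * _
      exact Real.exp_le_exp.2 (by linarith)
    simp only [ne_eq, OfNat.ofNat_ne_zero, not_false_eq_true, zero_pow, zero_mul,
      zero_add] at hen
    have e3 := mul_le_mul_of_nonneg_left (e2.trans (hen.trans e1)) (Real.exp_pos (2 * β * T)).le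
    have hE : Real.exp (2 * β * T) * Real.exp (-2 * β * T) = 1 := by
      rw [← Real.exp_add]; ring_nf; exact Real.exp_zero
    rwa [← mul_assoc, hE, one_mul] at e3
  · filter_upwards [hn] with r hr hr'
    have hr1 : r ∈ Ioc 0 (T - h) := ⟨hr'.1, hr'.2.trans hs.2⟩
    have f1 := hr hr1 (dq h y r)
    have f2 := hy.normSq_dq_le hA hmi hm hh hr1.1.le (by linarith [hr1.2] : r + h ≤ T)
    have f3 : r * dq h L r (dq h y r) ≤ n r * ‖dq h y r‖ :=
      (mul_le_mul_of_nonneg_left (le_abs_self _) hr1.1.le).trans f1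
    change ‖J (dq h y r)‖ ^ 2 ≤ ‖dq h y r‖ * p r at f2
    set Y := ‖dq h y r‖
    have f4 := mul_le_mul_of_nonneg_left f2 (by linarith [hr1.1] : 0 ≤ 2 * r)
    have f5 := mul_le_mul_of_nonneg_left f3 (by linarith [hr1.1] : 0 ≤ 2 * r)
    -- Two Young inequalities, for the term from the weight and for the source; each uses up `α r²
    -- Y²`, exactly exhausting the available `2 α r² Y²`.
    have g1 : 0 ≤ α⁻¹ * (p r - α * (r * Y)) ^ 2 := by positivity
    have g2 : 0 ≤ α⁻¹ * (n r - α * (r * Y)) ^ 2 := by positivity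
    have g3 : α⁻¹ * (p r - α * (r * Y)) ^ 2 + α⁻¹ * (n r - α * (r * Y)) ^ 2 =
      α⁻¹ * (p r ^ 2 + n r ^ 2) - 2 * r * (Y * p r) - 2 * r * (n r * Y)
        + r ^ 2 * (2 * α * Y ^ 2) := by field_simp; ring
    have g4 : r ^ 2 * (2 * dq h L r (dq h y r)) = 2 * r * (r * dq h L r (dq h y r)) := by ring
    linarith

/-- Bounds on difference quotients pass to the derivative. -/
theorem ae_norm_deriv_le [CompleteSpace V] (hy : IsEvol J a L T y y') {K : ℝ → ℝ}
    (hK : ∀ s ∈ Ioo 0 T, ∀ h, 0 < h → s + h ≤ T → ‖J (dq h y s)‖ ≤ K s) :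
    ∀ᵐ s, s ∈ Ioo 0 T → ‖J (y' s)‖ ≤ K s := by
  filter_upwards [hy.ae_hasDerivAt] with s hs hs'
  have h1 := (hasDerivAt_iff_tendsto_slope_zero.1 (hs hs')).mono_left
    (nhdsWithin_mono (0:ℝ) (s := Ioi 0) fun x hx => ne_of_gt hx)
  refine le_of_tendsto ((J.continuous.tendsto _).comp h1).norm ?_
  filter_upwards [Ioo_mem_nhdsGT (by linarith [hs'.2] : (0:ℝ) < T - s)] with h hh
  exact hK s hs' h hh.1 (by linarith [hh.2])

end IsEvol
end Evolution

/-! ### Regularity in time, uniform in the form. -/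

section Evolution

open intervalIntegral

variable {V H : Type*} [NormedAddCommGroup V] [InnerProductSpace ℝ V]
  [NormedAddCommGroup H] [InnerProductSpace ℝ H]

/-- The functional `φ ↦ (g, J φ)`. -/
def srcFn (J : V →L[ℝ] H) (g : H) : V →L[ℝ] ℝ := (innerSL ℝ g).comp J

theorem srcFn_apply (J : V →L[ℝ] H) (g : H) (φ : V) : srcFn J g φ = inner ℝ g (J φ) := by
  simp [srcFn]

theorem dq_srcFn (J : V →L[ℝ] H) (F : ℝ → H) (h s : ℝ) :
    dq h (fun s => srcFn J (F s)) s = srcFn J (dq h F s) := by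
  ext φ
  simp [dq, srcFn_apply, inner_smul_left, inner_sub_left]

theorem abs_srcFn_le (J : V →L[ℝ] H) (g : H) (φ : V) : |srcFn J g φ| ≤ ‖J‖ * ‖g‖ * ‖φ‖ := by
  rw [srcFn_apply]
  calc _ ≤ ‖g‖ * ‖J φ‖ := abs_real_inner_le_norm _ _
    _ ≤ ‖g‖ * (‖J‖ * ‖φ‖) := by gcongr; exact J.le_opNorm _
    _ = _ := by ring

theorem continuousOn_dq {E : Type*} [NormedAddCommGroup E] [NormedSpace ℝ E] {F : ℝ → E} {T h : ℝ}
    (hF : ContinuousOn F (Icc 0 T)) (hh : 0 ≤ h) : ContinuousOn (dq h F) (Icc 0 (T - h)) := by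
  refine ContinuousOn.const_smul ((hF.comp (Continuous.continuousOn (by fun_prop)) ?_).sub
    (hF.mono (Icc_subset_Icc le_rfl (by linarith)))) _
  intro x hx; exact ⟨by linarith [hx.1], by linarith [hx.2]⟩

theorem le_sqrt_of_sq_mul_sq_le {s x K : ℝ} (h : s ^ 2 * x ^ 2 ≤ K) : s * x ≤ √K :=
  Real.le_sqrt_of_sq_le (by rwa [mul_pow])

/-- Second difference quotients of a solution with a constant source. -/
theorem IsEvol.exists_second_dq_bound [CompleteSpace V] {J : V →L[ℝ] H} {a : V →L[ℝ] V →L[ℝ] ℝ} {l : V →L[ℝ] ℝ}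
    {T : ℝ} {u u' : ℝ → V} (hu : IsEvol J a (fun _ => l) T u u') {α β A : ℝ}
    (hα : 0 < α) (hβ : 0 ≤ β) (ha : ∀ v, α * ‖v‖ ^ 2 ≤ a v v + β * ‖J v‖ ^ 2)
    (hA : ∀ v φ, |a v φ| ≤ A * ‖v‖ * ‖φ‖) :
    ∃ C, 0 ≤ C ∧ ∀ h k s, 0 < h → 0 < k → 0 ≤ s → s + h + k ≤ T →
      s * ‖J (dq k (dq h u) s)‖ ≤ C := by
  refine ⟨√(Real.exp (2 * β * T) * (α⁻¹ * (A ^ 2 * ∫ r in (0:ℝ)..T, ‖u' r‖ ^ 2))),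
    Real.sqrt_nonneg _, fun h k s hh hk hs hT => le_sqrt_of_sq_mul_sq_le ?_⟩
  have hhT : h ≤ T := by linarith
  have hd := hu.differenceQuotient hh hhT
  have h0 : 0 ≤ T - h := by linarith
  have hL : ∀ r, dq h (fun _ : ℝ => l) r = 0 := fun r => by simp [dq]
  have hc : ContinuousOn (fun r => ‖dq h u r‖ ^ 2) (Icc 0 (T - h)) := hd.continuousOn.norm.pow 2
  have hci : IntervalIntegrable (fun r => ‖dq h u r‖ ^ 2) volume 0 (T - h) := by
    apply ContinuousOn.intervalIntegrable; rwa [uIcc_of_le h0]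
  have e : ∀ r, ((0:ℝ) + A * ‖dq h u r‖) ^ 2 = A ^ 2 * ‖dq h u r‖ ^ 2 := fun r => by ring
  -- The first difference quotient has zero source because `l` is constant in time. Hence `m = n =
  -- 0`, and only the `V`-norm of `dq h u` remains; it is controlled by `u'`.
  have := hd.dq_bound hα hβ ha hA (m := fun _ => 0) (n := fun _ => 0) intervalIntegrable_const
    (by simp only [e]; exact hci.const_mul _)
    (Eventually.of_forall fun r _ φ => by simp [hL]) hk (by linarith)
    intervalIntegrable_const
    (Eventually.of_forall fun r _ φ => by simp [dq])
    (s := s) ⟨hs, by linarith⟩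
  refine this.trans ?_
  simp only [e, intervalIntegral.integral_const_mul]
  have e1 := hu.integral_norm_dq_sq_le hh hhT
  have e2 : 0 ≤ ∫ s in (0:ℝ)..(T - h), ‖dq h u s‖ ^ 2 := integral_nonneg h0 fun _ _ => by positivity
  have : 2 * β * (T - h) ≤ 2 * β * T := by
    have := mul_nonneg hβ hh.le; linarith
  simp only [ne_eq, OfNat.ofNat_ne_zero, not_false_eq_true, zero_pow, intervalIntegral.integral_zero,
    add_zero]
  gcongr

/-- Time regularity of solutions starting from zero, uniformly in the form. -/
theorem exists_regularity_bound [CompleteSpace V] (J : V →L[ℝ] H) {T : ℝ} (hT : 0 < T) {F : ℝ → H} {B D₁ D₂ : ℝ}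
    (hF : ContinuousOn F (Icc 0 T)) (hB : ∀ s ∈ Icc 0 T, ‖F s‖ ≤ B)
    (hD₁ : ∀ h, 0 < h → h ≤ T → ∫ s in (0:ℝ)..(T - h), ‖dq h F s‖ ^ 2 ≤ D₁)
    (hD₂ : ∀ h k s, 0 < h → 0 < k → 0 ≤ s → s + h + k ≤ T → s * ‖dq k (dq h F) s‖ ≤ D₂)
    {α β A : ℝ} (hα : 0 < α) (hβ : 0 ≤ β) :
    ∃ C, 0 ≤ C ∧ ∀ a : V →L[ℝ] V →L[ℝ] ℝ, (∀ v, α * ‖v‖ ^ 2 ≤ a v v + β * ‖J v‖ ^ 2) →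
      (∀ v φ, |a v φ| ≤ A * ‖v‖ * ‖φ‖) → ∀ y y' : ℝ → V,
      IsEvol J a (fun s => srcFn J (F s)) T y y' → J (y 0) = 0 →
      (∀ s ∈ Icc 0 T, ‖J (y s)‖ ≤ C) ∧
      (∀ h s, 0 < h → 0 ≤ s → s + h ≤ T → ‖J (dq h y s)‖ ≤ C) ∧
      (∀ h k s, 0 < h → 0 < k → 0 ≤ s → s + h + k ≤ T → s * ‖J (dq k (dq h y) s)‖ ≤ C) := by
  have hB0 : 0 ≤ B := (norm_nonneg _).trans (hB 0 ⟨le_rfl, hT.le⟩)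
  -- Nonnegativity comes from degenerate instances of the hypotheses: `h = T` gives an interval of
  -- length zero, and below `s = 0` annihilates the second quotient.
  have hD₁0 : 0 ≤ D₁ := by
    refine le_trans ?_ (hD₁ T hT le_rfl)
    simp
  have hD₂0 : 0 ≤ D₂ := by
    refine le_trans ?_ (hD₂ (T/2) (T/2) 0 (by linarith) (by linarith) le_rfl (by linarith))
    simp
  -- `K` bounds the first difference quotient at time zero, `E` is the unweighted energy bound for
  -- first quotients, and `G` is the weighted bound for second quotients. They depend on the form
  -- only through `α`, `β` and `A`.
  set K := Real.exp (2 * β * T) * (2 * B) with hK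
  set E := Real.exp (2 * β * T) * (K ^ 2 + α⁻¹ * (‖J‖ ^ 2 * D₁)) with hE
  set G := Real.exp (2 * β * T) * (α⁻¹ * ((2 * (‖J‖ ^ 2 * D₁) + 2 * A ^ 2 * (α⁻¹ * E)) +
    T * (‖J‖ * D₂) ^ 2)) with hG
  have hK0 : 0 ≤ K := by positivity
  have hE0 : 0 ≤ E := by positivity
  refine ⟨K * T + √E + √G, by positivity, fun a ha hA y y' hy hy0 => ?_⟩
  have st1 : ∀ s ∈ Icc 0 T, ‖J (y s)‖ ≤ K * s := fun s hs =>
    hy.norm_le_mul_time hα hβ ha hB0 (fun r hr φ => by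
      rw [srcFn_apply]
      exact (abs_real_inner_le_norm _ _).trans (by gcongr; exact hB r hr)) hy0 hs
  have st2 : ∀ h, 0 < h → h ≤ T → (∀ s ∈ Icc 0 (T - h), ‖J (dq h y s)‖ ^ 2 ≤ E) ∧
      α * ∫ r in (0:ℝ)..(T - h), ‖dq h y r‖ ^ 2 ≤ E := by
    intro h hh hhT
    have hd := hy.differenceQuotient hh hhT
    have h0 : 0 ≤ T - h := by linarith
    have hc : ContinuousOn (fun r => ‖dq h F r‖ ^ 2) (Icc 0 (T - h)) :=
      (continuousOn_dq hF hh.le).norm.pow 2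
    have hci : IntervalIntegrable (fun r => ‖dq h F r‖ ^ 2) volume 0 (T - h) := by
      apply ContinuousOn.intervalIntegrable; rwa [uIcc_of_le h0]
    have e : ∀ r, (‖J‖ * ‖dq h F r‖) ^ 2 = ‖J‖ ^ 2 * ‖dq h F r‖ ^ 2 := fun r => by ring
    have := hd.energy_bound h0 hα hβ ha (m := fun r => ‖J‖ * ‖dq h F r‖)
      (by simp only [e]; exact hci.const_mul _)
      (Eventually.of_forall fun r _ φ => by rw [dq_srcFn]; exact abs_srcFn_le _ _ _)
    have hle : Real.exp (2 * β * (T - h)) * (‖J (dq h y 0)‖ ^ 2 +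
        α⁻¹ * ∫ r in (0:ℝ)..(T - h), (‖J‖ * ‖dq h F r‖) ^ 2) ≤ E := by
      -- Since `J (y 0) = 0`, this quotient is `h⁻¹ J (y h)`, and the linear growth bound cancels
      -- the factor `h⁻¹`.
      have i1 : ‖J (dq h y 0)‖ ≤ K := by
        have := st1 h ⟨hh.le, hhT⟩
        simp only [dq, zero_add, map_smul, map_sub, hy0, sub_zero, norm_smul, norm_inv,
          Real.norm_of_nonneg hh.le]
        rw [inv_mul_le_iff₀ hh]; linarith
      have i2 : 2 * β * (T - h) ≤ 2 * β * T := by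
        have := mul_nonneg hβ hh.le; linarith
      have i3 := hD₁ h hh hhT
      have i4 : 0 ≤ ∫ s in (0:ℝ)..(T - h), ‖dq h F s‖ ^ 2 :=
        integral_nonneg h0 fun _ _ => by positivity
      simp only [e, intervalIntegral.integral_const_mul]
      rw [hE]
      gcongr
    exact ⟨fun s hs => (this.1 s hs).trans hle, this.2.trans hle⟩
  refine ⟨fun s hs => ?_, fun h s hh hs hsT => ?_, fun h k s hh hk hs hsT => ?_⟩
  · have := mul_le_mul_of_nonneg_left hs.2 hK0
    have := st1 s hs
    have := Real.sqrt_nonneg E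
    have := Real.sqrt_nonneg G
    linarith
  · have := Real.le_sqrt_of_sq_le ((st2 h hh (by linarith)).1 s ⟨hs, by linarith⟩)
    have := mul_nonneg hK0 hT.le
    have := Real.sqrt_nonneg G
    linarith
  · have hhT : h ≤ T := by linarith
    have h0 : 0 ≤ T - h := by linarith
    have h0k : 0 ≤ T - h - k := by linarith
    have hd := hy.differenceQuotient hh hhT
    have hcF := continuousOn_dq hF hh.le
    have hcy := hd.continuousOn
    have hi : ∀ {f : ℝ → ℝ}, ContinuousOn f (Icc 0 (T - h)) →
        IntervalIntegrable f volume 0 (T - h) := fun hf => by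
      apply ContinuousOn.intervalIntegrable; rwa [uIcc_of_le h0]
    -- The smoothing estimate is applied to the equation of the first difference quotient, whose own
    -- source has the weighted quotient bound `‖J‖ D₂`.
    have hb := hd.dq_bound hα hβ ha hA (m := fun r => ‖J‖ * ‖dq h F r‖)
      (n := fun _ => ‖J‖ * D₂) (hi (continuousOn_const.mul hcF.norm))
      (hi (((continuousOn_const.mul hcF.norm).add (continuousOn_const.mul hcy.norm)).pow 2))
      (Eventually.of_forall fun r _ φ => by rw [dq_srcFn]; exact abs_srcFn_le _ _ _) hk
      (by linarith) intervalIntegrable_const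
      (Eventually.of_forall fun r hr φ => ?_) (s := s) ⟨hs, by linarith⟩
    · have i1 : ∫ r in (0:ℝ)..(T - h), (‖J‖ * ‖dq h F r‖ + A * ‖dq h y r‖) ^ 2 ≤
          2 * (‖J‖ ^ 2 * D₁) + 2 * A ^ 2 * (α⁻¹ * E) := by
        calc _ ≤ ∫ r in (0:ℝ)..(T - h), (2 * ‖J‖ ^ 2 * ‖dq h F r‖ ^ 2 +
              2 * A ^ 2 * ‖dq h y r‖ ^ 2) := by
              refine integral_mono_on h0 (hi (((continuousOn_const.mul hcF.norm).add
                (continuousOn_const.mul hcy.norm)).pow 2))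
                (hi ((continuousOn_const.mul (hcF.norm.pow 2)).add
                  (continuousOn_const.mul (hcy.norm.pow 2)))) fun r _ => ?_
              have := sq_nonneg (‖J‖ * ‖dq h F r‖ - A * ‖dq h y r‖)
              nlinarith
          _ = 2 * ‖J‖ ^ 2 * (∫ r in (0:ℝ)..(T - h), ‖dq h F r‖ ^ 2) +
              2 * A ^ 2 * ∫ r in (0:ℝ)..(T - h), ‖dq h y r‖ ^ 2 := by
              rw [intervalIntegral.integral_add, intervalIntegral.integral_const_mul,
                intervalIntegral.integral_const_mul]
              · exact hi (continuousOn_const.mul (hcF.norm.pow 2))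
              · exact hi (continuousOn_const.mul (hcy.norm.pow 2))
          _ ≤ 2 * ‖J‖ ^ 2 * D₁ + 2 * A ^ 2 * (α⁻¹ * E) := by
              gcongr
              · exact hD₁ h hh hhT
              · rw [le_inv_mul_iff₀ hα]; exact (st2 h hh hhT).2
          _ = _ := by ring
      have i2 : ∫ r in (0:ℝ)..(T - h - k), (‖J‖ * D₂) ^ 2 ≤ T * (‖J‖ * D₂) ^ 2 := by
        simp only [intervalIntegral.integral_const, smul_eq_mul]
        gcongr; linarith
      have i3 : 2 * β * (T - h) ≤ 2 * β * T := by
        have := mul_nonneg hβ hh.le; linarith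
      have i4 : 0 ≤ ∫ r in (0:ℝ)..(T - h), (‖J‖ * ‖dq h F r‖ + A * ‖dq h y r‖) ^ 2 :=
        integral_nonneg h0 fun _ _ => by positivity
      have i5 : 0 ≤ ∫ r in (0:ℝ)..(T - h - k), (‖J‖ * D₂) ^ 2 :=
        integral_nonneg h0k fun _ _ => by positivity
      have : s ^ 2 * ‖J (dq k (dq h y) s)‖ ^ 2 ≤ G := hb.trans (by rw [hG]; gcongr)
      have := le_sqrt_of_sq_mul_sq_le this
      have := mul_nonneg hK0 hT.le
      have := Real.sqrt_nonneg E
      linarith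
    · have e : dq k (dq h fun s => srcFn J (F s)) r = srcFn J (dq k (dq h F) r) := by
        rw [← dq_srcFn]; congr 1; ext1 x; exact dq_srcFn J F h x
      rw [e]
      calc _ ≤ r * (‖J‖ * ‖dq k (dq h F) r‖ * ‖φ‖) := by
            have := hr.1.le
            gcongr; exact abs_srcFn_le _ _ _
        _ = ‖J‖ * (r * ‖dq k (dq h F) r‖) * ‖φ‖ := by ring
        _ ≤ _ := by
            gcongr
            exact hD₂ h k r hh hk hr.1.le (by linarith [hr.2])

end Evolution

/-! ### Lipschitz dependence on the form. -/

section Evolution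

open intervalIntegral

variable {V H : Type*} [NormedAddCommGroup V] [InnerProductSpace ℝ V]
  [NormedAddCommGroup H] [InnerProductSpace ℝ H]

/-- The whole perturbation is placed on `y₂`: the difference is governed by the coercive form `a₁`,
and its source `(a₂ - a₁)(y₂)` involves only the solution whose own elliptic equation has the form
`a₂`. -/
theorem IsEvol.sub {J : V →L[ℝ] H} {a₁ a₂ : V →L[ℝ] V →L[ℝ] ℝ} {L : ℝ → V →L[ℝ] ℝ}
    {T : ℝ} {y₁ y₁' y₂ y₂' : ℝ → V} (h₁ : IsEvol J a₁ L T y₁ y₁') (h₂ : IsEvol J a₂ L T y₂ y₂') :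
    IsEvol J a₁ (fun s => a₂ (y₂ s) - a₁ (y₂ s)) T (fun s => y₁ s - y₂ s)
      (fun s => y₁' s - y₂' s) where
  memLp := h₁.memLp.sub h₂.memLp
  eq_integral := fun s hs => by
    have h0 : (0 : ℝ) ∈ Icc 0 T := ⟨le_rfl, hs.1.trans hs.2⟩
    rw [intervalIntegral.integral_sub (h₁.intervalIntegrable h0 hs) (h₂.intervalIntegrable h0 hs),
      h₁.eq_integral s hs, h₂.eq_integral s hs]
    abel
  weak := by
    filter_upwards [h₁.weak, h₂.weak] with s e₁ e₂ hs φ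
    have f₁ := e₁ hs φ
    have f₂ := e₂ hs φ
    simp only [map_sub, inner_sub_left, sub_apply]
    linarith

/-- A set of full measure is dense, so an almost everywhere bound reaches the right endpoint by
continuity. This turns estimates valid at almost every time into one at the prescribed time. -/
theorem le_of_ae_le_Ioo {f : ℝ → ℝ} {c t K : ℝ} (hct : c < t) (hf : ContinuousOn f (Icc c t))
    (h : ∀ᵐ s, s ∈ Ioo c t → f s ≤ K) : f t ≤ K := by
  have hd : Dense {s | s ∈ Ioo c t → f s ≤ K} := Measure.dense_of_ae h
  have hcl : t ∈ closure (Ioo c t ∩ {s | s ∈ Ioo c t → f s ≤ K}) := by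
    have h1 := closure_mono (hd.open_subset_closure_inter (isOpen_Ioo (a := c) (b := t)))
    rw [closure_closure, closure_Ioo hct.ne] at h1
    exact h1 ⟨hct.le, le_rfl⟩
  have := mem_closure_iff_nhdsWithin_neBot.1 hcl
  have h2 : 𝓝[Ioo c t ∩ {s | s ∈ Ioo c t → f s ≤ K}] t ≤ 𝓝[Icc c t] t :=
    nhdsWithin_mono _ (inter_subset_left.trans Ioo_subset_Icc_self)
  refine le_of_tendsto ((hf t ⟨hct.le, le_rfl⟩).tendsto.mono_left h2) ?_
  filter_upwards [self_mem_nhdsWithin] with s hs using hs.2 hs.1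

set_option maxHeartbeats 1000000 in
/-- The Lipschitz estimate for abstract evolution equations whose forms satisfy an elliptic
perturbation estimate. -/
theorem exists_lipschitz_bound [CompleteSpace V] (J : V →L[ℝ] H) {T t : ℝ} (ht : t ∈ Ioc 0 T)
    {F : ℝ → H} {B D₁ D₂ : ℝ}
    (hF : ContinuousOn F (Icc 0 T)) (hB : ∀ s ∈ Icc 0 T, ‖F s‖ ≤ B)
    (hD₁ : ∀ h, 0 < h → h ≤ T → ∫ s in (0:ℝ)..(T - h), ‖dq h F s‖ ^ 2 ≤ D₁)
    (hD₂ : ∀ h k s, 0 < h → 0 < k → 0 ≤ s → s + h + k ≤ T → s * ‖dq k (dq h F) s‖ ≤ D₂)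
    {α β A : ℝ} (hα : 0 < α) (hβ : 0 ≤ β) :
    ∃ C, 0 ≤ C ∧ ∀ a₁ a₂ : V →L[ℝ] V →L[ℝ] ℝ,
      (∀ v, α * ‖v‖ ^ 2 ≤ a₁ v v + β * ‖J v‖ ^ 2) → (∀ v φ, |a₁ v φ| ≤ A * ‖v‖ * ‖φ‖) →
      (∀ v, α * ‖v‖ ^ 2 ≤ a₂ v v + β * ‖J v‖ ^ 2) → (∀ v φ, |a₂ v φ| ≤ A * ‖v‖ * ‖φ‖) →
      ∀ δ, 0 ≤ δ → (∀ v g, (∀ φ, a₂ v φ = inner ℝ g (J φ)) →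
        ∀ φ, |a₂ v φ - a₁ v φ| ≤ δ * (‖g‖ + ‖J v‖) * ‖φ‖) →
      ∀ y₁ y₁' y₂ y₂' : ℝ → V, IsEvol J a₁ (fun s => srcFn J (F s)) T y₁ y₁' →
      IsEvol J a₂ (fun s => srcFn J (F s)) T y₂ y₂' → J (y₁ 0) = 0 → J (y₂ 0) = 0 →
      ‖y₁ t - y₂ t‖ ^ 2 ≤ C * δ ^ 2 := by
  have hT : 0 < T := ht.1.trans_le ht.2
  obtain ⟨C, hC0, hC⟩ := exists_regularity_bound J hT hF hB hD₁ hD₂ (A := A) hα hβ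
  have hB0 : 0 ≤ B := (norm_nonneg _).trans (hB 0 ⟨le_rfl, hT.le⟩)
  have hD₁0 : 0 ≤ D₁ := by
    refine le_trans ?_ (hD₁ T hT le_rfl)
    simp
  -- `M` bounds `‖F‖ + ‖J y₂'‖ + ‖J y₂‖`. The constants `E`, `G` and `R` are the bounds for the
  -- energy, the weighted time quotient and the final estimate after the factor `δ²` is taken out.
  set M := B + 2 * C with hM
  set E := Real.exp (2 * β * T) * (α⁻¹ * (T * M ^ 2)) with hE
  set G := Real.exp (2 * β * T) * (α⁻¹ * ((2 * (T * M ^ 2) + 2 * A ^ 2 * (α⁻¹ * E)) +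
    (2 * T ^ 2 * D₁ + T * (2 * (C + T * C) ^ 2)))) with hG
  set R := 2 * α⁻¹ * (α⁻¹ * M ^ 2 + √G * (2 / t) * √E + β * E) with hR
  have hM0 : 0 ≤ M := by positivity
  have hE0 : 0 ≤ E := by positivity
  have ht0 := ht.1
  refine ⟨R, by positivity, fun a₁ a₂ ha₁ hA₁ ha₂ hA₂ δ hδ hell y₁ y₁' y₂ y₂' h₁ h₂ h₁0 h₂0 => ?_⟩
  obtain ⟨r1, r2, r3⟩ := hC a₂ ha₂ hA₂ y₂ y₂' h₂ h₂0
  have hw := h₁.sub h₂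
  have hw0 : J (y₁ 0 - y₂ 0) = 0 := by rw [map_sub, h₁0, h₂0, sub_zero]
  set w : ℝ → V := fun s => y₁ s - y₂ s with hwdef
  have hneT : ∀ x : ℝ, ∀ᵐ s : ℝ, s ≠ x := fun x => by simp [ae_iff, measure_singleton]
  -- At almost every time the evolution equation reads as an elliptic equation for `y₂ s` with
  -- right-hand side `F s - J (y₂' s)`, so the perturbation hypothesis applies.
  have hsrc : ∀ᵐ s, s ∈ Ioc 0 T → ∀ φ, |(a₂ (y₂ s) - a₁ (y₂ s)) φ| ≤ δ * M * ‖φ‖ := by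
    have hd := h₂.ae_norm_deriv_le (K := fun _ => C) fun s hs h hh hsh => r2 h s hh hs.1.le hsh
    filter_upwards [hd, h₂.weak, hneT T] with s hds hws hsT hs φ
    have hs' : s ∈ Ioo 0 T := ⟨hs.1, lt_of_le_of_ne hs.2 hsT⟩
    have h := hell (y₂ s) (F s - J (y₂' s)) (fun φ => by
      have := hws hs φ
      rw [srcFn_apply] at this
      rw [inner_sub_left]; linarith) φ
    rw [sub_apply]
    refine h.trans ?_
    gcongr
    have e1 := norm_sub_le (F s) (J (y₂' s))
    have e2 := hB s ⟨hs.1.le, hs.2⟩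
    have e3 := hds hs'
    have e4 := r1 s ⟨hs.1.le, hs.2⟩
    linarith
  have hen := hw.energy_bound hT.le hα hβ ha₁ (m := fun _ => δ * M) intervalIntegrable_const hsrc
  have hEe : Real.exp (2 * β * T) * (‖J (w 0)‖ ^ 2 + α⁻¹ * ∫ r in (0:ℝ)..T, (δ * M) ^ 2) =
      δ ^ 2 * E := by
    simp only [hwdef, hw0, norm_zero, intervalIntegral.integral_const, smul_eq_mul]
    rw [hE]; ring
  rw [hEe] at hen
  obtain ⟨en1, en2⟩ := hen
  have hJw : ∀ s ∈ Icc 0 T, ‖J (w s)‖ ≤ δ * √E := fun s hs => by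
    have := Real.le_sqrt_of_sq_le (en1 s hs)
    rwa [Real.sqrt_mul (sq_nonneg δ), Real.sqrt_sq hδ] at this
  have hwc := hw.continuousOn
  have hi : ∀ {f : ℝ → ℝ} {T : ℝ}, 0 ≤ T → ContinuousOn f (Icc 0 T) →
      IntervalIntegrable f volume 0 T := fun h0 hf => by
    apply ContinuousOn.intervalIntegrable; rwa [uIcc_of_le h0]
  have hdq : ∀ s ∈ Ioo 0 T, ∀ h, 0 < h → s + h ≤ T → ‖J (dq h w s)‖ ≤ δ * √G / s := by
    intro s hs h hh hsh
    have hhT : h ≤ T := by linarith [hs.1]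
    have h0 : 0 ≤ T - h := by linarith
    have hcF := continuousOn_dq hF hh.le
    -- The second-quotient bound for `y₂`, in the limit `k → 0`, controls the time derivative of `dq
    -- h y₂` by `C / s`. The factor `r` in the source condition of `dq_bound` compensates this
    -- singularity.
    have hd := (h₂.differenceQuotient hh hhT).ae_norm_deriv_le (K := fun s => C / s)
      fun s hs k hk hsk => by
        rw [le_div_iff₀ hs.1, mul_comm]; exact r3 h k s hh hk hs.1.le (by linarith)
    -- The source of `dq h w` is `a₂ - a₁` applied to `dq h y₂`, which itself solves an elliptic
    -- equation with right-hand side `dq h F - J (dq h y₂')`. The three parts of `n` come from `r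
    -- ‖dq h F‖`, `r ‖J (dq h y₂')‖ ≤ C` and `r ‖J (dq h y₂)‖ ≤ T C`.
    have hb := hw.dq_bound hα hβ ha₁ hA₁ (m := fun _ => δ * M)
      (n := fun r => δ * (T * ‖dq h F r‖ + (C + T * C))) intervalIntegrable_const
      (hi hT.le ((continuousOn_const.add (continuousOn_const.mul hwc.norm)).pow 2)) hsrc hh hhT
      (hi h0 ((continuousOn_const.mul ((continuousOn_const.mul hcF.norm).add
        continuousOn_const)).pow 2)) ?_ (s := s) ⟨hs.1.le, by linarith⟩
    · have i1 : ∫ r in (0:ℝ)..T, (δ * M + A * ‖w r‖) ^ 2 ≤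
          δ ^ 2 * (2 * (T * M ^ 2) + 2 * A ^ 2 * (α⁻¹ * E)) := by
        calc _ ≤ ∫ r in (0:ℝ)..T, (2 * (δ * M) ^ 2 + 2 * A ^ 2 * ‖w r‖ ^ 2) := by
              refine integral_mono_on hT.le (hi hT.le ((continuousOn_const.add
                (continuousOn_const.mul hwc.norm)).pow 2))
                (hi hT.le (continuousOn_const.add
                  (continuousOn_const.mul (hwc.norm.pow 2)))) fun r _ => ?_
              have := sq_nonneg (δ * M - A * ‖w r‖)
              nlinarith
          _ = T * (2 * (δ * M) ^ 2) + 2 * A ^ 2 * ∫ r in (0:ℝ)..T, ‖w r‖ ^ 2 := by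
              rw [intervalIntegral.integral_add, intervalIntegral.integral_const_mul (2 * A ^ 2)]
              · simp only [intervalIntegral.integral_const, smul_eq_mul, sub_zero]
              · exact intervalIntegrable_const
              · exact hi hT.le (continuousOn_const.mul (hwc.norm.pow 2))
          _ ≤ T * (2 * (δ * M) ^ 2) + 2 * A ^ 2 * (α⁻¹ * (δ ^ 2 * E)) := by
              gcongr
              rw [le_inv_mul_iff₀ hα]; exact en2
          _ = _ := by ring
      have i2 : ∫ r in (0:ℝ)..(T - h), (δ * (T * ‖dq h F r‖ + (C + T * C))) ^ 2 ≤
          δ ^ 2 * (2 * T ^ 2 * D₁ + T * (2 * (C + T * C) ^ 2)) := by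
        calc _ ≤ ∫ r in (0:ℝ)..(T - h), (δ ^ 2 * (2 * T ^ 2) * ‖dq h F r‖ ^ 2 +
              δ ^ 2 * (2 * (C + T * C) ^ 2)) := by
              refine integral_mono_on h0 (hi h0 ((continuousOn_const.mul
                ((continuousOn_const.mul hcF.norm).add continuousOn_const)).pow 2))
                (hi h0 ((continuousOn_const.mul (hcF.norm.pow 2)).add continuousOn_const))
                fun r _ => ?_
              have := mul_nonneg (sq_nonneg δ) (sq_nonneg (T * ‖dq h F r‖ - (C + T * C)))
              nlinarith
          _ = δ ^ 2 * (2 * T ^ 2) * (∫ r in (0:ℝ)..(T - h), ‖dq h F r‖ ^ 2) +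
              (T - h) * (δ ^ 2 * (2 * (C + T * C) ^ 2)) := by
              rw [intervalIntegral.integral_add, intervalIntegral.integral_const_mul]
              · simp only [intervalIntegral.integral_const, smul_eq_mul, sub_zero]
              · exact hi h0 (continuousOn_const.mul (hcF.norm.pow 2))
              · exact intervalIntegrable_const
          _ ≤ δ ^ 2 * (2 * T ^ 2) * D₁ + T * (δ ^ 2 * (2 * (C + T * C) ^ 2)) := by
              gcongr
              · exact hD₁ h hh hhT
              · linarith
          _ = _ := by ring
      have i3 : s ^ 2 * ‖J (dq h w s)‖ ^ 2 ≤ δ ^ 2 * G := by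
        refine hb.trans ?_
        calc _ ≤ Real.exp (2 * β * T) * (α⁻¹ *
            (δ ^ 2 * (2 * (T * M ^ 2) + 2 * A ^ 2 * (α⁻¹ * E)) +
              δ ^ 2 * (2 * T ^ 2 * D₁ + T * (2 * (C + T * C) ^ 2)))) := by gcongr
          _ = _ := by rw [hG]; ring
      have i4 := le_sqrt_of_sq_mul_sq_le i3
      rw [Real.sqrt_mul (sq_nonneg δ), Real.sqrt_sq hδ] at i4
      rw [le_div_iff₀ hs.1]; linarith
    · filter_upwards [hd, (h₂.differenceQuotient hh hhT).weak, hneT (T - h)] with r hdr hwr hrT hr φ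
      have hr' : r ∈ Ioo 0 (T - h) := ⟨hr.1, lt_of_le_of_ne hr.2 hrT⟩
      have hl := hell (dq h y₂ r) (dq h F r - J (dq h y₂' r)) (fun φ => by
        have := hwr hr φ
        rw [dq_srcFn, srcFn_apply] at this
        rw [inner_sub_left]; linarith) φ
      have e0 : dq h (fun s => a₂ (y₂ s) - a₁ (y₂ s)) r φ =
          a₂ (dq h y₂ r) φ - a₁ (dq h y₂ r) φ := by
        simp only [dq, map_smul, map_sub, smul_apply, sub_apply, smul_eq_mul]; ring
      rw [e0]
      have e1 := norm_sub_le (dq h F r) (J (dq h y₂' r))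
      have e3 := hdr hr'
      rw [le_div_iff₀ hr.1] at e3
      have e4 := r2 h r hh hr.1.le (by linarith [hr.2])
      have hrT' : r ≤ T := by linarith [hr.2]
      calc _ ≤ r * (δ * (‖dq h F r - J (dq h y₂' r)‖ + ‖J (dq h y₂ r)‖) * ‖φ‖) :=
            mul_le_mul_of_nonneg_left hl hr.1.le
        _ ≤ r * (δ * (‖dq h F r‖ + ‖J (dq h y₂' r)‖ + C) * ‖φ‖) := by
            have := hr.1.le
            gcongr
        _ = δ * (r * ‖dq h F r‖ + (‖J (dq h y₂' r)‖ * r + r * C)) * ‖φ‖ := by ring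
        _ ≤ _ := by gcongr
  have hwd := hw.ae_norm_deriv_le hdq
  -- On `(t/2, t)` the factor `1 / s` is at most `2 / t`. There `w'` is of order `δ` in `H`, and
  -- coercivity with test function `w s` bounds the full norm of `w s`.
  refine le_of_ae_le_Ioo (c := t / 2) (f := fun s => ‖w s‖ ^ 2) (by linarith)
    ((hwc.mono (Icc_subset_Icc (by linarith) ht.2)).norm.pow 2) ?_
  filter_upwards [hwd, hw.weak, hsrc] with s hs1 hs2 hs3 hs
  have m1 : s ∈ Ioo 0 T := ⟨by linarith [hs.1], by linarith [hs.2, ht.2]⟩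
  have m2 : s ∈ Ioc 0 T := ⟨m1.1, m1.2.le⟩
  have e1 := ha₁ (w s)
  have e2 := hs2 m2 (w s)
  have e3 := (le_abs_self _).trans (hs3 m2 (w s))
  have e4 := hJw s ⟨m1.1.le, m1.2.le⟩
  have e5 := en1 s ⟨m1.1.le, m1.2.le⟩
  have e6 : δ * √G / s ≤ δ * √G * (2 / t) := by
    rw [div_eq_mul_inv]
    gcongr
    rw [inv_le_comm₀ m1.1 (by positivity), inv_div]
    exact hs.1.le
  have e7 : |inner ℝ (J (y₁' s - y₂' s)) (J (w s))| ≤ δ * √G * (2 / t) * (δ * √E) :=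
    (abs_real_inner_le_norm _ _).trans
      (mul_le_mul ((hs1 m1).trans e6) e4 (norm_nonneg _) (by positivity))
  have e8 := (abs_le.1 e7).1
  have e9 : δ * M * ‖w s‖ ≤ α⁻¹ * (δ * M) ^ 2 + α / 2 * ‖w s‖ ^ 2 := by
    have h1 : 0 ≤ α⁻¹ * (δ * M - α / 2 * ‖w s‖) ^ 2 := by positivity
    have h2 : α⁻¹ * (δ * M - α / 2 * ‖w s‖) ^ 2 =
      α⁻¹ * (δ * M) ^ 2 - δ * M * ‖w s‖ + α / 4 * ‖w s‖ ^ 2 := by field_simp; ring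
    have h3 : 0 ≤ α / 4 * ‖w s‖ ^ 2 := by positivity
    linarith
  have e10 := mul_le_mul_of_nonneg_left e5 hβ
  have e11 : α / 2 * ‖w s‖ ^ 2 ≤
      δ ^ 2 * (α⁻¹ * M ^ 2 + √G * (2 / t) * √E + β * E) := by linarith
  calc ‖w s‖ ^ 2 = 2 * α⁻¹ * (α / 2 * ‖w s‖ ^ 2) := by field_simp
    _ ≤ 2 * α⁻¹ * (δ ^ 2 * (α⁻¹ * M ^ 2 + √G * (2 / t) * √E + β * E)) := by gcongr
    _ = _ := by rw [hR]; ring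

end Evolution

/-! ### Sobolev spaces: norms, test functions and elementary inequalities. -/

section Sobolev

variable {Ω : Set Plane}

/-- An element of `H¹(Ω)` from a function and its weak derivatives. -/
def H1.ofWeakDeriv (u : L2 Ω) (g : Fin 2 → L2 Ω) (h : ∀ i, IsWeakDeriv Ω i u (g i)) : H1 Ω :=
  ⟨WithLp.toLp 2 (u, WithLp.toLp 2 g), h⟩

theorem H1.isWeakDeriv (w : H1 Ω) (i : Fin 2) : IsWeakDeriv Ω i w.fn (w.grad i) := w.2 i

theorem H1.norm_sq (w : H1 Ω) : ‖w‖ ^ 2 = ‖w.fn‖ ^ 2 + w.seminorm ^ 2 :=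
  WithLp.prod_norm_sq_eq_of_L2 _

theorem H1.seminorm_sq (w : H1 Ω) : w.seminorm ^ 2 = ∑ i, ‖w.grad i‖ ^ 2 :=
  PiLp.norm_sq_eq_of_L2 _ _

theorem H1.seminorm_nonneg (w : H1 Ω) : 0 ≤ w.seminorm := norm_nonneg _

theorem H1.norm_fn_le (w : H1 Ω) : ‖w.fn‖ ≤ ‖w‖ := by
  refine le_of_sq_le_sq ?_ (norm_nonneg _)
  rw [w.norm_sq]; nlinarith [sq_nonneg w.seminorm]

theorem H1.seminorm_le (w : H1 Ω) : w.seminorm ≤ ‖w‖ := by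
  refine le_of_sq_le_sq ?_ (norm_nonneg _)
  rw [w.norm_sq]; nlinarith [sq_nonneg ‖w.fn‖]

theorem H1.norm_grad_le_seminorm (w : H1 Ω) (i : Fin 2) : ‖w.grad i‖ ≤ w.seminorm :=
  PiLp.norm_apply_le w.grad i

theorem H1.norm_grad_le (w : H1 Ω) (i : Fin 2) : ‖w.grad i‖ ≤ ‖w‖ :=
  (w.norm_grad_le_seminorm i).trans w.seminorm_le

/-- The embedding `H¹(Ω) → L²(Ω)`. -/
def fnL (Ω : Set Plane) : H1 Ω →L[ℝ] L2 Ω :=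
  LinearMap.mkContinuous { toFun := H1.fn, map_add' := fun _ _ => rfl, map_smul' := fun _ _ => rfl }
    1 fun w => (one_mul ‖w‖).symm ▸ w.norm_fn_le

/-- The weak partial derivative `H¹(Ω) → L²(Ω)`. -/
def gradL (Ω : Set Plane) (i : Fin 2) : H1 Ω →L[ℝ] L2 Ω :=
  LinearMap.mkContinuous
    { toFun := fun w => w.grad i, map_add' := fun _ _ => rfl, map_smul' := fun _ _ => rfl }
    1 fun w => (one_mul ‖w‖).symm ▸ w.norm_grad_le i

theorem H1.fn_sub (w w' : H1 Ω) : (w - w').fn = w.fn - w'.fn := rfl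
theorem H1.grad_sub (w w' : H1 Ω) (i : Fin 2) : (w - w').grad i = w.grad i - w'.grad i := rfl
theorem H1.fn_neg (w : H1 Ω) : (-w).fn = -w.fn := rfl
theorem H1.grad_neg (w : H1 Ω) (i : Fin 2) : (-w).grad i = -w.grad i := rfl

theorem H1.tendsto_iff {w : ℕ → H1 Ω} {w₀ : H1 Ω} :
    Tendsto w atTop (𝓝 w₀) ↔ Tendsto (fun n => (w n).fn) atTop (𝓝 w₀.fn) ∧
      ∀ i, Tendsto (fun n => (w n).grad i) atTop (𝓝 (w₀.grad i)) := by
  constructor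
  · intro h
    exact ⟨((fnL Ω).continuous.tendsto _).comp h, fun i => ((gradL Ω i).continuous.tendsto _).comp h⟩
  · rintro ⟨h1, h2⟩
    rw [tendsto_iff_norm_sub_tendsto_zero] at h1 ⊢
    have h2' := fun i => tendsto_iff_norm_sub_tendsto_zero.1 (h2 i)
    have h3 : Tendsto (fun n => ‖w n - w₀‖ ^ 2) atTop (𝓝 0) := by
      have : Tendsto (fun n => ‖(w n).fn - w₀.fn‖ ^ 2 + ∑ i, ‖(w n).grad i - w₀.grad i‖ ^ 2) atTop
          (𝓝 (0 ^ 2 + ∑ i : Fin 2, 0 ^ 2)) :=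
        (h1.pow 2).add (tendsto_finsetSum _ fun i _ => (h2' i).pow 2)
      simp only [H1.norm_sq, H1.seminorm_sq, H1.fn_sub, H1.grad_sub]
      simpa using this
    have h4 := (Real.continuous_sqrt.tendsto _).comp h3
    simpa [Function.comp_def, Real.sqrt_sq (norm_nonneg _)] using h4

/-! ### Test functions -/

theorem IsTest.continuous {φ : Plane → ℝ} (h : IsTest Ω φ) : Continuous φ := h.1.continuous

theorem IsTest.differentiable {φ : Plane → ℝ} (h : IsTest Ω φ) : Differentiable ℝ φ :=
  h.1.differentiable (by simp)

theorem IsTest.zero : IsTest Ω (fun _ => 0) :=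
  ⟨contDiff_const, HasCompactSupport.zero, by simp [tsupport]⟩

theorem IsTest.of_tsupport_subset {φ ψ : Plane → ℝ} (h : IsTest Ω φ)
    (hψ : ContDiff ℝ (⊤ : ℕ∞) ψ) (hs : Function.support ψ ⊆ Function.support φ) : IsTest Ω ψ :=
  ⟨hψ, h.2.1.mono hs, (closure_mono hs).trans h.2.2⟩

theorem IsTest.add {φ ψ : Plane → ℝ} (h : IsTest Ω φ) (h' : IsTest Ω ψ) :
    IsTest Ω (fun x => φ x + ψ x) :=
  ⟨h.1.add h'.1, h.2.1.add h'.2.1, (tsupport_add φ ψ).trans (union_subset h.2.2 h'.2.2)⟩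

theorem IsTest.const_mul {φ : Plane → ℝ} (h : IsTest Ω φ) (c : ℝ) :
    IsTest Ω (fun x => c * φ x) :=
  h.of_tsupport_subset (contDiff_const.mul h.1) fun _ hx => right_ne_zero_of_mul hx

theorem IsTest.mul {φ ψ : Plane → ℝ} (h : IsTest Ω φ) (h' : ContDiff ℝ (⊤ : ℕ∞) ψ) :
    IsTest Ω (fun x => φ x * ψ x) :=
  h.of_tsupport_subset (h.1.mul h') fun _ hx => left_ne_zero_of_mul hx

theorem IsTest.pderiv_eq_zero {φ : Plane → ℝ} (h : IsTest Ω φ) {x : Plane} (hx : x ∉ Ω)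
    (i : Fin 2) : pderiv i φ x = 0 := by
  have : x ∉ tsupport (fderiv ℝ φ) := fun hx' => hx (h.2.2 (tsupport_fderiv_subset ℝ hx'))
  simp [pderiv, image_eq_zero_of_notMem_tsupport this]

theorem IsTest.eq_zero {φ : Plane → ℝ} (h : IsTest Ω φ) {x : Plane} (hx : x ∉ Ω) : φ x = 0 :=
  image_eq_zero_of_notMem_tsupport fun hx' => hx (h.2.2 hx')

theorem IsTest.continuous_pderiv {φ : Plane → ℝ} (h : IsTest Ω φ) (i : Fin 2) :
    Continuous (pderiv i φ) :=
  (h.1.continuous_fderiv (by simp)).clm_apply continuous_const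

theorem pderiv_mul {φ ψ : Plane → ℝ} (h : Differentiable ℝ φ) (h' : Differentiable ℝ ψ)
    (i : Fin 2) (x : Plane) :
    pderiv i (fun x => φ x * ψ x) x = φ x * pderiv i ψ x + pderiv i φ x * ψ x := by
  have := fderiv_mul (h x) (h' x)
  simp only [pderiv]
  change (fderiv ℝ (φ * ψ) x) _ = _
  rw [this]
  simp; ring

theorem IsTest.integral_mul_pderiv {φ ψ : Plane → ℝ} (h : IsTest Ω φ) (h' : IsTest Ω ψ)
    (i : Fin 2) : ∫ x in Ω, φ x * pderiv i ψ x = -∫ x in Ω, pderiv i φ x * ψ x := by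
  rw [setIntegral_eq_integral_of_forall_compl_eq_zero fun x hx => by rw [h.eq_zero hx, zero_mul],
    setIntegral_eq_integral_of_forall_compl_eq_zero fun x hx => by rw [h'.eq_zero hx, mul_zero]]
  have hc : ∀ {f g : Plane → ℝ}, Continuous f → HasCompactSupport f → Continuous g →
      Integrable (fun x => f x * g x) := fun hf hs hg =>
    (hf.mul hg).integrable_of_hasCompactSupport hs.mul_right
  exact integral_mul_fderiv_eq_neg_fderiv_mul_of_integrable
    (hc (h.continuous_pderiv i) (h.2.1.fderiv_apply (𝕜 := ℝ) _) h'.continuous)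
    (hc h.continuous h.2.1 (h'.continuous_pderiv i)) (hc h.continuous h.2.1 h'.continuous)
    (fun x _ => h.differentiable x) (fun x _ => h'.differentiable x)

/-- A test function as an element of `H¹(Ω)`. -/
def IsTest.toH1 {φ : Plane → ℝ} (h : IsTest Ω φ) : H1 Ω :=
  H1.ofWeakDeriv (h.memLp.toLp φ) (fun i => (h.memLp_pderiv i).toLp _) fun i ψ hψ => by
    have e1 : ∫ x in Ω, h.memLp.toLp φ x * pderiv i ψ x = ∫ x in Ω, φ x * pderiv i ψ x := by
      refine integral_congr_ae ?_
      filter_upwards [h.memLp.coeFn_toLp] with x hx using by rw [hx]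
    have e2 : ∫ x in Ω, (h.memLp_pderiv i).toLp _ x * ψ x = ∫ x in Ω, pderiv i φ x * ψ x := by
      refine integral_congr_ae ?_
      filter_upwards [(h.memLp_pderiv i).coeFn_toLp] with x hx using by rw [hx]
    rw [e1, e2, h.integral_mul_pderiv hψ]

theorem IsTest.coeFn_toH1 {φ : Plane → ℝ} (h : IsTest Ω φ) : h.toH1.fn =ᵐ[vol Ω] φ :=
  h.memLp.coeFn_toLp

theorem IsTest.coeFn_grad_toH1 {φ : Plane → ℝ} (h : IsTest Ω φ) (i : Fin 2) :
    h.toH1.grad i =ᵐ[vol Ω] pderiv i φ :=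
  (h.memLp_pderiv i).coeFn_toLp

theorem eq_zero_of_integral_test (hΩ : IsOpen Ω) {g : L2 Ω}
    (h : ∀ φ : Plane → ℝ, IsTest Ω φ → ∫ x in Ω, g x * φ x = 0) : g = 0 := by
  have hloc : LocallyIntegrableOn g Ω volume :=
    locallyIntegrableOn_of_locallyIntegrable_restrict ((Lp.memLp g).locallyIntegrable (by norm_num))
  have h0 := hΩ.ae_eq_zero_of_integral_contDiff_smul_eq_zero hloc fun φ h1 h2 h3 => by
    rw [← h φ ⟨h1, h2, h3⟩, ← setIntegral_eq_integral_of_forall_compl_eq_zero (s := Ω)]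
    · simp only [smul_eq_mul, mul_comm]
    · intro x hx
      rw [IsTest.eq_zero (Ω := Ω) ⟨h1, h2, h3⟩ hx, zero_smul]
  refine Lp.ext ?_
  filter_upwards [(ae_restrict_iff' hΩ.measurableSet).2 h0, Lp.coeFn_zero ℝ 2 (vol Ω)] with x h1 h2
  rw [h1, h2]; rfl

/-- The gradient component is determined by the function, because weak derivatives on an open set
are unique. -/
theorem H1.ext_fn (hΩ : IsOpen Ω) {w w' : H1 Ω} (h : w.fn = w'.fn) : w = w' := by
  have hg : ∀ i, w.grad i = w'.grad i := fun i => by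
    rw [← sub_eq_zero]
    refine eq_zero_of_integral_test hΩ fun φ hφ => ?_
    have h1 := (w - w').isWeakDeriv i φ hφ
    rw [H1.fn_sub, h, sub_self, H1.grad_sub] at h1
    have h2 : ∫ x in Ω, (0 : L2 Ω) x * pderiv i φ x = 0 := by
      rw [← integral_zero (Plane) ℝ (μ := vol Ω)]
      refine integral_congr_ae ?_
      filter_upwards [Lp.coeFn_zero ℝ 2 (vol Ω)] with x hx
      rw [hx]; simp
    rw [h2] at h1; linarith
  have : ‖w - w'‖ ^ 2 = 0 := by
    rw [H1.norm_sq, H1.seminorm_sq, H1.fn_sub, h]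
    simp [H1.grad_sub, hg]
  exact sub_eq_zero.1 (norm_eq_zero.1 (pow_eq_zero_iff (two_ne_zero) |>.1 this))

theorem IsTest.toH1_mem {φ : Plane → ℝ} (h : IsTest Ω φ) : h.toH1 ∈ H10 Ω :=
  (Submodule.span ℝ _).le_topologicalClosure (Submodule.subset_span ⟨φ, h, h.coeFn_toH1⟩)

theorem H10_isClosed : IsClosed (H10 Ω : Set (H1 Ω)) :=
  Submodule.isClosed_topologicalClosure _

/-- Functions in `H¹₀(Ω)` are limits of test functions. -/
theorem exists_seq_test (hΩ : IsOpen Ω) {w : H1 Ω} (hw : w ∈ H10 Ω) :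
    ∃ (φ : ℕ → Plane → ℝ) (hφ : ∀ n, IsTest Ω (φ n)),
      Tendsto (fun n => (hφ n).toH1) atTop (𝓝 w) ∧
      ∀ᵐ x ∂(vol Ω), Tendsto (fun n => φ n x) atTop (𝓝 (w.fn x)) := by
  -- The generating set of `H10` is already a subspace, so elements of its closure are limits of
  -- test functions themselves rather than of linear combinations.
  let S : Submodule ℝ (H1 Ω) :=
    { carrier := {w : H1 Ω | ∃ φ : Plane → ℝ, IsTest Ω φ ∧ w.fn =ᵐ[vol Ω] φ}
      zero_mem' := ⟨_, IsTest.zero, Lp.coeFn_zero _ _ _⟩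
      add_mem' := by
        rintro v v' ⟨φ, h, e⟩ ⟨φ', h', e'⟩
        exact ⟨_, h.add h', (Lp.coeFn_add v.fn v'.fn).trans (e.add e')⟩
      smul_mem' := by
        rintro c v ⟨φ, h, e⟩
        exact ⟨_, h.const_mul c, (Lp.coeFn_smul c v.fn).trans (e.const_smul c)⟩ }
  have hS : H10 Ω = S.topologicalClosure := by
    have : Submodule.span ℝ {w : H1 Ω | ∃ φ : Plane → ℝ, IsTest Ω φ ∧ w.fn =ᵐ[vol Ω] φ} = S :=
      Submodule.span_eq S
    rw [H10, this]
  have hw' : w ∈ closure (S : Set (H1 Ω)) := by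
    rw [hS] at hw; exact hw
  obtain ⟨v, hv, hlim⟩ := mem_closure_iff_seq_limit.1 hw'
  choose φ hφ he using hv
  have hv' : ∀ n, v n = (hφ n).toH1 := fun n =>
    H1.ext_fn hΩ (Lp.ext ((he n).trans (hφ n).coeFn_toH1.symm))
  obtain ⟨ns, hns, hae⟩ := (tendstoInMeasure_of_tendsto_Lp
    ((H1.tendsto_iff.1 hlim).1)).exists_seq_tendsto_ae
  refine ⟨fun n => φ (ns n), fun n => hφ _, ?_, ?_⟩
  · have := hlim.comp hns.tendsto_atTop
    simpa only [Function.comp_def, hv'] using this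
  · have hall : ∀ᵐ x ∂(vol Ω), ∀ n, (v n).fn x = φ n x := ae_all_iff.2 he
    filter_upwards [hae, hall] with x h1 h2
    simpa only [h2] using h1

theorem IsWeakDeriv.of_tendsto {i : Fin 2} {u g : ℕ → L2 Ω} {u₀ g₀ : L2 Ω}
    (h : ∀ n, IsWeakDeriv Ω i (u n) (g n)) (hu : Tendsto u atTop (𝓝 u₀))
    (hg : Tendsto g atTop (𝓝 g₀)) : IsWeakDeriv Ω i u₀ g₀ := by
  rw [isWeakDeriv_iff]
  intro φ hφ
  refine tendsto_nhds_unique ((tendsto_const_nhds.inner hu).add (tendsto_const_nhds.inner hg)) ?_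
  simp only [fun n => isWeakDeriv_iff.1 (h n) φ hφ]
  exact tendsto_const_nhds

/-- The weak derivative relation is closed in `L²` and `H10` is closed in `H1`. New elements of
`H10` are therefore produced from `L²` limits of functions and gradients, without checking any
integration by parts for the limit. -/
theorem exists_H10_of_tendsto {w : ℕ → H1 Ω} (hw : ∀ n, w n ∈ H10 Ω) {u : L2 Ω} {g : Fin 2 → L2 Ω}
    (hu : Tendsto (fun n => (w n).fn) atTop (𝓝 u))
    (hg : ∀ i, Tendsto (fun n => (w n).grad i) atTop (𝓝 (g i))) :
    ∃ v ∈ H10 Ω, v.fn = u ∧ (∀ i, v.grad i = g i) ∧ Tendsto w atTop (𝓝 v) := by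
  let v := H1.ofWeakDeriv u g fun i =>
    IsWeakDeriv.of_tendsto (fun n => (w n).isWeakDeriv i) hu (hg i)
  have hv : Tendsto w atTop (𝓝 v) := H1.tendsto_iff.2 ⟨hu, hg⟩
  exact ⟨v, H10_isClosed.mem_of_tendsto hv (Eventually.of_forall hw), rfl, fun _ => rfl, hv⟩

/-! ### Elementary inequalities -/

theorem inner_eq_integral (f g : L2 Ω) : inner ℝ f g = ∫ x in Ω, f x * g x := by
  rw [L2.inner_def]
  refine integral_congr_ae (Eventually.of_forall fun x => ?_)
  simp [mul_comm]

theorem integrable_mul (f g : L2 Ω) : Integrable (fun x => f x * g x) (vol Ω) :=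
  (Lp.memLp f).integrable_mul (Lp.memLp g)

theorem integral_abs_mul_le (f g : L2 Ω) : ∫ x in Ω, |f x * g x| ≤ ‖f‖ * ‖g‖ := by
  have h := real_inner_le_norm |f| |g|
  rw [norm_abs_eq_norm, norm_abs_eq_norm, inner_eq_integral] at h
  refine le_trans (le_of_eq (integral_congr_ae ?_)) h
  filter_upwards [Lp.coeFn_abs f, Lp.coeFn_abs g] with x h1 h2
  rw [h1, h2, abs_mul]

theorem norm_toLp_sq {f : Plane → ℝ} (hf : MemLp f 2 (vol Ω)) :
    ‖hf.toLp f‖ ^ 2 = ∫ x in Ω, f x ^ 2 := by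
  rw [← real_inner_self_eq_norm_sq, inner_eq_integral]
  refine integral_congr_ae ?_
  filter_upwards [hf.coeFn_toLp] with x hx
  rw [hx, sq]

theorem norm_sq_eq_integral (f : L2 Ω) : ‖f‖ ^ 2 = ∫ x in Ω, f x ^ 2 := by
  rw [← real_inner_self_eq_norm_sq, inner_eq_integral]
  simp only [sq]

variable [IsFiniteMeasure (vol Ω)]

/-- Cauchy–Schwarz against the indicator of `A`. The factor `√|A|` is the gain that drives the
iteration over level sets. -/
theorem integral_abs_le (g : L2 Ω) {A : Set Plane} (hA : MeasurableSet A)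
    (hg : ∀ᵐ x ∂(vol Ω), x ∉ A → g x = 0) :
    ∫ x in Ω, |g x| ≤ √((vol Ω).real A) * ‖g‖ := by
  have hm : MemLp (A.indicator fun _ => (1 : ℝ)) 2 (vol Ω) :=
    (memLp_const 1).indicator hA
  have h := integral_abs_mul_le (hm.toLp _) g
  have hn : ‖hm.toLp _‖ = √((vol Ω).real A) := by
    rw [eq_comm, Real.sqrt_eq_iff_eq_sq measureReal_nonneg (norm_nonneg _), norm_toLp_sq]
    have : ∀ x, (A.indicator (fun _ => (1 : ℝ)) x) ^ 2 = A.indicator 1 x := fun x => by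
      by_cases hx : x ∈ A <;> simp [hx]
    simp only [this]
    rw [integral_indicator_one hA]
  rw [hn] at h
  refine le_trans (le_of_eq (integral_congr_ae ?_)) h
  filter_upwards [hm.coeFn_toLp, hg] with x h1 h2
  rw [h1]
  by_cases hx : x ∈ A
  · simp [hx]
  · simp [hx, h2 hx]

end Sobolev

/-! ### Mollification and its convergence in `L²`. -/

section Mollification

/-- Mollification by a normed bump function. -/
def mollify (η : ContDiffBump (0 : Plane)) (g : Plane → ℝ) : Plane → ℝ :=
  convolution (η.normed volume) g (ContinuousLinearMap.lsmul ℝ ℝ) volume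

variable {η : ContDiffBump (0 : Plane)} {g : Plane → ℝ}

theorem integrable_normed_mul (hg : LocallyIntegrable g volume) (x : Plane) :
    Integrable (fun t => η.normed volume t * g (x - t)) :=
  η.hasCompactSupport_normed.convolutionExists_left (ContinuousLinearMap.lsmul ℝ ℝ)
    η.continuous_normed hg x

theorem mollify_apply (x : Plane) : mollify η g x = ∫ t, η.normed volume t * g (x - t) := rfl

/-- Jensen's inequality for a kernel of mass one, obtained by expanding the weighted variance about
`c`. -/
theorem sq_mollify_le (hg : MemLp g 2 volume) (x : Plane) :
    mollify η g x ^ 2 ≤ mollify η (fun y => g y ^ 2) x := by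
  have i1 := integrable_normed_mul (η := η) (hg.locallyIntegrable (by norm_num)) x
  have i2 := integrable_normed_mul (η := η) (hg.integrable_sq.locallyIntegrable) x
  have i3 : Integrable (fun t => η.normed volume t) := η.integrable_normed
  set c := mollify η g x with hc
  have h0 : 0 ≤ ∫ t, η.normed volume t * (g (x - t) - c) ^ 2 :=
    integral_nonneg fun t => mul_nonneg (η.nonneg_normed t) (sq_nonneg _)
  have e : ∫ t, η.normed volume t * (g (x - t) - c) ^ 2 =
      mollify η (fun y => g y ^ 2) x - 2 * c * mollify η g x + c ^ 2 := by
    have e1 : ∀ t, η.normed volume t * (g (x - t) - c) ^ 2 =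
        η.normed volume t * g (x - t) ^ 2 - 2 * c * (η.normed volume t * g (x - t)) +
          c ^ 2 * η.normed volume t := fun t => by ring
    simp only [e1]
    have j1 : Integrable (fun t => η.normed volume t * g (x - t) ^ 2 -
        2 * c * (η.normed volume t * g (x - t))) := i2.sub (i1.const_mul (2 * c))
    rw [integral_add j1 (i3.const_mul _), integral_sub i2 (i1.const_mul _), integral_const_mul, integral_const_mul,
      η.integral_normed, mollify_apply, mollify_apply, mul_one]
  rw [e, ← hc] at h0
  linarith

theorem continuous_mollify (hg : LocallyIntegrable g volume) : Continuous (mollify η g) :=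
  η.hasCompactSupport_normed.continuous_convolution_left (ContinuousLinearMap.lsmul ℝ ℝ)
    η.continuous_normed hg

theorem integral_mollify (hg : Integrable g volume) : ∫ x, mollify η g x = ∫ x, g x := by
  have := integral_convolution (μ := volume) (ν := volume) (ContinuousLinearMap.lsmul ℝ ℝ)
    (η.integrable_normed (μ := volume)) hg
  rw [η.integral_normed, ContinuousLinearMap.lsmul_apply, one_smul] at this
  exact this

theorem integrable_mollify (hg : Integrable g volume) : Integrable (mollify η g) :=
  (η.integrable_normed (μ := volume)).integrable_convolution (ContinuousLinearMap.lsmul ℝ ℝ) hg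

/-- A dominated convergence theorem with varying majorants. -/
theorem tendsto_integral_zero_of_le {X : Type*} [MeasurableSpace X] {ν : Measure X}
    {a b : ℕ → X → ℝ} {B : X → ℝ} (ha : ∀ n, Integrable (a n) ν) (hb : ∀ n, Integrable (b n) ν)
    (hB : Integrable B ν) (h0 : ∀ n x, 0 ≤ a n x) (hab : ∀ n x, a n x ≤ b n x)
    (hB0 : ∀ x, 0 ≤ B x)
    (hal : ∀ᵐ x ∂ν, Tendsto (fun n => a n x) atTop (𝓝 0))
    (hbl : ∀ᵐ x ∂ν, Tendsto (fun n => b n x) atTop (𝓝 (B x)))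
    (hint : Tendsto (fun n => ∫ x, b n x ∂ν) atTop (𝓝 (∫ x, B x ∂ν))) :
    Tendsto (fun n => ∫ x, a n x ∂ν) atTop (𝓝 0) := by
  -- Truncating `b n - a n` at `B` allows ordinary dominated convergence with majorant `B`, and `∫ a
  -- n` is at most `∫ b n` minus this truncated integral.
  have hm : Tendsto (fun n => ∫ x, min (b n x - a n x) (B x) ∂ν) atTop (𝓝 (∫ x, B x ∂ν)) := by
    refine tendsto_integral_of_dominated_convergence B
      (fun n => (((hb n).sub (ha n)).inf hB).aestronglyMeasurable) hB
      (fun n => Eventually.of_forall fun x => ?_) ?_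
    · rw [Real.norm_of_nonneg (le_min (sub_nonneg.2 (hab n x)) (hB0 x))]
      exact min_le_right _ _
    · filter_upwards [hal, hbl] with x h1 h2
      have := (h2.sub h1).min (tendsto_const_nhds (x := B x))
      simpa using this
  have hd := hint.sub hm
  rw [sub_self] at hd
  refine squeeze_zero (fun n => integral_nonneg (h0 n)) (fun n => ?_) hd
  have : ∫ x, min (b n x - a n x) (B x) ∂ν ≤ ∫ x, (b n x - a n x) ∂ν :=
    integral_mono (((hb n).sub (ha n)).inf hB) ((hb n).sub (ha n)) fun x => min_le_left _ _
  rw [integral_sub (hb n) (ha n)] at this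
  linarith

/-- Mollifications converge in `L²`. -/
theorem tendsto_integral_sq_mollify_sub {η : ℕ → ContDiffBump (0 : Plane)}
    (hη : Tendsto (fun n => (η n).rOut) atTop (𝓝 0)) (hη' : ∀ n, (η n).rOut ≤ 2 * (η n).rIn)
    (hg : MemLp g 2 volume) :
    Tendsto (fun n => ∫ x, (mollify (η n) g x - g x) ^ 2) atTop (𝓝 0) := by
  have hl := hg.locallyIntegrable (by norm_num)
  have hsq := hg.integrable_sq
  have l1 := ContDiffBump.ae_convolution_tendsto_right_of_locallyIntegrable (μ := volume) hη
    (Eventually.of_forall hη') hl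
  have l2 := ContDiffBump.ae_convolution_tendsto_right_of_locallyIntegrable (μ := volume) hη
    (Eventually.of_forall hη') hsq.locallyIntegrable
  have hb : ∀ n, Integrable (fun x => 2 * mollify (η n) (fun y => g y ^ 2) x + 2 * g x ^ 2) :=
    fun n => ((integrable_mollify hsq).const_mul 2).add (hsq.const_mul 2)
  -- The majorant varies with `n`, but its integral does not, since mollification preserves
  -- integrals; it converges almost everywhere to `4 g²`.
  have hle : ∀ n x, (mollify (η n) g x - g x) ^ 2 ≤
      2 * mollify (η n) (fun y => g y ^ 2) x + 2 * g x ^ 2 := fun n x => by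
    have := sq_mollify_le (η := η n) hg x
    nlinarith [sq_nonneg (mollify (η n) g x + g x)]
  refine tendsto_integral_zero_of_le
    (b := fun n x => 2 * mollify (η n) (fun y => g y ^ 2) x + 2 * g x ^ 2)
    (B := fun x => 4 * g x ^ 2) (fun n => ?_) hb (hsq.const_mul 4) (fun n x => sq_nonneg _) hle
    (fun x => by positivity) ?_ ?_ ?_
  · refine (hb n).mono' ?_ (Eventually.of_forall fun x => ?_)
    · exact (((continuous_mollify hl).aestronglyMeasurable.sub hg.1).pow 2)
    · rw [Real.norm_of_nonneg (sq_nonneg _)]; exact hle n x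
  · filter_upwards [l1] with x hx
    have := (hx.sub (tendsto_const_nhds (x := g x))).pow 2
    rw [sub_self, zero_pow two_ne_zero] at this
    exact this
  · filter_upwards [l2] with x hx
    have := (hx.const_mul 2).add (tendsto_const_nhds (x := 2 * g x ^ 2))
    rw [show 4 * g x ^ 2 = 2 * g x ^ 2 + 2 * g x ^ 2 by ring]
    exact this
  · have : ∀ n, ∫ x, (2 * mollify (η n) (fun y => g y ^ 2) x + 2 * g x ^ 2) =
        ∫ x, 4 * g x ^ 2 := fun n => by
      rw [integral_add ((integrable_mollify hsq).const_mul 2) (hsq.const_mul 2),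
        integral_const_mul, integral_const_mul, integral_const_mul, integral_mollify hsq]
      ring
    simp only [this]
    exact tendsto_const_nhds

end Mollification

/-! ### Limits in `L²` and products with test functions. -/

section Sobolev

variable {Ω : Set Plane}

theorem tendsto_toLp_of_integral_sq {f : ℕ → Plane → ℝ} {g : Plane → ℝ}
    (hf : ∀ n, MemLp (f n) 2 (vol Ω)) (hg : MemLp g 2 (vol Ω))
    (h : Tendsto (fun n => ∫ x in Ω, (f n x - g x) ^ 2) atTop (𝓝 0)) :
    Tendsto (fun n => (hf n).toLp (f n)) atTop (𝓝 (hg.toLp g)) := by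
  rw [tendsto_iff_norm_sub_tendsto_zero]
  have e : ∀ n, ‖(hf n).toLp (f n) - hg.toLp g‖ ^ 2 = ∫ x in Ω, (f n x - g x) ^ 2 := fun n => by
    rw [← MemLp.toLp_sub, norm_toLp_sq ((hf n).sub hg)]; rfl
  have h4 := (Real.continuous_sqrt.tendsto _).comp h
  simp only [Function.comp_def, ← e, Real.sqrt_sq (norm_nonneg _), Real.sqrt_zero] at h4
  exact h4

/-- A dominated convergence theorem in `L²(Ω)`. -/
theorem tendsto_toLp_of_dominated {f : ℕ → Plane → ℝ} {g F : Plane → ℝ}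
    (hf : ∀ n, MemLp (f n) 2 (vol Ω)) (hg : MemLp g 2 (vol Ω)) (hF : MemLp F 2 (vol Ω))
    (hb : ∀ n, ∀ᵐ x ∂(vol Ω), |f n x| ≤ F x)
    (hl : ∀ᵐ x ∂(vol Ω), Tendsto (fun n => f n x) atTop (𝓝 (g x))) :
    Tendsto (fun n => (hf n).toLp (f n)) atTop (𝓝 (hg.toLp g)) := by
  refine tendsto_toLp_of_integral_sq hf hg ?_
  have := tendsto_integral_of_dominated_convergence (μ := vol Ω)
    (F := fun n x => (f n x - g x) ^ 2) (f := fun _ => (0:ℝ)) (fun x => 4 * F x ^ 2)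
    (fun n => ((hf n).1.sub hg.1).pow 2) (hF.integrable_sq.const_mul 4) (fun n => ?_) ?_
  · simpa using this
  · filter_upwards [ae_all_iff.2 hb, hl] with x h1 h2
    have h3 : |g x| ≤ F x := le_of_tendsto h2.abs (Eventually.of_forall h1)
    have h4 := abs_le.1 (h1 n)
    have h5 := abs_le.1 h3
    rw [Real.norm_of_nonneg (sq_nonneg _), show 4 * F x ^ 2 = (2 * F x) ^ 2 by ring]
    exact sq_le_sq' (by linarith) (by linarith)
  · filter_upwards [hl] with x hx
    have := (hx.sub (tendsto_const_nhds (x := g x))).pow 2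
    simpa using this

theorem memLp_of_bounded_mul {f g : Plane → ℝ} {C : ℝ} (hf : AEStronglyMeasurable f (vol Ω))
    (hC : ∀ᵐ x ∂(vol Ω), |f x| ≤ C) (hg : MemLp g 2 (vol Ω)) :
    MemLp (fun x => f x * g x) 2 (vol Ω) := by
  refine MemLp.of_le_mul (c := C) hg (hf.mul hg.1) ?_
  filter_upwards [hC] with x hx
  rw [norm_mul]
  exact mul_le_mul_of_nonneg_right hx (norm_nonneg _)

theorem IsTest.exists_bound {φ : Plane → ℝ} (h : IsTest Ω φ) : ∃ C, ∀ x, |φ x| ≤ C :=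
  h.2.1.exists_bound_of_continuous h.continuous

theorem IsTest.exists_bound_pderiv {φ : Plane → ℝ} (h : IsTest Ω φ) (i : Fin 2) :
    ∃ C, ∀ x, |pderiv i φ x| ≤ C :=
  (h.2.1.fderiv_apply (𝕜 := ℝ) _).exists_bound_of_continuous (h.continuous_pderiv i)

theorem IsTest.memLp_mul {φ : Plane → ℝ} (h : IsTest Ω φ) (b : L2 Ω) :
    MemLp (fun x => φ x * b x) 2 (vol Ω) := by
  obtain ⟨C, hC⟩ := h.exists_bound
  exact memLp_of_bounded_mul h.continuous.aestronglyMeasurable (Eventually.of_forall hC)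
    (Lp.memLp b)

theorem IsTest.memLp_pderiv_mul {φ : Plane → ℝ} (h : IsTest Ω φ) (i : Fin 2) (b : L2 Ω) :
    MemLp (fun x => pderiv i φ x * b x) 2 (vol Ω) := by
  obtain ⟨C, hC⟩ := h.exists_bound_pderiv i
  exact memLp_of_bounded_mul (h.continuous_pderiv i).aestronglyMeasurable (Eventually.of_forall hC)
    (Lp.memLp b)

theorem memLp_volume_of_eq_zero (hΩ : MeasurableSet Ω) {g : Plane → ℝ} (hg : MemLp g 2 (vol Ω))
    (h0 : ∀ x ∉ Ω, g x = 0) : MemLp g 2 volume := by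
  have : Ω.indicator g = g := by
    ext x; by_cases hx : x ∈ Ω <;> simp [hx, h0]
  rw [← this]
  exact (memLp_indicator_iff_restrict hΩ).2 hg

/-- The product of a test function and an `H¹` function is in `H¹₀`. -/
theorem IsTest.exists_mul_mem_H10 (hΩ : IsOpen Ω) {φ : Plane → ℝ} (hφ : IsTest Ω φ) (b : H1 Ω) :
    ∃ w ∈ H10 Ω, w.fn =ᵐ[vol Ω] (fun x => φ x * b.fn x) ∧
      ∀ i, w.grad i =ᵐ[vol Ω] fun x => φ x * b.grad i x + pderiv i φ x * b.fn x := by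
  set G : Plane → ℝ := fun x => φ x * b.fn x with hG
  set D : Fin 2 → Plane → ℝ := fun i x => φ x * b.grad i x + pderiv i φ x * b.fn x with hD
  have mG : MemLp G 2 (vol Ω) := hφ.memLp_mul b.fn
  have mD : ∀ i, MemLp (D i) 2 (vol Ω) := fun i =>
    (hφ.memLp_mul (b.grad i)).add (hφ.memLp_pderiv_mul i b.fn)
  have zG : ∀ x ∉ Ω, G x = 0 := fun x hx => by simp [hG, hφ.eq_zero hx]
  have zD : ∀ i, ∀ x ∉ Ω, D i x = 0 := fun i x hx => by
    simp [hD, hφ.eq_zero hx, hφ.pderiv_eq_zero hx]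
  -- The factor `φ` makes `G` and `D i` vanish off `Ω`, so they are square integrable on the whole
  -- plane and can be mollified there.
  have MG := memLp_volume_of_eq_zero hΩ.measurableSet mG zG
  have MD := fun i => memLp_volume_of_eq_zero hΩ.measurableSet (mD i) (zD i)
  have lG := MG.locallyIntegrable (by norm_num)
  -- A `δ`-neighbourhood of the support of `φ` stays in `Ω`. Kernels of radius at most `δ` then
  -- produce genuine test functions on `Ω`.
  obtain ⟨δ, hδ, hsub⟩ := hφ.2.1.isCompact.exists_cthickening_subset_open hΩ hφ.2.2
  let η : ℕ → ContDiffBump (0 : Plane) := fun n =>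
    ⟨δ / (n + 1) / 2, δ / (n + 1), by positivity, half_lt_self (by positivity)⟩
  have hη : Tendsto (fun n => (η n).rOut) atTop (𝓝 0) :=
    ((tendsto_const_div_atTop_nhds_zero_nat δ).comp (tendsto_add_atTop_nat 1)).congr fun n => by
      simp [η]
  have hη' : ∀ n, (η n).rOut ≤ 2 * (η n).rIn := fun n => by
    change δ / (n + 1) ≤ 2 * (δ / (n + 1) / 2); linarith
  have hηδ : ∀ n, (η n).rOut ≤ δ := fun n => by
    change δ / (n + 1) ≤ δ
    exact div_le_self hδ.le (by linarith [(Nat.cast_nonneg n : (0:ℝ) ≤ n)])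
  have hsupp : ∀ n, tsupport (mollify (η n) G) ⊆ Metric.cthickening δ (tsupport φ) := by
    intro n
    refine closure_minimal (fun x hx => ?_) Metric.isClosed_cthickening
    obtain ⟨s, hs, z, hz, rfl⟩ := support_convolution_subset _ hx
    rw [ContDiffBump.support_normed_eq, Metric.mem_ball, dist_zero_right] at hs
    have hz' : z ∈ tsupport φ := subset_tsupport _ (left_ne_zero_of_mul hz)
    refine Metric.mem_cthickening_of_dist_le _ z δ _ hz' ?_
    simp only [dist_eq_norm, add_sub_cancel_right]
    exact hs.le.trans (hηδ n)
  have htest : ∀ n, IsTest Ω (mollify (η n) G) := fun n =>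
    ⟨(η n).hasCompactSupport_normed.contDiff_convolution_left _ (η n).contDiff_normed lG,
      (hφ.2.1.isCompact.cthickening).of_isClosed_subset (isClosed_tsupport _) (hsupp n),
      (hsupp n).trans hsub⟩
  -- Differentiation falls on the kernel and is moved back by testing the weak derivative of `b`
  -- with `t ↦ φ t * N (x - t)`. This product is admissible on `Ω` even where the kernel alone is
  -- not.
  have hder : ∀ n i x, pderiv i (mollify (η n) G) x = mollify (η n) (D i) x := by
    intro n i x
    set N := (η n).normed (volume : Measure Plane) with hN
    have cN : ContDiff ℝ (⊤ : ℕ∞) N := (η n).contDiff_normed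
    have dN : Differentiable ℝ N := cN.differentiable (by simp)
    have sN : HasCompactSupport N := (η n).hasCompactSupport_normed
    have e1 : pderiv i (mollify (η n) G) x = ∫ t, pderiv i N t * G (x - t) := by
      have hd := sN.hasFDerivAt_convolution_left (ContinuousLinearMap.lsmul ℝ ℝ)
        (cN.of_le (by simp)) lG x
      have hex := (sN.fderiv (𝕜 := ℝ)).convolutionExists_left
        ((ContinuousLinearMap.lsmul ℝ ℝ).precompL Plane)
        (cN.continuous_fderiv (by simp)) lG x
      rw [pderiv, mollify, hd.fderiv, convolution_def, ContinuousLinearMap.integral_apply hex]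
      rfl
    have e2 : ∫ t, pderiv i N t * G (x - t) = ∫ t, pderiv i N (x - t) * G t := by
      rw [← integral_sub_left_eq_self _ volume x]
      simp
    have e3 : mollify (η n) (D i) x = ∫ t, N (x - t) * D i t := by
      rw [mollify_apply, ← integral_sub_left_eq_self _ volume x]
      simp [hN]
    have cNx : ContDiff ℝ (⊤ : ℕ∞) fun t => N (x - t) := cN.comp (contDiff_const.sub contDiff_id)
    have hψ : IsTest Ω fun t => φ t * N (x - t) := hφ.mul cNx
    have hp : ∀ t, pderiv i (fun t => φ t * N (x - t)) t =
        pderiv i φ t * N (x - t) - φ t * pderiv i N (x - t) := by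
      intro t
      rw [pderiv_mul hφ.differentiable (cNx.differentiable (by simp))]
      have : pderiv i (fun t => N (x - t)) t = -pderiv i N (x - t) := by
        have h1 : HasFDerivAt (fun t : Plane => x - t) (-ContinuousLinearMap.id ℝ Plane) t := by
          simpa using (hasFDerivAt_id (𝕜 := ℝ) t).const_sub x
        have h2 := ((dN (x - t)).hasFDerivAt).comp t h1
        rw [pderiv, pderiv]
        change (fderiv ℝ (N ∘ fun t => x - t) t) _ = _
        rw [h2.fderiv]
        simp
      rw [this]; ring
    have hw := b.isWeakDeriv i _ hψ
    simp only [hp] at hw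
    have r1 : ∫ t in Ω, pderiv i N (x - t) * G t = ∫ t, pderiv i N (x - t) * G t :=
      setIntegral_eq_integral_of_forall_compl_eq_zero fun t ht => by rw [zG t ht, mul_zero]
    have r2 : ∫ t in Ω, N (x - t) * D i t = ∫ t, N (x - t) * D i t :=
      setIntegral_eq_integral_of_forall_compl_eq_zero fun t ht => by rw [zD i t ht, mul_zero]
    rw [e1, e2, e3, ← r1, ← r2]
    obtain ⟨B1, hB1⟩ := sN.exists_bound_of_continuous cN.continuous
    obtain ⟨B2, hB2⟩ := (sN.fderiv_apply (𝕜 := ℝ)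
      (EuclideanSpace.single i (1:ℝ))).exists_bound_of_continuous
      ((cN.continuous_fderiv (by simp)).clm_apply continuous_const)
    have cpN : Continuous fun t => pderiv i N (x - t) :=
      ((cN.continuous_fderiv (by simp)).clm_apply continuous_const).comp
        (continuous_const.sub continuous_id)
    have I1 : Integrable (fun t => b.fn t * (pderiv i φ t * N (x - t))) (vol Ω) := by
      have h1 := memLp_of_bounded_mul (Ω := Ω) cNx.continuous.aestronglyMeasurable
        (Eventually.of_forall fun t => hB1 (x - t)) (hφ.memLp_pderiv i)
      have h2 := (Lp.memLp b.fn).integrable_mul h1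
      refine h2.congr (Eventually.of_forall fun t => ?_)
      simp only [Pi.mul_apply]; ring
    have I2 : Integrable (fun t => b.fn t * (φ t * pderiv i N (x - t))) (vol Ω) := by
      have h1 := memLp_of_bounded_mul (Ω := Ω) cpN.aestronglyMeasurable
        (Eventually.of_forall fun t => hB2 (x - t)) hφ.memLp
      have h2 := (Lp.memLp b.fn).integrable_mul h1
      refine h2.congr (Eventually.of_forall fun t => ?_)
      simp only [Pi.mul_apply]; ring
    have I3 : Integrable (fun t => b.grad i t * (φ t * N (x - t))) (vol Ω) :=
      (Lp.memLp (b.grad i)).integrable_mul hψ.memLp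
    have s1 : ∫ t in Ω, b.fn t * (pderiv i φ t * N (x - t) - φ t * pderiv i N (x - t)) =
        (∫ t in Ω, b.fn t * (pderiv i φ t * N (x - t))) -
          ∫ t in Ω, b.fn t * (φ t * pderiv i N (x - t)) := by
      rw [← integral_sub I1 I2]; congr 1; ext t; ring
    have s2 : ∫ t in Ω, N (x - t) * D i t = (∫ t in Ω, b.grad i t * (φ t * N (x - t))) +
        ∫ t in Ω, b.fn t * (pderiv i φ t * N (x - t)) := by
      rw [← integral_add I3 I1]; congr 1; ext t; simp only [hD]; ring
    have s3 : ∫ t in Ω, pderiv i N (x - t) * G t =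
        ∫ t in Ω, b.fn t * (φ t * pderiv i N (x - t)) := by
      congr 1; ext t; simp only [hG]; ring
    rw [s2, s3]
    rw [s1] at hw
    linarith
  have hconv : ∀ {g : Plane → ℝ}, MemLp g 2 volume →
      Tendsto (fun n => ∫ x in Ω, (mollify (η n) g x - g x) ^ 2) atTop (𝓝 0) := by
    intro g hg
    refine squeeze_zero (fun n => integral_nonneg fun x => sq_nonneg _) (fun n => ?_)
      (tendsto_integral_sq_mollify_sub hη hη' hg)
    refine setIntegral_le_integral ?_ (Eventually.of_forall fun x => sq_nonneg _)
    have hsq := hg.integrable_sq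
    refine (((integrable_mollify (η := η n) hsq).const_mul 2).add (hsq.const_mul 2)).mono'
      (((continuous_mollify (hg.locallyIntegrable (by norm_num))).aestronglyMeasurable.sub
        hg.1).pow 2) (Eventually.of_forall fun x => ?_)
    rw [Real.norm_of_nonneg (sq_nonneg _)]
    have := sq_mollify_le (η := η n) hg x
    simp only [Pi.add_apply]
    nlinarith [sq_nonneg (mollify (η n) g x + g x)]
  obtain ⟨w, hw, hw1, hw2, -⟩ := exists_H10_of_tendsto (w := fun n => (htest n).toH1)
    (fun n => (htest n).toH1_mem) (u := mG.toLp G) (g := fun i => (mD i).toLp (D i))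
    (tendsto_toLp_of_integral_sq (fun n => (htest n).memLp) mG (hconv MG))
    (fun i => tendsto_toLp_of_integral_sq (fun n => (htest n).memLp_pderiv i) (mD i)
      (by simpa only [hder] using hconv (MD i)))
  exact ⟨w, hw, hw1 ▸ mG.coeFn_toLp, fun i => hw2 i ▸ (mD i).coeFn_toLp⟩

end Sobolev

/-! ### The planar Sobolev inequality and multiplication from `H¹₀` to `L²`. -/

section Sobolev

variable {Ω : Set Plane}

theorem norm_le_sum_apply_single (L : Plane →L[ℝ] ℝ) :
    ‖L‖ ≤ ∑ i, |L (EuclideanSpace.single i (1 : ℝ))| := by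
  refine L.opNorm_le_bound (Finset.sum_nonneg fun _ _ => abs_nonneg _) fun v => ?_
  have hv : v = ∑ i, v i • EuclideanSpace.single i (1 : ℝ) := by
    ext j; fin_cases j <;> simp
  conv_lhs => rw [hv]
  rw [map_sum, Finset.sum_mul]
  refine (norm_sum_le _ _).trans (Finset.sum_le_sum fun i _ => ?_)
  rw [map_smul, norm_smul, mul_comm, Real.norm_eq_abs]
  gcongr
  exact PiLp.norm_apply_le v i

/-- The constant in the Gagliardo–Nirenberg–Sobolev inequality in the plane. -/
def sobolevConst : ℝ := eLpNormLESNormFDerivOneConst (volume : Measure Plane) ((2 : NNReal) : ℝ)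

theorem sobolevConst_nonneg : 0 ≤ sobolevConst := NNReal.coe_nonneg _

/-- The Gagliardo–Nirenberg–Sobolev inequality at the exponent one, whose Sobolev exponent in
dimension two is exactly two. Having the gradient only in `L¹` on the right is what makes it usable
for products and for small supports. -/
theorem IsTest.norm_fn_le {φ : Plane → ℝ} (h : IsTest Ω φ) :
    ‖h.toH1.fn‖ ≤ sobolevConst * ∑ i, ∫ x in Ω, |h.toH1.grad i x| := by
  have hconj : NNReal.HolderConjugate (Module.finrank ℝ Plane) 2 := by
    rw [finrank_euclideanSpace_fin]
    exact NNReal.holderConjugate_iff.2 ⟨by norm_num, by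
      rw [← NNReal.coe_inj]; push_cast; norm_num⟩
  have h1 := eLpNorm_le_eLpNorm_fderiv_one (volume : Measure Plane) (h.1.of_le (by simp)) h.2.1 hconj
  have hc : Continuous (fderiv ℝ φ) := h.1.continuous_fderiv (by simp)
  have hi : Integrable (fderiv ℝ φ) := hc.integrable_of_hasCompactSupport (h.2.1.fderiv (𝕜 := ℝ))
  have hpi : ∀ i, Integrable (fun x => |pderiv i φ x|) := fun i =>
    ((h.continuous_pderiv i).integrable_of_hasCompactSupport (h.2.1.fderiv_apply (𝕜 := ℝ) _)).abs
  have h2 : eLpNorm (fderiv ℝ φ) 1 volume ≤ ENNReal.ofReal (∑ i, ∫ x in Ω, |h.toH1.grad i x|) := by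
    rw [eLpNorm_one_eq_lintegral_enorm, ← ofReal_integral_norm_eq_lintegral_enorm hi]
    refine ENNReal.ofReal_le_ofReal ?_
    have e : ∀ i, ∫ x in Ω, |h.toH1.grad i x| = ∫ x, |pderiv i φ x| := fun i => by
      have e1 : ∫ x in Ω, |pderiv i φ x| = ∫ x, |pderiv i φ x| :=
        setIntegral_eq_integral_of_forall_compl_eq_zero fun x hx => by
          rw [h.pderiv_eq_zero hx, abs_zero]
      rw [← e1]
      refine integral_congr_ae ?_
      filter_upwards [h.coeFn_grad_toH1 i] with x hx using by rw [hx]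
    simp only [e]
    rw [← integral_finsetSum _ fun i _ => hpi i]
    exact integral_mono hi.norm (integrable_finsetSum _ fun i _ => hpi i) fun x =>
      norm_le_sum_apply_single _
  have h3 : eLpNorm φ 2 (vol Ω) ≤ eLpNorm φ 2 volume := eLpNorm_mono_measure _ Measure.restrict_le_self
  have h4 : ‖h.toH1.fn‖ = (eLpNorm φ 2 (vol Ω)).toReal := Lp.norm_toLp φ h.memLp
  rw [h4]
  refine ENNReal.toReal_le_of_le_ofReal
    (mul_nonneg sobolevConst_nonneg (Finset.sum_nonneg fun i _ => integral_nonneg fun _ => abs_nonneg _)) ?_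
  rw [ENNReal.ofReal_mul sobolevConst_nonneg]
  refine h3.trans (h1.trans ?_)
  rw [sobolevConst, ENNReal.ofReal_coe_nnreal]
  gcongr

theorem H1.continuous_seminorm : Continuous (H1.seminorm : H1 Ω → ℝ) := by
  have : (H1.seminorm : H1 Ω → ℝ) = fun w => √(∑ i, ‖gradL Ω i w‖ ^ 2) := by
    ext w
    rw [eq_comm, Real.sqrt_eq_iff_eq_sq (by positivity) w.seminorm_nonneg, w.seminorm_sq]
    rfl
  rw [this]
  fun_prop

/-- Integration by parts against `H¹₀` functions. -/
theorem inner_grad_eq (hΩ : IsOpen Ω) (b : H1 Ω) {p : H1 Ω} (hp : p ∈ H10 Ω) (i : Fin 2) :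
    inner ℝ b.fn (p.grad i) = -inner ℝ (b.grad i) p.fn := by
  obtain ⟨φ, hφ, hlim, -⟩ := exists_seq_test hΩ hp
  obtain ⟨l1, l2⟩ := H1.tendsto_iff.1 hlim
  refine tendsto_nhds_unique (tendsto_const_nhds.inner (l2 i))
    ((tendsto_const_nhds.inner l1).neg.congr fun n => ?_)
  have h := isWeakDeriv_iff.1 (b.isWeakDeriv i) (φ n) (hφ n)
  change inner ℝ ((hφ n).toH1.grad i) b.fn + inner ℝ (hφ n).toH1.fn (b.grad i) = 0 at h
  have c1 := real_inner_comm (b.grad i) (hφ n).toH1.fn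
  have c2 := real_inner_comm b.fn ((hφ n).toH1.grad i)
  linarith

section

variable [IsFiniteMeasure (vol Ω)]

theorem integrable_coeFn (g : L2 Ω) : Integrable g (vol Ω) :=
  (Lp.memLp g).integrable (by norm_num)

theorem continuous_integral_abs : Continuous fun g : L2 Ω => ∫ x in Ω, |g x| := by
  refine LipschitzWith.continuous (K := (√((vol Ω).real univ)).toNNReal)
    (LipschitzWith.of_dist_le_mul fun f g => ?_)
  rw [Real.dist_eq, dist_eq_norm, Real.coe_toNNReal _ (Real.sqrt_nonneg _)]
  refine le_trans ?_ (integral_abs_le (f - g) MeasurableSet.univ (by simp))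
  rw [← integral_sub (integrable_coeFn f).abs (integrable_coeFn g).abs]
  refine abs_integral_le_integral_abs.trans ?_
  refine integral_mono_ae ((integrable_coeFn f).abs.sub (integrable_coeFn g).abs).abs
    (integrable_coeFn (f - g)).abs ?_
  filter_upwards [Lp.coeFn_sub f g] with x hx
  rw [hx]
  exact abs_abs_sub_abs_le_abs_sub _ _

/-- The Sobolev inequality `W₀^{1,1} ⊂ L²` for functions in `H¹₀(Ω)`. -/
theorem norm_fn_le_integral_abs_grad (hΩ : IsOpen Ω) {w : H1 Ω} (hw : w ∈ H10 Ω) :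
    ‖w.fn‖ ≤ sobolevConst * ∑ i, ∫ x in Ω, |w.grad i x| := by
  obtain ⟨φ, hφ, hlim, -⟩ := exists_seq_test hΩ hw
  obtain ⟨l1, l2⟩ := H1.tendsto_iff.1 hlim
  refine le_of_tendsto_of_tendsto' l1.norm ((tendsto_finsetSum Finset.univ fun i _ =>
    (continuous_integral_abs.tendsto _).comp (l2 i)).const_mul sobolevConst)
    fun n => (hφ n).norm_fn_le

/-- The `L¹` norm of a gradient living on `A` is at most `√|A|` times its `L²` norm; the factor two
counts the two partial derivatives. -/
theorem norm_fn_le_of_support (hΩ : IsOpen Ω) {w : H1 Ω} (hw : w ∈ H10 Ω) {A : Set Plane}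
    (hA : MeasurableSet A) (h : ∀ i, ∀ᵐ x ∂(vol Ω), x ∉ A → w.grad i x = 0) :
    ‖w.fn‖ ≤ 2 * sobolevConst * √((vol Ω).real A) * w.seminorm := by
  refine (norm_fn_le_integral_abs_grad hΩ hw).trans ?_
  have : ∀ i ∈ Finset.univ, ∫ x in Ω, |w.grad i x| ≤ √((vol Ω).real A) * w.seminorm := fun i _ =>
    (integral_abs_le _ hA (h i)).trans (by gcongr; exact w.norm_grad_le_seminorm i)
  calc _ ≤ sobolevConst * ∑ i : Fin 2, √((vol Ω).real A) * w.seminorm := by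
        exact mul_le_mul_of_nonneg_left (Finset.sum_le_sum this) sobolevConst_nonneg
    _ = _ := by simp; ring

/-- Both terms of the product rule for `φ b` are products of two `L²` functions, hence in `L¹`; the
inequality `W₀^{1,1} ⊂ L²` then bounds the product in `L²` using `H¹` norms only. -/
theorem IsTest.norm_mul_le (hΩ : IsOpen Ω) {φ : Plane → ℝ} (h : IsTest Ω φ) (b : H1 Ω) :
    ‖(h.memLp_mul b.fn).toLp _‖ ≤
      2 * sobolevConst * (‖h.toH1.fn‖ * b.seminorm + h.toH1.seminorm * ‖b.fn‖) := by
  obtain ⟨w, hw, w1, w2⟩ := h.exists_mul_mem_H10 hΩ b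
  have e : (h.memLp_mul b.fn).toLp _ = w.fn := Lp.ext ((h.memLp_mul b.fn).coeFn_toLp.trans w1.symm)
  rw [e]
  refine (norm_fn_le_integral_abs_grad hΩ hw).trans ?_
  have : ∀ i ∈ Finset.univ, ∫ x in Ω, |w.grad i x| ≤
      ‖h.toH1.fn‖ * b.seminorm + h.toH1.seminorm * ‖b.fn‖ := fun i _ => by
    have i1 := (integrable_mul h.toH1.fn (b.grad i)).abs
    have i2 := (integrable_mul (h.toH1.grad i) b.fn).abs
    calc ∫ x in Ω, |w.grad i x| ≤
        ∫ x in Ω, (|h.toH1.fn x * b.grad i x| + |h.toH1.grad i x * b.fn x|) := by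
          refine integral_mono_ae (integrable_coeFn _).abs (i1.add i2) ?_
          filter_upwards [w2 i, h.coeFn_toH1, h.coeFn_grad_toH1 i] with x e1 e2 e3
          rw [e1, e2, e3]
          exact abs_add_le _ _
      _ = (∫ x in Ω, |h.toH1.fn x * b.grad i x|) + ∫ x in Ω, |h.toH1.grad i x * b.fn x| :=
          integral_add i1 i2
      _ ≤ ‖h.toH1.fn‖ * ‖b.grad i‖ + ‖h.toH1.grad i‖ * ‖b.fn‖ :=
          add_le_add (integral_abs_mul_le _ _) (integral_abs_mul_le _ _)
      _ ≤ _ := by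
          gcongr
          · exact b.norm_grad_le_seminorm i
          · exact h.toH1.norm_grad_le_seminorm i
  calc _ ≤ sobolevConst * ∑ i : Fin 2,
      (‖h.toH1.fn‖ * b.seminorm + h.toH1.seminorm * ‖b.fn‖) := by
        exact mul_le_mul_of_nonneg_left (Finset.sum_le_sum this) sobolevConst_nonneg
    _ = _ := by simp; ring

/-- The bound for test functions passes to the limit by Fatou along an almost everywhere convergent
sequence. This gives membership in `L²` and the estimate at once. -/
theorem eLpNorm_mul_le (hΩ : IsOpen Ω) {p : H1 Ω} (hp : p ∈ H10 Ω) (b : H1 Ω) :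
    eLpNorm (fun x => p.fn x * b.fn x) 2 (vol Ω) ≤ ENNReal.ofReal
      (2 * sobolevConst * (‖p.fn‖ * b.seminorm + p.seminorm * ‖b.fn‖)) := by
  obtain ⟨φ, hφ, hlim, hae⟩ := exists_seq_test hΩ hp
  have hl : ∀ᵐ x ∂(vol Ω), Tendsto (fun n => φ n x * b.fn x) atTop (𝓝 (p.fn x * b.fn x)) := by
    filter_upwards [hae] with x hx using hx.mul_const _
  refine (Lp.eLpNorm_lim_le_liminf_eLpNorm (fun n => ((hφ n).memLp_mul b.fn).1) _ hl).trans ?_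
  have hK : Tendsto (fun n => ENNReal.ofReal (2 * sobolevConst * (‖(hφ n).toH1.fn‖ * b.seminorm +
      (hφ n).toH1.seminorm * ‖b.fn‖))) atTop (𝓝 (ENNReal.ofReal
      (2 * sobolevConst * (‖p.fn‖ * b.seminorm + p.seminorm * ‖b.fn‖)))) := by
    refine ENNReal.tendsto_ofReal (Tendsto.const_mul _ (Tendsto.add ?_ ?_))
    · exact (H1.tendsto_iff.1 hlim).1.norm.mul_const _
    · exact ((H1.continuous_seminorm.tendsto _).comp hlim).mul_const _
  rw [← hK.liminf_eq]
  refine liminf_le_liminf (Eventually.of_forall fun n => ?_)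
  have := (hφ n).norm_mul_le hΩ b
  rw [Lp.norm_toLp] at this
  rw [← ENNReal.ofReal_toReal ((hφ n).memLp_mul b.fn).eLpNorm_ne_top]
  exact ENNReal.ofReal_le_ofReal this

theorem memLp_mul_H10 (hΩ : IsOpen Ω) {p : H1 Ω} (hp : p ∈ H10 Ω) (b : H1 Ω) :
    MemLp (fun x => p.fn x * b.fn x) 2 (vol Ω) :=
  ⟨(Lp.memLp p.fn).1.mul (Lp.memLp b.fn).1,
    (eLpNorm_mul_le hΩ hp b).trans_lt ENNReal.ofReal_lt_top⟩

theorem norm_mul_H10_le (hΩ : IsOpen Ω) {p : H1 Ω} (hp : p ∈ H10 Ω) (b : H1 Ω) :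
    ‖(memLp_mul_H10 hΩ hp b).toLp _‖ ≤
      2 * sobolevConst * (‖p.fn‖ * b.seminorm + p.seminorm * ‖b.fn‖) := by
  rw [Lp.norm_toLp]
  refine ENNReal.toReal_le_of_le_ofReal ?_ (eLpNorm_mul_le hΩ hp b)
  have := sobolevConst_nonneg
  have := b.seminorm_nonneg
  have := p.seminorm_nonneg
  positivity

theorem norm_mul_H10_le' (hΩ : IsOpen Ω) {p : H1 Ω} (hp : p ∈ H10 Ω) (b : H1 Ω) :
    ‖(memLp_mul_H10 hΩ hp b).toLp _‖ ≤ 4 * sobolevConst * ‖b‖ * ‖p‖ := by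
  refine (norm_mul_H10_le hΩ hp b).trans ?_
  have h0 := sobolevConst_nonneg
  have h1 := mul_le_mul p.norm_fn_le b.seminorm_le b.seminorm_nonneg (norm_nonneg _)
  have h2 := mul_le_mul p.seminorm_le b.norm_fn_le (norm_nonneg _) (norm_nonneg _)
  calc _ ≤ 2 * sobolevConst * (‖p‖ * ‖b‖ + ‖p‖ * ‖b‖) := by gcongr
    _ = 4 * sobolevConst * ‖b‖ * ‖p‖ := by ring

/-- Multiplication by an `H¹` function, as an operator from `H¹₀(Ω)` to `L²(Ω)`. -/
def mulL (hΩ : IsOpen Ω) (b : H1 Ω) : H10 Ω →L[ℝ] L2 Ω :=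
  LinearMap.mkContinuous
    { toFun := fun p => (memLp_mul_H10 hΩ p.2 b).toLp _
      map_add' := fun p p' => by
        refine Lp.ext ?_
        filter_upwards [(memLp_mul_H10 hΩ (p + p').2 b).coeFn_toLp,
          (memLp_mul_H10 hΩ p.2 b).coeFn_toLp, (memLp_mul_H10 hΩ p'.2 b).coeFn_toLp,
          Lp.coeFn_add ((memLp_mul_H10 hΩ p.2 b).toLp _) ((memLp_mul_H10 hΩ p'.2 b).toLp _),
          Lp.coeFn_add p.1.fn p'.1.fn] with x h1 h2 h3 h4 h5
        rw [h1, h4, Pi.add_apply, h2, h3]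
        change (p.1.fn + p'.1.fn) x * _ = _
        rw [h5, Pi.add_apply]; ring
      map_smul' := fun c p => by
        refine Lp.ext ?_
        filter_upwards [(memLp_mul_H10 hΩ (c • p).2 b).coeFn_toLp,
          (memLp_mul_H10 hΩ p.2 b).coeFn_toLp,
          Lp.coeFn_smul c ((memLp_mul_H10 hΩ p.2 b).toLp _),
          Lp.coeFn_smul c p.1.fn] with x h1 h2 h3 h4
        rw [h1, RingHom.id_apply, h3, Pi.smul_apply, h2]
        change (c • p.1.fn) x * _ = _
        rw [h4, Pi.smul_apply, smul_eq_mul, smul_eq_mul]; ring }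
    (4 * sobolevConst * ‖b‖) fun p => norm_mul_H10_le' hΩ p.2 b

variable (hΩ : IsOpen Ω)

theorem coeFn_mulL (b : H1 Ω) (p : H10 Ω) :
    mulL hΩ b p =ᵐ[vol Ω] fun x => p.1.fn x * b.fn x :=
  (memLp_mul_H10 hΩ p.2 b).coeFn_toLp

theorem norm_mulL_le (b : H1 Ω) (p : H10 Ω) : ‖mulL hΩ b p‖ ≤
    2 * sobolevConst * (‖p.1.fn‖ * b.seminorm + p.1.seminorm * ‖b.fn‖) :=
  norm_mul_H10_le hΩ p.2 b

theorem norm_mulL_le' (b : H1 Ω) (p : H10 Ω) : ‖mulL hΩ b p‖ ≤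
    4 * sobolevConst * ‖b‖ * ‖p.1‖ :=
  norm_mul_H10_le' hΩ p.2 b

theorem mulL_comm (p r : H10 Ω) : mulL hΩ p.1 r = mulL hΩ r.1 p := by
  refine Lp.ext ?_
  filter_upwards [coeFn_mulL hΩ p.1 r, coeFn_mulL hΩ r.1 p] with x h1 h2
  rw [h1, h2, mul_comm]

theorem tendsto_mulL_self (hΩ : IsOpen Ω) {p : ℕ → H10 Ω} {p₀ : H10 Ω} (h : Tendsto p atTop (𝓝 p₀)) :
    Tendsto (fun n => mulL hΩ (p n).1 (p n)) atTop (𝓝 (mulL hΩ p₀.1 p₀)) := by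
  rw [tendsto_iff_norm_sub_tendsto_zero] at *
  have e : ∀ n, mulL hΩ (p n).1 (p n) - mulL hΩ p₀.1 p₀ =
      mulL hΩ (p n).1 (p n - p₀) + mulL hΩ p₀.1 (p n - p₀) := fun n => by
    rw [map_sub, map_sub, mulL_comm hΩ p₀ (p n)]; abel
  have hb : ∀ n, ‖mulL hΩ (p n).1 (p n) - mulL hΩ p₀.1 p₀‖ ≤
      4 * sobolevConst * (‖p n - p₀‖ + ‖p₀‖) * ‖p n - p₀‖ +
        4 * sobolevConst * ‖p₀‖ * ‖p n - p₀‖ := fun n => by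
    rw [e]
    refine (norm_add_le _ _).trans (add_le_add ((norm_mulL_le' hΩ _ _).trans ?_)
      (norm_mulL_le' hΩ _ _))
    have h0 := sobolevConst_nonneg
    have : ‖(p n).1‖ ≤ ‖p n - p₀‖ + ‖p₀‖ := by
      have := norm_add_le (p n - p₀) p₀
      rwa [sub_add_cancel] at this
    gcongr
    exact le_rfl
  refine squeeze_zero (fun n => norm_nonneg _) hb ?_
  have := ((((h.add_const ‖p₀‖).const_mul (4 * sobolevConst)).mul h).add
    (h.const_mul (4 * sobolevConst * ‖p₀‖)))
  simp only [zero_add, mul_zero, add_zero] at this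
  exact this

/-- `∫ (p b) ∂ᵢp = -½ ∫ ∂ᵢb p²` for `p ∈ H¹₀(Ω)`, `b ∈ H¹(Ω)`. -/
theorem inner_mulL_grad (b : H1 Ω) (p : H10 Ω) (i : Fin 2) :
    inner ℝ (mulL hΩ b p) (p.1.grad i) = -(1 / 2) * inner ℝ (b.grad i) (mulL hΩ p.1 p) := by
  obtain ⟨φ, hφ, hlim, -⟩ := exists_seq_test hΩ p.2
  obtain ⟨l1, l2⟩ := H1.tendsto_iff.1 hlim
  let P : ℕ → H10 Ω := fun n => ⟨(hφ n).toH1, (hφ n).toH1_mem⟩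
  have hP : Tendsto P atTop (𝓝 p) := tendsto_subtype_rng.2 hlim
  refine tendsto_nhds_unique ((((mulL hΩ b).continuous.tendsto _).comp hP).inner (l2 i))
    (((tendsto_const_nhds.inner (tendsto_mulL_self hΩ hP)).const_mul (-(1 / 2) : ℝ)).congr
      fun n => ?_)
  -- The test function is `φ²`, since `∂ᵢ(φ²) = 2 φ ∂ᵢφ`.
  have h := b.isWeakDeriv i _ ((hφ n).mul (hφ n).1)
  have hp : ∀ x, pderiv i (fun x => φ n x * φ n x) x = 2 * (φ n x * pderiv i (φ n) x) := fun x => by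
    rw [pderiv_mul (hφ n).differentiable (hφ n).differentiable]; ring
  simp only [hp] at h
  have e1 : inner ℝ (mulL hΩ b (P n)) ((hφ n).toH1.grad i) =
      (1 / 2) * ∫ x in Ω, b.fn x * (2 * (φ n x * pderiv i (φ n) x)) := by
    rw [inner_eq_integral, ← integral_const_mul]
    refine integral_congr_ae ?_
    filter_upwards [coeFn_mulL hΩ b (P n), (hφ n).coeFn_toH1, (hφ n).coeFn_grad_toH1 i]
      with x h1 h2 h3
    rw [h1, h3]
    change (hφ n).toH1.fn x * _ * _ = _
    rw [h2]; ring
  have e2 : inner ℝ (b.grad i) (mulL hΩ (P n).1 (P n)) =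
      ∫ x in Ω, b.grad i x * (φ n x * φ n x) := by
    rw [inner_eq_integral]
    refine integral_congr_ae ?_
    filter_upwards [coeFn_mulL hΩ (P n).1 (P n), (hφ n).coeFn_toH1] with x h1 h2
    rw [h1]
    change _ * ((hφ n).toH1.fn x * (hφ n).toH1.fn x) = _
    rw [h2]
  simp only [Function.comp_apply]
  rw [e1, e2, h]; ring

end

end Sobolev

/-! ### Chain rule, truncation and bounded products in `H¹₀`. -/

section Chain

variable {Ω : Set Plane}

/-- Split `a n g n - a₀ g₀` into `a n (g n - g₀)`, small by the uniform bound on `a n`, and `(a n -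
a₀) g₀`, handled by dominated convergence. The factors `a n` need to converge only almost
everywhere. -/
theorem tendsto_toLp_bounded_mul {a : ℕ → Plane → ℝ} {a₀ : Plane → ℝ} {L : ℝ}
    (ha : ∀ n, AEStronglyMeasurable (a n) (vol Ω)) (hL : ∀ n, ∀ᵐ x ∂(vol Ω), |a n x| ≤ L)
    (hl : ∀ᵐ x ∂(vol Ω), Tendsto (fun n => a n x) atTop (𝓝 (a₀ x)))
    {g : ℕ → L2 Ω} {g₀ : L2 Ω} (hg : Tendsto g atTop (𝓝 g₀))
    (m : ∀ n, MemLp (fun x => a n x * g n x) 2 (vol Ω))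
    (m₀ : MemLp (fun x => a₀ x * g₀ x) 2 (vol Ω)) :
    Tendsto (fun n => (m n).toLp _) atTop (𝓝 (m₀.toLp _)) := by
  have m' : ∀ n, MemLp (fun x => a n x * g₀ x) 2 (vol Ω) := fun n =>
    memLp_of_bounded_mul (ha n) (hL n) (Lp.memLp g₀)
  have h1 : Tendsto (fun n => (m' n).toLp _) atTop (𝓝 (m₀.toLp _)) := by
    refine tendsto_toLp_of_dominated m' m₀ ((Lp.memLp g₀).abs.const_mul L) (fun n => ?_) ?_
    · filter_upwards [hL n] with x hx
      rw [abs_mul]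
      exact mul_le_mul_of_nonneg_right hx (abs_nonneg _)
    · filter_upwards [hl] with x hx using hx.mul_const _
  have h2 : Tendsto (fun n => (m n).toLp _ - (m' n).toLp _) atTop (𝓝 0) := by
    rw [tendsto_iff_norm_sub_tendsto_zero] at hg
    have hz := hg.const_mul L
    rw [mul_zero] at hz
    refine squeeze_zero_norm (fun n => ?_) hz
    refine Lp.norm_le_mul_norm_of_ae_le_mul ?_
    filter_upwards [hL n, Lp.coeFn_sub ((m n).toLp _) ((m' n).toLp _), (m n).coeFn_toLp,
      (m' n).coeFn_toLp, Lp.coeFn_sub (g n) g₀] with x e1 e2 e3 e4 e5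
    rw [e2, e5, Pi.sub_apply, Pi.sub_apply, e3, e4, ← mul_sub, norm_mul]
    exact mul_le_mul_of_nonneg_right e1 (norm_nonneg _)
  simpa using h2.add h1

theorem IsTest.comp {φ : Plane → ℝ} (h : IsTest Ω φ) {G : ℝ → ℝ} (hG : ContDiff ℝ (⊤ : ℕ∞) G)
    (h0 : G 0 = 0) : IsTest Ω (fun x => G (φ x)) :=
  h.of_tsupport_subset (hG.comp h.1) fun x hx hx' => hx (by simp only [hx', h0])

theorem pderiv_comp {φ : Plane → ℝ} (h : Differentiable ℝ φ) {G : ℝ → ℝ} (hG : Differentiable ℝ G)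
    (i : Fin 2) (x : Plane) :
    pderiv i (fun x => G (φ x)) x = deriv G (φ x) * pderiv i φ x := by
  have := ((hG (φ x)).hasDerivAt.comp_hasFDerivAt x (h x).hasFDerivAt).fderiv
  simp only [pderiv]
  change (fderiv ℝ (G ∘ φ) x) _ = _
  rw [this]
  simp

/-- The chain rule in `H¹₀(Ω)`, with convergence of the compositions with test functions. -/
theorem exists_comp_mem_H10 {G : ℝ → ℝ} {L : ℝ} (hG : ContDiff ℝ (⊤ : ℕ∞) G) (h0 : G 0 = 0)
    (hL : ∀ s, |deriv G s| ≤ L) {w : H1 Ω} {φ : ℕ → Plane → ℝ} (hφ : ∀ n, IsTest Ω (φ n))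
    (hlim : Tendsto (fun n => (hφ n).toH1) atTop (𝓝 w))
    (hae : ∀ᵐ x ∂(vol Ω), Tendsto (fun n => φ n x) atTop (𝓝 (w.fn x))) :
    ∃ v ∈ H10 Ω, v.fn =ᵐ[vol Ω] (fun x => G (w.fn x)) ∧
      (∀ i, v.grad i =ᵐ[vol Ω] fun x => deriv G (w.fn x) * w.grad i x) ∧
      Tendsto (fun n => ((hφ n).comp hG h0).toH1) atTop (𝓝 v) := by
  obtain ⟨l1, l2⟩ := H1.tendsto_iff.1 hlim
  have dG : Differentiable ℝ G := hG.differentiable (by simp)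
  have cG' : Continuous (deriv G) := hG.continuous_deriv (by simp)
  have lip : ∀ s r, |G s - G r| ≤ L * |s - r| := fun s r =>
    Convex.norm_image_sub_le_of_norm_deriv_le (s := univ) (fun x _ => dG x) (fun x _ => hL x)
      convex_univ (mem_univ _) (mem_univ _)
  have mw : AEStronglyMeasurable w.fn (vol Ω) := (Lp.memLp w.fn).1
  have mG : MemLp (fun x => G (w.fn x)) 2 (vol Ω) :=
    MemLp.of_le_mul (c := L) (Lp.memLp w.fn) (hG.continuous.comp_aestronglyMeasurable mw)
      (Eventually.of_forall fun x => by simpa [h0] using lip (w.fn x) 0)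
  have mD : ∀ i, MemLp (fun x => deriv G (w.fn x) * w.grad i x) 2 (vol Ω) := fun i =>
    memLp_of_bounded_mul (cG'.comp_aestronglyMeasurable mw) (Eventually.of_forall fun x => hL _)
      (Lp.memLp _)
  have t1 : Tendsto (fun n => ((hφ n).comp hG h0).toH1.fn) atTop (𝓝 (mG.toLp _)) := by
    rw [tendsto_iff_norm_sub_tendsto_zero] at l1 ⊢
    have hz := l1.const_mul L
    rw [mul_zero] at hz
    refine squeeze_zero (fun n => norm_nonneg _) (fun n => ?_) hz
    refine Lp.norm_le_mul_norm_of_ae_le_mul ?_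
    filter_upwards [((hφ n).comp hG h0).coeFn_toH1, mG.coeFn_toLp, (hφ n).coeFn_toH1,
      Lp.coeFn_sub ((hφ n).comp hG h0).toH1.fn (mG.toLp _), Lp.coeFn_sub (hφ n).toH1.fn w.fn]
      with x e1 e2 e3 e4 e5
    rw [e4, e5, Pi.sub_apply, Pi.sub_apply, e1, e2, e3]
    exact lip _ _
  have t2 : ∀ i, Tendsto (fun n => ((hφ n).comp hG h0).toH1.grad i) atTop (𝓝 ((mD i).toLp _)) := by
    intro i
    have mn : ∀ n, MemLp (fun x => deriv G (φ n x) * (hφ n).toH1.grad i x) 2 (vol Ω) := fun n =>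
      memLp_of_bounded_mul (cG'.comp (hφ n).continuous).aestronglyMeasurable
        (Eventually.of_forall fun x => hL _) (Lp.memLp _)
    refine (tendsto_toLp_bounded_mul (L := L) (a := fun n x => deriv G (φ n x)) (fun n =>
      (cG'.comp (hφ n).continuous).aestronglyMeasurable) (fun n => Eventually.of_forall fun x => hL _)
      ?_ (l2 i) mn (mD i)).congr fun n => ?_
    · filter_upwards [hae] with x hx using (cG'.tendsto _).comp hx
    · refine Lp.ext ?_
      filter_upwards [(mn n).coeFn_toLp, ((hφ n).comp hG h0).coeFn_grad_toH1 i,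
        (hφ n).coeFn_grad_toH1 i] with x e1 e2 e3
      rw [e1, e2, e3, pderiv_comp (hφ n).differentiable dG]
  obtain ⟨v, hv, v1, v2, v3⟩ := exists_H10_of_tendsto (fun n => ((hφ n).comp hG h0).toH1_mem) t1 t2
  exact ⟨v, hv, v1 ▸ mG.coeFn_toLp, fun i => v2 i ▸ (mD i).coeFn_toLp, v3⟩

/-! ### Truncation -/

/-- A smooth approximation of the positive part. -/
def smoothPos (s : ℝ) : ℝ := s * Real.smoothTransition s

theorem contDiff_smoothPos : ContDiff ℝ (⊤ : ℕ∞) smoothPos :=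
  contDiff_id.mul Real.smoothTransition.contDiff

theorem smoothPos_of_nonpos {s : ℝ} (h : s ≤ 0) : smoothPos s = 0 := by
  rw [smoothPos, Real.smoothTransition.zero_of_nonpos h, mul_zero]

theorem smoothPos_of_one_le {s : ℝ} (h : 1 ≤ s) : smoothPos s = s := by
  rw [smoothPos, Real.smoothTransition.one_of_one_le h, mul_one]

theorem smoothPos_nonneg (s : ℝ) : 0 ≤ smoothPos s := by
  rcases le_total s 0 with h | h
  · exact (smoothPos_of_nonpos h).ge
  · exact mul_nonneg h (Real.smoothTransition.nonneg s)

theorem smoothPos_le (s : ℝ) : smoothPos s ≤ max s 0 := by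
  rcases le_total s 0 with h | h
  · rw [smoothPos_of_nonpos h]; exact le_max_right _ _
  · exact (mul_le_of_le_one_right h (Real.smoothTransition.le_one s)).trans (le_max_left _ _)

/-- Every nonpositive point, zero included, is a global minimum of this nonnegative function. -/
theorem deriv_smoothPos_of_nonpos {s : ℝ} (h : s ≤ 0) : deriv smoothPos s = 0 :=
  IsLocalMin.deriv_eq_zero (Eventually.of_forall fun r => by
    simpa only [smoothPos_of_nonpos h] using smoothPos_nonneg r)

theorem deriv_smoothPos_of_one_lt {s : ℝ} (h : 1 < s) : deriv smoothPos s = 1 := by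
  have : smoothPos =ᶠ[𝓝 s] id := by
    filter_upwards [lt_mem_nhds h] with r hr using smoothPos_of_one_le hr.le
  rw [this.deriv_eq, deriv_id]

theorem exists_bound_deriv_smoothPos : ∃ L, ∀ s, |deriv smoothPos s| ≤ L := by
  obtain ⟨L, hL⟩ := isCompact_Icc.exists_bound_of_continuousOn (s := Icc (0:ℝ) 1)
    (contDiff_smoothPos.continuous_deriv (by simp)).continuousOn
  refine ⟨max L 1, fun s => ?_⟩
  rcases le_total s 0 with h | h
  · simp [deriv_smoothPos_of_nonpos h]
  · rcases lt_or_ge 1 s with h' | h'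
    · simp [deriv_smoothPos_of_one_lt h']
    · exact (hL s ⟨h, h'⟩).trans (le_max_left _ _)

/-- Truncation from below preserves `H¹₀(Ω)`. -/
theorem exists_max_sub_mem_H10 (hΩ : IsOpen Ω) {w : H1 Ω} (hw : w ∈ H10 Ω) {k : ℝ} (hk : 0 ≤ k) :
    ∃ v ∈ H10 Ω, v.fn =ᵐ[vol Ω] (fun x => max (w.fn x - k) 0) ∧
      ∀ i, v.grad i =ᵐ[vol Ω] fun x => if k < w.fn x then w.grad i x else 0 := by
  obtain ⟨L, hL⟩ := exists_bound_deriv_smoothPos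
  obtain ⟨φ, hφ, hlim, hae⟩ := exists_seq_test hΩ hw
  have hN : ∀ n : ℕ, (0:ℝ) < (n:ℝ) + 1 := fun n => by positivity
  -- Rescaling leaves the bound on the derivative unchanged. The functions tend to `(s - k)⁺` and
  -- their derivatives to the indicator of `k < s`, with value zero at `s = k`. The condition `0 ≤
  -- k` ensures that they vanish at zero.
  set G : ℕ → ℝ → ℝ := fun n s => ((n:ℝ) + 1)⁻¹ * smoothPos (((n:ℝ) + 1) * (s - k)) with hGdef
  have cG : ∀ n, ContDiff ℝ (⊤ : ℕ∞) (G n) := fun n =>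
    contDiff_const.mul (contDiff_smoothPos.comp (contDiff_const.mul (contDiff_id.sub contDiff_const)))
  have z : ∀ (n : ℕ) s, s ≤ k → ((n:ℝ) + 1) * (s - k) ≤ 0 := fun n s hs =>
    mul_nonpos_of_nonneg_of_nonpos (hN n).le (by linarith)
  have G0 : ∀ n s, s ≤ k → G n s = 0 := fun n s hs => by
    simp only [hGdef, smoothPos_of_nonpos (z n s hs), mul_zero]
  have dG : ∀ n s, deriv (G n) s = deriv smoothPos (((n:ℝ) + 1) * (s - k)) := fun n s => by
    have h1 : HasDerivAt (fun s : ℝ => ((n:ℝ) + 1) * (s - k)) ((n:ℝ) + 1) s := by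
      simpa using ((hasDerivAt_id s).sub_const k).const_mul ((n:ℝ) + 1)
    have h2 := (((contDiff_smoothPos.differentiable (by simp))
      (((n:ℝ) + 1) * (s - k))).hasDerivAt.comp s h1).const_mul ((n:ℝ) + 1)⁻¹
    refine h2.deriv.trans ?_
    field_simp [(hN n).ne']
  have bG : ∀ n s, |deriv (G n) s| ≤ L := fun n s => by rw [dG]; exact hL _
  have nG : ∀ n s, 0 ≤ G n s := fun n s => mul_nonneg (inv_nonneg.2 (hN n).le) (smoothPos_nonneg _)
  have leG : ∀ n s, G n s ≤ |s| := fun n s => by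
    rcases le_total s k with h | h
    · rw [G0 n s h]; exact abs_nonneg _
    · have h1 : 0 ≤ ((n:ℝ) + 1) * (s - k) := mul_nonneg (hN n).le (by linarith)
      have h2 := smoothPos_le (((n:ℝ) + 1) * (s - k))
      rw [max_eq_left h1] at h2
      calc G n s ≤ ((n:ℝ) + 1)⁻¹ * (((n:ℝ) + 1) * (s - k)) :=
            mul_le_mul_of_nonneg_left h2 (inv_nonneg.2 (hN n).le)
        _ = s - k := by field_simp
        _ ≤ |s| := by linarith [le_abs_self s]
  have big : ∀ s, k < s → ∀ᶠ n : ℕ in atTop, 1 < ((n:ℝ) + 1) * (s - k) := fun s hs => by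
    have : Tendsto (fun n : ℕ => ((n:ℝ) + 1) * (s - k)) atTop atTop :=
      (tendsto_atTop_add_const_right _ _ tendsto_natCast_atTop_atTop).atTop_mul_const (sub_pos.2 hs)
    exact this.eventually_gt_atTop 1
  have lG : ∀ s, Tendsto (fun n => G n s) atTop (𝓝 (max (s - k) 0)) := fun s => by
    rcases le_or_gt s k with h | h
    · simp only [G0 _ s h, max_eq_right (sub_nonpos.2 h)]; exact tendsto_const_nhds
    · rw [max_eq_left (sub_pos.2 h).le]
      refine tendsto_const_nhds.congr' ?_
      filter_upwards [big s h] with n hn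
      simp only [hGdef, smoothPos_of_one_le hn.le]
      field_simp
  have ldG : ∀ s, Tendsto (fun n => deriv (G n) s) atTop (𝓝 (if k < s then 1 else 0)) := fun s => by
    rcases le_or_gt s k with h | h
    · rw [if_neg h.not_gt]
      simp only [dG, deriv_smoothPos_of_nonpos (z _ s h)]; exact tendsto_const_nhds
    · rw [if_pos h]
      refine tendsto_const_nhds.congr' ?_
      filter_upwards [big s h] with n hn
      rw [dG, deriv_smoothPos_of_one_lt hn]
  have mw : AEStronglyMeasurable w.fn (vol Ω) := (Lp.memLp w.fn).1
  have hex : ∀ n, ∃ v ∈ H10 Ω, v.fn =ᵐ[vol Ω] (fun x => G n (w.fn x)) ∧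
      ∀ i, v.grad i =ᵐ[vol Ω] fun x => deriv (G n) (w.fn x) * w.grad i x := fun n => by
    obtain ⟨v, h1, h2, h3, -⟩ := exists_comp_mem_H10 (cG n) (G0 n 0 hk) (bG n) hφ hlim hae
    exact ⟨v, h1, h2, h3⟩
  choose v hv v1 v2 using hex
  have mG : ∀ n, MemLp (fun x => G n (w.fn x)) 2 (vol Ω) := fun n =>
    (memLp_congr_ae (v1 n)).1 (Lp.memLp _)
  have mD : ∀ n i, MemLp (fun x => deriv (G n) (w.fn x) * w.grad i x) 2 (vol Ω) := fun n i =>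
    (memLp_congr_ae (v2 n i)).1 (Lp.memLp _)
  have mP : MemLp (fun x => max (w.fn x - k) 0) 2 (vol Ω) := by
    refine MemLp.of_le (Lp.memLp w.fn)
      (aestronglyMeasurable_of_tendsto_ae atTop (fun n => (mG n).1)
        (Eventually.of_forall fun x => lG _)) (Eventually.of_forall fun x => ?_)
    rw [Real.norm_of_nonneg (le_max_right _ _)]
    exact max_le (by rw [Real.norm_eq_abs]; linarith [le_abs_self (w.fn x)]) (norm_nonneg _)
  have mI : ∀ i, MemLp (fun x => (if k < w.fn x then 1 else 0) * w.grad i x) 2 (vol Ω) := fun i => by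
    refine MemLp.of_le (Lp.memLp (w.grad i))
      (aestronglyMeasurable_of_tendsto_ae atTop (fun n => (mD n i).1)
        (Eventually.of_forall fun x => (ldG _).mul_const _)) (Eventually.of_forall fun x => ?_)
    split_ifs <;> simp
  have e1 : ∀ n, (mG n).toLp _ = (v n).fn := fun n =>
    Lp.ext ((mG n).coeFn_toLp.trans (v1 n).symm)
  have e2 : ∀ n i, (mD n i).toLp _ = (v n).grad i := fun n i =>
    Lp.ext ((mD n i).coeFn_toLp.trans (v2 n i).symm)
  have t1 : Tendsto (fun n => (v n).fn) atTop (𝓝 (mP.toLp _)) := by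
    simp only [← e1]
    exact tendsto_toLp_of_dominated mG mP (Lp.memLp w.fn).abs
      (fun n => Eventually.of_forall fun x => (abs_of_nonneg (nG n _)).trans_le (leG n _))
      (Eventually.of_forall fun x => lG _)
  have t2 : ∀ i, Tendsto (fun n => (v n).grad i) atTop (𝓝 ((mI i).toLp _)) := fun i => by
    simp only [← e2]
    exact tendsto_toLp_bounded_mul
      (fun n => ((cG n).continuous_deriv (by simp)).comp_aestronglyMeasurable mw)
      (fun n => Eventually.of_forall fun x => bG n _) (Eventually.of_forall fun x => ldG _)
      tendsto_const_nhds (fun n => mD n i) (mI i)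
  obtain ⟨p, hp, p1, p2, -⟩ := exists_H10_of_tendsto hv t1 t2
  refine ⟨p, hp, p1 ▸ mP.coeFn_toLp, fun i => ?_⟩
  rw [p2 i]
  filter_upwards [(mI i).coeFn_toLp] with x hx
  rw [hx]; split_ifs <;> simp

/-! ### Products with bounded functions -/

/-- Bounded functions in `H¹₀(Ω)` are limits of uniformly bounded test functions. -/
theorem exists_bounded_seq_test (hΩ : IsOpen Ω) {w : H1 Ω} (hw : w ∈ H10 Ω) {M : ℝ}
    (hM : ∀ᵐ x ∂(vol Ω), |w.fn x| ≤ M) :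
    ∃ (C : ℝ) (φ : ℕ → Plane → ℝ) (hφ : ∀ n, IsTest Ω (φ n)), (∀ n x, |φ n x| ≤ C) ∧
      Tendsto (fun n => (hφ n).toH1) atTop (𝓝 w) ∧
      ∀ᵐ x ∂(vol Ω), Tendsto (fun n => φ n x) atTop (𝓝 (w.fn x)) := by
  obtain ⟨φ, hφ, hlim, hae⟩ := exists_seq_test hΩ hw
  -- The cutoff `s ↦ s χ(s)` is bounded and is the identity for `|s| ≤ M`. Composing with it bounds
  -- the approximating test functions and leaves `w` unchanged.
  let χ : ContDiffBump (0:ℝ) := ⟨|M| + 1, |M| + 2, by positivity, by linarith⟩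
  set G : ℝ → ℝ := fun s => s * χ s with hG
  have cG : ContDiff ℝ (⊤ : ℕ∞) G := contDiff_id.mul χ.contDiff
  have sG : HasCompactSupport G := χ.hasCompactSupport.mul_left
  have G0 : G 0 = 0 := zero_mul _
  obtain ⟨L, hL⟩ := (sG.deriv).exists_bound_of_continuous (cG.continuous_deriv (by simp))
  obtain ⟨C, hC⟩ := sG.exists_bound_of_continuous cG.continuous
  obtain ⟨v, hv, v1, -, v3⟩ := exists_comp_mem_H10 cG G0 hL hφ hlim hae
  have Gw : ∀ s, |s| ≤ M → G s = s := fun s hs => by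
    have : χ s = 1 := χ.one_of_mem_closedBall (by
      rw [mem_closedBall_zero_iff, Real.norm_eq_abs]
      exact hs.trans ((le_abs_self M).trans (by linarith [show χ.rIn = |M| + 1 from rfl])))
    simp only [hG, this, mul_one]
  have e : v = w := H1.ext_fn hΩ (Lp.ext (by
    filter_upwards [v1, hM] with x h1 h2
    rw [h1, Gw _ h2]))
  refine ⟨C, fun n x => G (φ n x), fun n => (hφ n).comp cG G0, fun n x => hC _, e ▸ v3, ?_⟩
  filter_upwards [hae, hM] with x h1 h2
  have := (cG.continuous.tendsto _).comp h1
  rwa [Gw _ h2] at this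

theorem memLp_mul_of_ae_bound {f g : L2 Ω} {M : ℝ} (hM : ∀ᵐ x ∂(vol Ω), |f x| ≤ M) :
    MemLp (fun x => f x * g x) 2 (vol Ω) :=
  memLp_of_bounded_mul (Lp.memLp f).1 hM (Lp.memLp g)

/-- Products of bounded functions in `H¹₀(Ω)` and `H¹(Ω)`. -/
theorem exists_mul_mem_H10 (hΩ : IsOpen Ω) {w : H1 Ω} (hw : w ∈ H10 Ω) {M : ℝ}
    (hM : ∀ᵐ x ∂(vol Ω), |w.fn x| ≤ M) {d : H1 Ω} {D : ℝ} (hD : ∀ᵐ x ∂(vol Ω), |d.fn x| ≤ D) :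
    ∃ p ∈ H10 Ω, p.fn =ᵐ[vol Ω] (fun x => d.fn x * w.fn x) ∧
      ∀ i, p.grad i =ᵐ[vol Ω] fun x => d.fn x * w.grad i x + w.fn x * d.grad i x := by
  obtain ⟨C, φ, hφ, hC, hlim, hae⟩ := exists_bounded_seq_test hΩ hw hM
  obtain ⟨l1, l2⟩ := H1.tendsto_iff.1 hlim
  choose p hp p1 p2 using fun n => (hφ n).exists_mul_mem_H10 hΩ d
  have md : AEStronglyMeasurable d.fn (vol Ω) := (Lp.memLp d.fn).1
  have t1 := tendsto_toLp_bounded_mul (fun n => md) (fun n => hD)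
    (Eventually.of_forall fun x => tendsto_const_nhds) l1
    (fun n => memLp_mul_of_ae_bound hD) (memLp_mul_of_ae_bound hD)
  have t2 := fun i => tendsto_toLp_bounded_mul (fun n => md) (fun n => hD)
    (Eventually.of_forall fun x => tendsto_const_nhds) (l2 i)
    (fun n => memLp_mul_of_ae_bound hD) (memLp_mul_of_ae_bound hD)
  -- Here the uniform bound on the test functions is needed: `∂ᵢd` lies only in `L²`, so `φ n ∂ᵢd`
  -- converges in `L²` by domination.
  have t3 := fun i => tendsto_toLp_bounded_mul (g := fun _ => d.grad i)
    (fun n => (hφ n).continuous.aestronglyMeasurable (μ := vol Ω))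
    (fun n => Eventually.of_forall fun x => hC n x) hae tendsto_const_nhds
    (fun n => (hφ n).memLp_mul _) (memLp_mul_of_ae_bound hM)
  obtain ⟨r, hr, r1, r2, -⟩ := exists_H10_of_tendsto hp
    (t1.congr fun n => Lp.ext (by
      filter_upwards [MemLp.coeFn_toLp (memLp_mul_of_ae_bound (g := (hφ n).toH1.fn) hD), p1 n,
        (hφ n).coeFn_toH1] with x e1 e2 e3
      rw [e1, e2, e3, mul_comm]))
    (fun i => ((t2 i).add (t3 i)).congr fun n => Lp.ext (by
      filter_upwards [MemLp.coeFn_toLp (memLp_mul_of_ae_bound (g := (hφ n).toH1.grad i) hD),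
        MemLp.coeFn_toLp ((hφ n).memLp_mul (d.grad i)), p2 n i, (hφ n).coeFn_grad_toH1 i,
        Lp.coeFn_add (MemLp.toLp _ (memLp_mul_of_ae_bound (g := (hφ n).toH1.grad i) hD))
          (MemLp.toLp _ ((hφ n).memLp_mul (d.grad i)))] with x e1 e2 e3 e4 e5
      rw [e5, Pi.add_apply, e1, e2, e3, e4]; ring))
  refine ⟨r, hr, r1 ▸ MemLp.coeFn_toLp _, fun i => ?_⟩
  rw [r2 i]
  filter_upwards [Lp.coeFn_add (MemLp.toLp _ (memLp_mul_of_ae_bound (g := w.grad i) hD))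
    (MemLp.toLp _ (memLp_mul_of_ae_bound (g := d.grad i) hM)),
    MemLp.coeFn_toLp (memLp_mul_of_ae_bound (g := w.grad i) hD),
    MemLp.coeFn_toLp (memLp_mul_of_ae_bound (g := d.grad i) hM)] with x e1 e2 e3
  rw [e1, Pi.add_apply, e2, e3]

end Chain

/-! ### The elliptic form in terms of bounded operators. -/

section BoundedMul

variable {Ω : Set Plane}

/-- Multiplication by a bounded function, as an operator on `L²(Ω)`. -/
def bmul {a : Plane → ℝ} {C : ℝ} (ha : AEStronglyMeasurable a (vol Ω))
    (hC : ∀ᵐ x ∂(vol Ω), |a x| ≤ C) : L2 Ω →L[ℝ] L2 Ω :=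
  LinearMap.mkContinuous
    { toFun := fun g => (memLp_of_bounded_mul ha hC (Lp.memLp g)).toLp _
      map_add' := fun g g' => by
        refine Lp.ext ?_
        filter_upwards [(memLp_of_bounded_mul ha hC (Lp.memLp (g + g'))).coeFn_toLp,
          (memLp_of_bounded_mul ha hC (Lp.memLp g)).coeFn_toLp,
          (memLp_of_bounded_mul ha hC (Lp.memLp g')).coeFn_toLp,
          Lp.coeFn_add ((memLp_of_bounded_mul ha hC (Lp.memLp g)).toLp _)
            ((memLp_of_bounded_mul ha hC (Lp.memLp g')).toLp _),
          Lp.coeFn_add g g'] with x h1 h2 h3 h4 h5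
        rw [h1, h4, Pi.add_apply, h2, h3, h5, Pi.add_apply]; ring
      map_smul' := fun c g => by
        refine Lp.ext ?_
        filter_upwards [(memLp_of_bounded_mul ha hC (Lp.memLp (c • g))).coeFn_toLp,
          (memLp_of_bounded_mul ha hC (Lp.memLp g)).coeFn_toLp,
          Lp.coeFn_smul c ((memLp_of_bounded_mul ha hC (Lp.memLp g)).toLp _),
          Lp.coeFn_smul c g] with x h1 h2 h3 h4
        rw [h1, RingHom.id_apply, h3, Pi.smul_apply, h2, h4, Pi.smul_apply, smul_eq_mul,
          smul_eq_mul]; ring }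
    C fun g => by
      refine Lp.norm_le_mul_norm_of_ae_le_mul ?_
      filter_upwards [hC, (memLp_of_bounded_mul ha hC (Lp.memLp g)).coeFn_toLp] with x h1 h2
      refine (congrArg norm h2).trans_le ?_
      rw [norm_mul]
      exact mul_le_mul_of_nonneg_right h1 (norm_nonneg _)

theorem coeFn_bmul {a : Plane → ℝ} {C : ℝ} (ha : AEStronglyMeasurable a (vol Ω))
    (hC : ∀ᵐ x ∂(vol Ω), |a x| ≤ C) (g : L2 Ω) : bmul ha hC g =ᵐ[vol Ω] fun x => a x * g x :=
  (memLp_of_bounded_mul ha hC (Lp.memLp g)).coeFn_toLp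

theorem norm_bmul_le {a : Plane → ℝ} {C : ℝ} (ha : AEStronglyMeasurable a (vol Ω))
    (hC : ∀ᵐ x ∂(vol Ω), |a x| ≤ C) (g : L2 Ω) : ‖bmul ha hC g‖ ≤ C * ‖g‖ := by
  refine Lp.norm_le_mul_norm_of_ae_le_mul ?_
  filter_upwards [hC, coeFn_bmul ha hC g] with x h1 h2
  rw [h2, norm_mul]
  exact mul_le_mul_of_nonneg_right h1 (norm_nonneg _)

theorem aesm (g : L2 Ω) : AEStronglyMeasurable g (vol Ω) := (Lp.memLp g).1

theorem aesm_top (g : LInf Ω) : AEStronglyMeasurable g (vol Ω) := (Lp.memLp g).1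

theorem ae_abs_le {q : H1 Ω} {q₀ q₁ : ℝ} (h0 : 0 ≤ q₀) (hq : q ∈ Conductivities Ω q₀ q₁) :
    ∀ᵐ x ∂(vol Ω), |q.fn x| ≤ q₁ := by
  filter_upwards [hq] with x hx
  rw [abs_of_nonneg (h0.trans hx.1)]; exact hx.2

theorem ae_abs_le_top {c : LInf Ω} {c₁ : ℝ} (hc : ∀ᵐ x ∂(vol Ω), 0 ≤ c x ∧ c x ≤ c₁) :
    ∀ᵐ x ∂(vol Ω), |c x| ≤ c₁ := by
  filter_upwards [hc] with x hx
  rw [abs_of_nonneg hx.1]; exact hx.2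

variable [IsFiniteMeasure (vol Ω)]

/-- Each coefficient is attached to the first argument. For the convection term this needs `v ∈
H¹₀`, which puts `bᵢ v` in `L²`; the second argument may then be any `H¹` function. -/
theorem form_eq (hΩ : IsOpen Ω) {q : H1 Ω} {Q : ℝ} (hq : ∀ᵐ x ∂(vol Ω), |q.fn x| ≤ Q)
    (b : Fin 2 → H1 Ω) {c : LInf Ω} {c₁ : ℝ} (hc : ∀ᵐ x ∂(vol Ω), |c x| ≤ c₁) (v : H10 Ω)
    (φ : H1 Ω) :
    form q b c v φ = (∑ i, inner ℝ (bmul (aesm q.fn) hq (v.1.grad i)) (φ.grad i))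
      - (∑ i, inner ℝ (mulL hΩ (b i) v) (φ.grad i))
      + inner ℝ (bmul (aesm_top c) hc v.1.fn) φ.fn := by
  simp only [form, inner_eq_integral]
  rw [← integral_finsetSum _ fun i _ => integrable_mul _ _,
    ← integral_finsetSum _ fun i _ => integrable_mul _ _]
  congr 1
  · congr 1
    · refine integral_congr_ae ?_
      filter_upwards [ae_all_iff.2 fun i => coeFn_bmul (aesm q.fn) hq (v.1.grad i)] with x hx
      rw [Finset.mul_sum]
      exact Finset.sum_congr rfl fun i _ => by rw [hx i]; ring
    · refine integral_congr_ae ?_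
      filter_upwards [ae_all_iff.2 fun i => coeFn_mulL hΩ (b i) v] with x hx
      rw [Finset.mul_sum]
      exact Finset.sum_congr rfl fun i _ => by rw [hx i]; ring
  · refine integral_congr_ae ?_
    filter_upwards [coeFn_bmul (aesm_top c) hc v.1.fn] with x hx
    rw [hx]

theorem form_neg (hΩ : IsOpen Ω) {q : H1 Ω} {Q : ℝ} (hq : ∀ᵐ x ∂(vol Ω), |q.fn x| ≤ Q)
    (b : Fin 2 → H1 Ω) {c : LInf Ω} {c₁ : ℝ} (hc : ∀ᵐ x ∂(vol Ω), |c x| ≤ c₁) (v : H10 Ω)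
    (φ : H1 Ω) : form q b c (-v : H10 Ω) φ = -form q b c v φ := by
  rw [form_eq hΩ hq b hc, form_eq hΩ hq b hc]
  simp only [map_neg, inner_neg_left, NegMemClass.coe_neg, H1.fn_neg, H1.grad_neg,
    Finset.sum_neg_distrib]
  ring

end BoundedMul

/-! ### Boundedness of solutions of the elliptic equation. -/

section Stampacchia

/-- If `a j ≤ a 0 4⁻ʲ`, squaring supplies one factor `4⁻ʲ` that cancels the growth `4ʲ` of the
recursion, and `4 K a 0 ≤ 1` supplies the next quarter. -/
theorem fast_geometric_decay {a : ℕ → ℝ} {K : ℝ} (hK : 0 ≤ K) (ha : ∀ j, 0 ≤ a j)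
    (h : ∀ j, a (j + 1) ≤ K * 4 ^ j * a j ^ 2) (h0 : 4 * K * a 0 ≤ 1) (j : ℕ) :
    a j ≤ a 0 * (1 / 4) ^ j := by
  induction j with
  | zero => simp
  | succ j ih =>
    have h1 : a j ^ 2 ≤ (a 0 * (1 / 4) ^ j) ^ 2 := pow_le_pow_left₀ (ha j) ih 2
    have e : (4:ℝ) ^ j * (1 / 4) ^ j = 1 := by rw [← mul_pow]; norm_num
    have hp : (0:ℝ) ≤ (1 / 4) ^ j := by positivity
    calc a (j + 1) ≤ K * 4 ^ j * (a 0 * (1 / 4) ^ j) ^ 2 :=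
          (h j).trans (mul_le_mul_of_nonneg_left h1 (by positivity))
      _ = (K * a 0) * (a 0 * (1 / 4) ^ j) * (4 ^ j * (1 / 4) ^ j) := by ring
      _ = (K * a 0) * (a 0 * (1 / 4) ^ j) := by rw [e, mul_one]
      _ ≤ 1 / 4 * (a 0 * (1 / 4) ^ j) :=
          mul_le_mul_of_nonneg_right (by linarith) (mul_nonneg (ha 0) hp)
      _ = a 0 * (1 / 4) ^ (j + 1) := by ring

/-- One step between two levels at distance `δ`: `h1` is the Sobolev inequality on a level set, `h2`
the energy estimate, `h3` Chebyshev's inequality. Eliminating the seminorm `X` and the root `s` of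
the measure leaves an estimate quadratic in the previous norm `a'`. -/
theorem level_step {a a' X s S q₀ B G k δ : ℝ} (hq₀ : 0 < q₀) (hS : 0 ≤ S) (hB : 0 ≤ B)
    (hG : 0 ≤ G) (hk : 0 ≤ k) (hδ : 0 < δ) (ha : 0 ≤ a) (hs : 0 ≤ s) (hX : 0 ≤ X)
    (h1 : a ≤ 2 * S * s * X) (h2 : q₀ * X ^ 2 ≤ 2 * B * S * a * X + (k * B + G) * a)
    (h3 : s * δ ≤ a') (h4 : a ≤ a') :
    a ≤ 4 * S ^ 2 / q₀ * (B / δ + (k * B + G) / δ ^ 2) * a' ^ 2 := by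
  have ha' := ha.trans h4
  rcases hX.eq_or_lt with h | hX
  · rw [← h, mul_zero] at h1
    exact h1.trans (by positivity)
  have hkB : 0 ≤ k * B + G := by positivity
  have h5 : q₀ * X ≤ 2 * B * S * a + (k * B + G) * (2 * S * s) := by
    refine le_of_mul_le_mul_right ?_ hX
    nlinarith [mul_le_mul_of_nonneg_left h1 hkB]
  have hσ : s ≤ a' / δ := (le_div_iff₀ hδ).2 h3
  have h6 : a * q₀ ≤ 4 * S ^ 2 * (B * (s * a') + (k * B + G) * s ^ 2) := by
    have i1 : a * q₀ ≤ 2 * S * s * (q₀ * X) := by nlinarith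
    have i2 : 2 * S * s * (q₀ * X) ≤ 2 * S * s * (2 * B * S * a + (k * B + G) * (2 * S * s)) :=
      mul_le_mul_of_nonneg_left h5 (by positivity)
    have i3 : B * (s * a) ≤ B * (s * a') := by gcongr
    have i4 := mul_le_mul_of_nonneg_left i3 (by positivity : 0 ≤ 4 * S ^ 2)
    nlinarith
  have h7 : B * (s * a') + (k * B + G) * s ^ 2 ≤
      B * (a' / δ * a') + (k * B + G) * (a' / δ) ^ 2 := by gcongr
  have h8 := h6.trans (mul_le_mul_of_nonneg_left h7 (by positivity : 0 ≤ 4 * S ^ 2))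
  rw [← le_div_iff₀ hq₀] at h8
  refine h8.trans (le_of_eq ?_)
  field_simp

variable {Ω : Set Plane}

/-- The sum of the norms of the diagonal derivatives of a vector field. -/
def divNorm (b : Fin 2 → H1 Ω) : ℝ := ∑ i, ‖(b i).grad i‖

theorem divNorm_nonneg (b : Fin 2 → H1 Ω) : 0 ≤ divNorm b :=
  Finset.sum_nonneg fun _ _ => norm_nonneg _

theorem abs_sum_inner_grad_le (hΩ : IsOpen Ω) (b : Fin 2 → H1 Ω) (p : H10 Ω) :
    |∑ i, inner ℝ (b i).fn (p.1.grad i)| ≤ divNorm b * ‖p.1.fn‖ := by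
  refine (Finset.abs_sum_le_sum_abs _ _).trans ?_
  rw [divNorm, Finset.sum_mul]
  refine Finset.sum_le_sum fun i _ => ?_
  rw [inner_grad_eq hΩ _ p.2, abs_neg]
  exact abs_real_inner_le_norm _ _

theorem norm_le_norm_of_max_sub {v w w' : L2 Ω} {l k : ℝ} (hlk : l ≤ k)
    (hw : w =ᵐ[vol Ω] fun x => max (v x - l) 0) (hw' : w' =ᵐ[vol Ω] fun x => max (v x - k) 0) :
    ‖w'‖ ≤ ‖w‖ := by
  refine Lp.norm_le_norm_of_ae_le ?_
  filter_upwards [hw, hw'] with x h1 h2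
  rw [h1, h2, Real.norm_of_nonneg (le_max_right _ _), Real.norm_of_nonneg (le_max_right _ _)]
  exact max_le_max (by linarith) le_rfl

/-- The constant in the maximum principle. -/
def stampConst (b : Fin 2 → H1 Ω) (q₀ : ℝ) : ℝ :=
  256 * (2 * divNorm b + 1) * sobolevConst ^ 2 / q₀

theorem stampConst_nonneg (b : Fin 2 → H1 Ω) {q₀ : ℝ} (hq₀ : 0 < q₀) : 0 ≤ stampConst b q₀ := by
  have := divNorm_nonneg b
  rw [stampConst]; positivity

variable [IsFiniteMeasure (vol Ω)]

theorem norm_mulL_self_le (hΩ : IsOpen Ω) (p : H10 Ω) :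
    ‖mulL hΩ p.1 p‖ ≤ 4 * sobolevConst * ‖p.1.fn‖ * p.1.seminorm :=
  (norm_mulL_le hΩ p.1 p).trans (le_of_eq (by ring))

/-- Since `p ∂ᵢp` is half the derivative of `p²`, the derivative can be moved onto `bᵢ`. The result
is linear in the seminorm, so the convection term can be absorbed by diffusion at the cost of an
`L²` term. -/
theorem abs_sum_inner_mulL_grad_le (hΩ : IsOpen Ω) (b : Fin 2 → H1 Ω) (p : H10 Ω) :
    |∑ i, inner ℝ (mulL hΩ (b i) p) (p.1.grad i)| ≤
      2 * divNorm b * sobolevConst * ‖p.1.fn‖ * p.1.seminorm := by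
  have h : ∀ i ∈ Finset.univ, |inner ℝ (mulL hΩ (b i) p) (p.1.grad i)| ≤
      ‖(b i).grad i‖ * (2 * sobolevConst * ‖p.1.fn‖ * p.1.seminorm) := fun i _ => by
    rw [inner_mulL_grad, abs_mul]
    have h1 := (abs_real_inner_le_norm ((b i).grad i) (mulL hΩ p.1 p)).trans
      (mul_le_mul_of_nonneg_left (norm_mulL_self_le hΩ p) (norm_nonneg _))
    have h2 : |(-(1 / 2) : ℝ)| = 1 / 2 := by norm_num
    rw [h2]; linarith
  refine (Finset.abs_sum_le_sum_abs _ _).trans ((Finset.sum_le_sum h).trans (le_of_eq ?_))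
  rw [← Finset.sum_mul, divNorm]; ring

/-- Testing the elliptic equation with a truncation of its solution. -/
theorem energy_truncation (hΩ : IsOpen Ω) {q : H1 Ω} {b : Fin 2 → H1 Ω} {c : LInf Ω}
    {q₀ q₁ c₁ : ℝ} (hq₀ : 0 < q₀) (hq : q ∈ Conductivities Ω q₀ q₁)
    (hc : ∀ᵐ x ∂(vol Ω), 0 ≤ c x ∧ c x ≤ c₁) {v : H10 Ω} {g : L2 Ω}
    (hv : ∀ φ ∈ H10 Ω, form q b c v φ = inner ℝ g φ.fn) {k : ℝ} (hk : 0 ≤ k) {w : H10 Ω}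
    (w1 : w.1.fn =ᵐ[vol Ω] fun x => max (v.1.fn x - k) 0)
    (w2 : ∀ i, w.1.grad i =ᵐ[vol Ω] fun x => if k < v.1.fn x then v.1.grad i x else 0) :
    q₀ * w.1.seminorm ^ 2 ≤ 2 * divNorm b * sobolevConst * ‖w.1.fn‖ * w.1.seminorm +
      (k * divNorm b + ‖g‖) * ‖w.1.fn‖ := by
  have h := hv w.1 w.2
  rw [form_eq hΩ (ae_abs_le hq₀.le hq) b (ae_abs_le_top hc)] at h
  have hA : q₀ * w.1.seminorm ^ 2 ≤
      ∑ i, inner ℝ (bmul (aesm q.fn) (ae_abs_le hq₀.le hq) (v.1.grad i)) (w.1.grad i) := by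
    rw [H1.seminorm_sq, Finset.mul_sum]
    refine Finset.sum_le_sum fun i _ => ?_
    rw [← real_inner_self_eq_norm_sq, inner_eq_integral, inner_eq_integral, ← integral_const_mul]
    refine integral_mono_ae ((integrable_mul _ _).const_mul _) (integrable_mul _ _) ?_
    filter_upwards [hq, w2 i, coeFn_bmul (aesm q.fn) (ae_abs_le hq₀.le hq) (v.1.grad i)]
      with x e1 e2 e3
    simp only [e2, e3]
    split_ifs
    · nlinarith [mul_self_nonneg (v.1.grad i x)]
    · simp
  -- Where the gradient of `w` is nonzero, `v = w + k`. The part with `w` is quadratic in the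
  -- truncation, and the part with `k` is integrated by parts onto `b`.
  have hB : ∀ i, inner ℝ (mulL hΩ (b i) v) (w.1.grad i) =
      inner ℝ (mulL hΩ (b i) w) (w.1.grad i) + k * inner ℝ (b i).fn (w.1.grad i) := fun i => by
    simp only [inner_eq_integral]
    rw [← integral_const_mul, ← integral_add (integrable_mul _ _) ((integrable_mul _ _).const_mul _)]
    refine integral_congr_ae ?_
    filter_upwards [coeFn_mulL hΩ (b i) v, coeFn_mulL hΩ (b i) w, w1, w2 i] with x e1 e2 e3 e4
    rw [e1, e2, e3, e4]
    split_ifs with hx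
    · rw [max_eq_left (sub_pos.2 hx).le]; ring
    · simp
  have hC : 0 ≤ inner ℝ (bmul (aesm_top c) (ae_abs_le_top hc) v.1.fn) w.1.fn := by
    rw [inner_eq_integral]
    refine integral_nonneg_of_ae ?_
    filter_upwards [coeFn_bmul (aesm_top c) (ae_abs_le_top hc) v.1.fn, w1, hc] with x e1 e2 e3
    rw [e1, e2, Pi.zero_apply]
    rcases le_total (v.1.fn x - k) 0 with hx | hx
    · rw [max_eq_right hx, mul_zero]
    · rw [max_eq_left hx]
      exact mul_nonneg (mul_nonneg e3.1 (by linarith)) hx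
  simp only [hB, Finset.sum_add_distrib, ← Finset.mul_sum] at h
  have h1 := le_abs_self (∑ i, inner ℝ (mulL hΩ (b i) w) (w.1.grad i)) |>.trans
    (abs_sum_inner_mulL_grad_le hΩ b w)
  have h2 := mul_le_mul_of_nonneg_left ((le_abs_self _).trans (abs_sum_inner_grad_le hΩ b w)) hk
  have h3 := real_inner_le_norm g w.1.fn
  linarith

/-- Chebyshev's inequality: on the set where `v` exceeds `k`, its truncation at `l` is at least `k -
l`. -/
theorem sqrt_measureReal_mul_le {v w : L2 Ω} {l k : ℝ} (hlk : l < k)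
    (hw : w =ᵐ[vol Ω] fun x => max (v x - l) 0) :
    √((vol Ω).real {x | k < v x}) * (k - l) ≤ ‖w‖ := by
  have hA : MeasurableSet {x | k < v x} :=
    measurableSet_lt measurable_const (Lp.stronglyMeasurable v).measurable
  refine le_of_sq_le_sq ?_ (norm_nonneg _)
  rw [mul_pow, Real.sq_sqrt measureReal_nonneg, norm_sq_eq_integral, ← smul_eq_mul,
    ← integral_indicator_const _ hA]
  refine integral_mono_ae ((integrable_const _).indicator hA) (Lp.memLp w).integrable_sq ?_
  filter_upwards [hw] with x hx
  by_cases hxA : x ∈ {x | k < v x}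
  · rw [indicator_of_mem hxA, hx]
    have : k < v x := hxA
    exact pow_le_pow_left₀ (by linarith) (le_max_of_le_left (by linarith)) 2
  · rw [indicator_of_notMem hxA]; exact sq_nonneg _

/-- Stampacchia's iteration over the levels `M (1 - 2^{-(j+1)})`, which increase to `M`. The norms
of the truncations satisfy a quadratic recursion; the lower bound on `M` in terms of `‖v‖` makes the
initial one small enough, so the truncation at `M` vanishes. -/
theorem ae_le_of_form_eq (hΩ : IsOpen Ω) {q : H1 Ω} {b : Fin 2 → H1 Ω} {c : LInf Ω}
    {q₀ q₁ c₁ : ℝ} (hq₀ : 0 < q₀) (hq : q ∈ Conductivities Ω q₀ q₁)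
    (hc : ∀ᵐ x ∂(vol Ω), 0 ≤ c x ∧ c x ≤ c₁) {v : H10 Ω} {g : L2 Ω}
    (hv : ∀ φ ∈ H10 Ω, form q b c v φ = inner ℝ g φ.fn) {M : ℝ} (hM : 0 < M) (hg : ‖g‖ ≤ M)
    (hvM : stampConst b q₀ * ‖v.1.fn‖ ≤ M) : ∀ᵐ x ∂(vol Ω), v.1.fn x ≤ M := by
  set k : ℕ → ℝ := fun j => M * (1 - (1 / 2) ^ (j + 1)) with hkdef
  have hp1 : ∀ j : ℕ, ((1:ℝ) / 2) ^ j ≤ 1 := fun j => pow_le_one₀ (by norm_num) (by norm_num)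
  have hk0 : ∀ j, 0 ≤ k j := fun j => mul_nonneg hM.le (by linarith [hp1 (j + 1)])
  have hkM : ∀ j, k j ≤ M := fun j => by
    have : (0:ℝ) < (1 / 2) ^ (j + 1) := by positivity
    simp only [hkdef]; nlinarith
  have hkd : ∀ j, k (j + 1) - k j = M * (1 / 2) ^ (j + 2) := fun j => by
    simp only [hkdef]; ring
  have hdpos : ∀ j : ℕ, 0 < M * (1 / 2) ^ (j + 2) := fun j => by positivity
  choose w hw w1 w2 using fun j => exists_max_sub_mem_H10 hΩ v.2 (hk0 j)
  have hS := sobolevConst_nonneg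
  have hB := divNorm_nonneg b
  -- The gap between consecutive levels is `M 2^{-(j+2)}`. Its inverse square contributes `16 · 4ʲ /
  -- M²`, while levels and right-hand side contribute at most a factor `M (divNorm b + 1)`.
  set K : ℝ := 64 * (2 * divNorm b + 1) * sobolevConst ^ 2 / q₀ / M with hK
  have hK0 : 0 ≤ K := by positivity
  have step : ∀ j, ‖(w (j + 1)).fn‖ ≤ K * 4 ^ j * ‖(w j).fn‖ ^ 2 := fun j => by
    have hlt : k j < k (j + 1) := by linarith [hkd j, hdpos j]
    have s1 := norm_fn_le_of_support hΩ (hw (j + 1)) (A := {x | k (j + 1) < v.1.fn x})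
      (measurableSet_lt measurable_const (Lp.stronglyMeasurable v.1.fn).measurable) fun i => by
        filter_upwards [w2 (j + 1) i] with x hx hxA
        rw [hx, if_neg hxA]
    have s2 := energy_truncation hΩ hq₀ hq hc hv (hk0 (j + 1)) (w := ⟨w (j + 1), hw (j + 1)⟩)
      (w1 (j + 1)) (w2 (j + 1))
    have s3 := sqrt_measureReal_mul_le hlt (w1 j)
    rw [hkd] at s3
    refine (level_step hq₀ hS hB (norm_nonneg g) (hk0 _) (hdpos j) (norm_nonneg _)
      (Real.sqrt_nonneg _) (w (j + 1)).seminorm_nonneg s1 s2 s3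
      (norm_le_norm_of_max_sub hlt.le (w1 j) (w1 (j + 1)))).trans ?_
    refine mul_le_mul_of_nonneg_right ?_ (sq_nonneg _)
    have hP : (0:ℝ) < 4 ^ j := by positivity
    have e1 : divNorm b / (M * (1 / 2) ^ (j + 2)) ≤ divNorm b * (16 * 4 ^ j) / M := by
      have : divNorm b / (M * (1 / 2) ^ (j + 2)) = divNorm b * (4 * 2 ^ j) / M := by
        rw [one_div, inv_pow]; field_simp; ring
      rw [this]
      have h24 : (2:ℝ) ^ j ≤ 4 ^ j := pow_le_pow_left₀ (by norm_num) (by norm_num) j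
      gcongr
      norm_num
    have e2 : (k (j + 1) * divNorm b + ‖g‖) / (M * (1 / 2) ^ (j + 2)) ^ 2 ≤
        (divNorm b + 1) * (16 * 4 ^ j) / M := by
      calc _ ≤ (M * divNorm b + M) / (M * (1 / 2) ^ (j + 2)) ^ 2 := by
            gcongr; exact hkM _
        _ = _ := by
            have h24 : ((1:ℝ) / 2) ^ (j + 2) = (4 * 2 ^ j)⁻¹ := by
              rw [one_div, inv_pow]; congr 1; ring
            have h4 : (4:ℝ) ^ j = 2 ^ j * 2 ^ j := by rw [← mul_pow]; norm_num
            rw [h24, h4]; field_simp; ring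
    calc _ ≤ 4 * sobolevConst ^ 2 / q₀ * (divNorm b * (16 * 4 ^ j) / M +
          (divNorm b + 1) * (16 * 4 ^ j) / M) := by gcongr
      _ = K * 4 ^ j := by rw [hK]; field_simp; ring
  have hw0 : ‖(w 0).fn‖ ≤ ‖v.1.fn‖ := by
    refine Lp.norm_le_norm_of_ae_le ?_
    filter_upwards [w1 0] with x hx
    rw [hx, Real.norm_of_nonneg (le_max_right _ _), Real.norm_eq_abs]
    exact max_le (by linarith [le_abs_self (v.1.fn x), hk0 0]) (abs_nonneg _)
  -- The constant `256 = 4 · 64` in `stampConst` is chosen so that `4 K = stampConst b q₀ / M`.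
  have start : 4 * K * ‖(w 0).fn‖ ≤ 1 := by
    have : 4 * K = stampConst b q₀ / M := by rw [hK, stampConst]; field_simp; ring
    rw [this, div_mul_eq_mul_div, div_le_one hM]
    exact (mul_le_mul_of_nonneg_left hw0 (stampConst_nonneg b hq₀)).trans hvM
  have decay := fast_geometric_decay (a := fun j => ‖(w j).fn‖) hK0 (fun j => norm_nonneg _) step start
  obtain ⟨z, hz, z1, -⟩ := exists_max_sub_mem_H10 hΩ v.2 hM.le
  have hz0 : ‖z.fn‖ ≤ 0 := by
    have hlim : Tendsto (fun j : ℕ => ‖(w 0).fn‖ * (1 / 4) ^ j) atTop (𝓝 0) := by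
      simpa using (tendsto_pow_atTop_nhds_zero_of_lt_one (r := (1 / 4 : ℝ)) (by norm_num)
        (by norm_num)).const_mul ‖(w 0).fn‖
    exact ge_of_tendsto' hlim fun j => (norm_le_norm_of_max_sub (hkM j) (w1 j) z1).trans (decay j)
  have hz1 : z.fn = 0 := norm_le_zero_iff.1 hz0
  filter_upwards [z1, Lp.coeFn_zero ℝ 2 (vol Ω)] with x e1 e2
  rw [hz1, e2, Pi.zero_apply] at e1
  have := le_max_left (v.1.fn x - M) 0
  linarith

/-- A maximum principle: weak solutions of the elliptic equation are bounded. -/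
theorem ae_abs_le_of_form_eq (hΩ : IsOpen Ω) {q : H1 Ω} {b : Fin 2 → H1 Ω} {c : LInf Ω}
    {q₀ q₁ c₁ : ℝ} (hq₀ : 0 < q₀) (hq : q ∈ Conductivities Ω q₀ q₁)
    (hc : ∀ᵐ x ∂(vol Ω), 0 ≤ c x ∧ c x ≤ c₁) {v : H10 Ω} {g : L2 Ω}
    (hv : ∀ φ ∈ H10 Ω, form q b c v φ = inner ℝ g φ.fn) :
    ∀ᵐ x ∂(vol Ω), |v.1.fn x| ≤ ‖g‖ + (stampConst b q₀ + 1) * ‖v.1.fn‖ := by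
  have hs := stampConst_nonneg b hq₀
  rcases (norm_nonneg v.1.fn).eq_or_lt with h | h
  · have h0 : v.1.fn = 0 := norm_eq_zero.1 h.symm
    filter_upwards [Lp.coeFn_zero ℝ 2 (vol Ω)] with x hx
    rw [h0, hx]; simp
  · have hM : 0 < ‖g‖ + (stampConst b q₀ + 1) * ‖v.1.fn‖ := by positivity
    have h1 : ‖g‖ ≤ ‖g‖ + (stampConst b q₀ + 1) * ‖v.1.fn‖ := by
      have := mul_nonneg (add_nonneg hs zero_le_one) h.le; linarith
    have h2 : stampConst b q₀ * ‖v.1.fn‖ ≤ ‖g‖ + (stampConst b q₀ + 1) * ‖v.1.fn‖ := by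
      linarith [norm_nonneg g]
    have u1 := ae_le_of_form_eq hΩ hq₀ hq hc hv hM h1 h2
    have u2 := ae_le_of_form_eq hΩ hq₀ hq hc (v := -v) (g := -g) (fun φ hφ => by
      rw [form_neg hΩ (ae_abs_le hq₀.le hq) b (ae_abs_le_top hc), hv φ hφ, inner_neg_left])
      hM (by rwa [norm_neg]) (by
        rwa [NegMemClass.coe_neg, H1.fn_neg, norm_neg])
    filter_upwards [u1, u2, Lp.coeFn_neg v.1.fn] with x e1 e2 e3
    rw [NegMemClass.coe_neg, H1.fn_neg, e3, Pi.neg_apply] at e2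
    exact abs_le.2 ⟨by linarith, e1⟩

end Stampacchia

/-! ### The weighted gradient estimate for elliptic solutions. -/

section WeightedGradient

theorem le_of_sq_le_quadratic {q₀ κ X y : ℝ} (hq₀ : 0 < q₀) (hκ : 0 ≤ κ) (hy : 0 ≤ y)
    (h : q₀ * X ^ 2 ≤ κ * y * X + κ * y ^ 2) : X ≤ (1 + 2 * κ / q₀) * y := by
  have hd : 0 ≤ 2 * κ / q₀ := by positivity
  rcases le_or_gt X y with hX | hX
  · nlinarith
  · have hX0 : 0 < X := hy.trans_lt hX
    have h1 : q₀ * X ≤ 2 * κ * y := by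
      refine le_of_mul_le_mul_right ?_ hX0
      nlinarith [mul_le_mul_of_nonneg_left hX.le (mul_nonneg hκ hy)]
    have h2 : X ≤ 2 * κ / q₀ * y := by
      rw [div_mul_eq_mul_div, le_div_iff₀ hq₀]; linarith
    linarith

variable {Ω : Set Plane}

theorem H1.norm_le_add (w : H1 Ω) : ‖w‖ ≤ ‖w.fn‖ + ∑ i, ‖w.grad i‖ := by
  refine le_of_sq_le_sq ?_ (by positivity)
  rw [w.norm_sq, w.seminorm_sq, Fin.sum_univ_two, Fin.sum_univ_two]
  nlinarith [mul_nonneg (norm_nonneg w.fn) (norm_nonneg (w.grad 0)),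
    mul_nonneg (norm_nonneg w.fn) (norm_nonneg (w.grad 1)),
    mul_nonneg (norm_nonneg (w.grad 0)) (norm_nonneg (w.grad 1))]

variable [IsFiniteMeasure (vol Ω)]

-- Test with `r = d² v`. Put `p = d v`, `x = d ∇v`, `z = v ∇d`, so that `∇p = x + z`. Diffusion
-- gives `q |x|² + 2 q x·z`, convection becomes `p b·(∇p + z)`, and the source is `g` times `d p`.
-- Convection and source are bounded by the product estimate, linearly in `‖p‖₁`, hence linearly in
-- `X = ‖x‖` up to a multiple of `M ‖d‖`. Since `‖z‖` is controlled by `M ‖d‖`, the diffusion term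
-- dominates. The bound `D` serves only to make `d² v` an admissible test function and is absent
-- from the estimate.
set_option maxHeartbeats 400000 in
theorem sqrt_sum_norm_sq_bmul_grad_le (hΩ : IsOpen Ω) {q : H1 Ω} {b : Fin 2 → H1 Ω} {c : LInf Ω}
    {q₀ q₁ c₁ : ℝ} (hq₀ : 0 < q₀) (hq₁ : 0 ≤ q₁) (hq : q ∈ Conductivities Ω q₀ q₁)
    (hc : ∀ᵐ x ∂(vol Ω), 0 ≤ c x ∧ c x ≤ c₁) {v : H10 Ω} {g : L2 Ω}
    (hv : ∀ φ ∈ H10 Ω, form q b c v φ = inner ℝ g φ.fn) {M : ℝ}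
    (hM : ∀ᵐ x ∂(vol Ω), |v.1.fn x| ≤ M) (hgM : ‖g‖ ≤ M) {d : H1 Ω} {D : ℝ}
    (hD : ∀ᵐ x ∂(vol Ω), |d.fn x| ≤ D) :
    √(∑ i, ‖bmul (aesm d.fn) hD (v.1.grad i)‖ ^ 2) ≤
      (1 + 2 * (4 * q₁ + 18 * (∑ i, ‖b i‖) * sobolevConst + 12 * sobolevConst) / q₀) *
        (M * ‖d‖) := by
  have hM0 : 0 ≤ M := (norm_nonneg g).trans hgM
  obtain ⟨p, hp, p1, p2⟩ := exists_mul_mem_H10 hΩ v.2 hM hD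
  have hpb : ∀ᵐ x ∂(vol Ω), |p.fn x| ≤ |D| * M := by
    filter_upwards [p1, hM, hD] with x e1 e2 e3
    rw [e1, abs_mul]
    exact mul_le_mul (e3.trans (le_abs_self D)) e2 (abs_nonneg _) (abs_nonneg _)
  obtain ⟨r, hr, r1, r2⟩ := exists_mul_mem_H10 hΩ hp hpb hD
  set P : H10 Ω := ⟨p, hp⟩ with hP
  set x : Fin 2 → L2 Ω := fun i => bmul (aesm d.fn) hD (v.1.grad i) with hx
  set z : Fin 2 → L2 Ω := fun i => bmul (aesm v.1.fn) hM (d.grad i) with hz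
  set X := √(∑ i, ‖x i‖ ^ 2) with hX
  have hX0 : 0 ≤ X := Real.sqrt_nonneg _
  have hXsq : X ^ 2 = ∑ i, ‖x i‖ ^ 2 := Real.sq_sqrt (Finset.sum_nonneg fun i _ => sq_nonneg _)
  have hxX : ∀ i, ‖x i‖ ≤ X := fun i => Real.le_sqrt_of_sq_le
    (Finset.single_le_sum (f := fun i => ‖x i‖ ^ 2) (fun i _ => sq_nonneg _) (Finset.mem_univ i))
  have hzM : ∀ i, ‖z i‖ ≤ M * ‖d‖ := fun i => (norm_bmul_le _ _ _).trans
    (mul_le_mul_of_nonneg_left (d.norm_grad_le i) hM0)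
  have hS := sobolevConst_nonneg
  set β := ∑ i, ‖b i‖ with hβ
  have hβ0 : 0 ≤ β := Finset.sum_nonneg fun i _ => norm_nonneg _
  have hy0 : 0 ≤ M * ‖d‖ := mul_nonneg hM0 (norm_nonneg d)
  have ep : ∀ i, p.grad i = x i + z i := fun i => Lp.ext (by
    filter_upwards [p2 i, coeFn_bmul (aesm d.fn) hD (v.1.grad i),
      coeFn_bmul (aesm v.1.fn) hM (d.grad i), Lp.coeFn_add (x i) (z i)] with y e1 e2 e3 e4
    rw [e1, e4, Pi.add_apply, e2, e3])
  have hpn : ‖p.fn‖ ≤ M * ‖d‖ := by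
    refine le_trans ?_ (mul_le_mul_of_nonneg_left d.norm_fn_le hM0)
    refine Lp.norm_le_mul_norm_of_ae_le_mul ?_
    filter_upwards [p1, hM] with y e1 e2
    rw [e1, norm_mul, mul_comm]
    exact mul_le_mul_of_nonneg_right e2 (norm_nonneg _)
  have hpg : ∀ i, ‖p.grad i‖ ≤ X + M * ‖d‖ := fun i => by
    rw [ep]
    exact (norm_add_le _ _).trans (add_le_add (hxX i) (hzM i))
  have hpH : ‖p‖ ≤ 2 * X + 3 * (M * ‖d‖) := by
    refine p.norm_le_add.trans ?_
    rw [Fin.sum_univ_two]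
    linarith [hpg 0, hpg 1]
  have h := hv r hr
  rw [form_eq hΩ (ae_abs_le hq₀.le hq) b (ae_abs_le_top hc)] at h
  have hA : ∀ i, q₀ * ‖x i‖ ^ 2 - 2 * (q₁ * X * (M * ‖d‖)) ≤
      inner ℝ (bmul (aesm q.fn) (ae_abs_le hq₀.le hq) (v.1.grad i)) (r.grad i) := fun i => by
    set y := bmul (aesm q.fn) (ae_abs_le hq₀.le hq) (x i) with hy
    have e : inner ℝ (bmul (aesm q.fn) (ae_abs_le hq₀.le hq) (v.1.grad i)) (r.grad i) =
        inner ℝ y (x i) + 2 * inner ℝ y (z i) := by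
      simp only [inner_eq_integral]
      rw [← integral_const_mul,
        ← integral_add (integrable_mul _ _) ((integrable_mul _ _).const_mul _)]
      refine integral_congr_ae ?_
      filter_upwards [coeFn_bmul (aesm q.fn) (ae_abs_le hq₀.le hq) (v.1.grad i),
        coeFn_bmul (aesm q.fn) (ae_abs_le hq₀.le hq) (x i), r2 i, p2 i, p1,
        coeFn_bmul (aesm d.fn) hD (v.1.grad i), coeFn_bmul (aesm v.1.fn) hM (d.grad i)]
        with s e1 e2 e3 e4 e5 e6 e7
      rw [e1, e2, e3, e4, e5, e6, e7]; ring
    have l1 : q₀ * ‖x i‖ ^ 2 ≤ inner ℝ y (x i) := by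
      rw [← real_inner_self_eq_norm_sq, inner_eq_integral, inner_eq_integral, ← integral_const_mul]
      refine integral_mono_ae ((integrable_mul _ _).const_mul _) (integrable_mul _ _) ?_
      filter_upwards [hq, coeFn_bmul (aesm q.fn) (ae_abs_le hq₀.le hq) (x i)] with s e1 e2
      simp only [hy, e2]
      nlinarith [mul_self_nonneg (x i s)]
    have l2 : |inner ℝ y (z i)| ≤ q₁ * X * (M * ‖d‖) :=
      (abs_real_inner_le_norm _ _).trans (mul_le_mul ((norm_bmul_le _ _ _).trans
        (mul_le_mul_of_nonneg_left (hxX i) hq₁)) (hzM i) (norm_nonneg _) (by positivity))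
    rw [e]
    linarith [neg_le_of_abs_le l2]
  have hB : ∀ i, inner ℝ (mulL hΩ (b i) v) (r.grad i) =
      inner ℝ (mulL hΩ (b i) P) (P.1.grad i) + inner ℝ (mulL hΩ (b i) P) (z i) := fun i => by
    simp only [inner_eq_integral]
    rw [← integral_add (integrable_mul _ _) (integrable_mul _ _)]
    refine integral_congr_ae ?_
    filter_upwards [coeFn_mulL hΩ (b i) v, coeFn_mulL hΩ (b i) P, r2 i, p1,
      coeFn_bmul (aesm v.1.fn) hM (d.grad i)] with s e1 e2 e3 e4 e5
    rw [e1, e2, e3, e5]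
    simp only [hP, e4]; ring
  have hB1 : ∑ i, inner ℝ (mulL hΩ (b i) P) (P.1.grad i) ≤
      2 * divNorm b * sobolevConst * ‖p.fn‖ * p.seminorm := (le_abs_self _).trans (abs_sum_inner_mulL_grad_le hΩ b P)
  have hdiv : divNorm b ≤ β := Finset.sum_le_sum fun i _ => (b i).norm_grad_le i
  have hB1' : 2 * divNorm b * sobolevConst * ‖p.fn‖ * p.seminorm ≤
      2 * β * sobolevConst * (M * ‖d‖) * ‖p‖ :=
    mul_le_mul (mul_le_mul (mul_le_mul_of_nonneg_right (by linarith) hS) hpn (norm_nonneg _)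
      (by positivity)) p.seminorm_le p.seminorm_nonneg (by positivity)
  have hB2 : ∑ i, inner ℝ (mulL hΩ (b i) P) (z i) ≤ 4 * β * sobolevConst * (M * ‖d‖) * ‖p‖ := by
    have : ∀ i ∈ Finset.univ, inner ℝ (mulL hΩ (b i) P) (z i) ≤
        ‖b i‖ * (4 * sobolevConst * (M * ‖d‖) * ‖p‖) := fun i _ => by
      refine (real_inner_le_norm _ _).trans ((mul_le_mul (norm_mulL_le' hΩ (b i) P) (hzM i)
        (norm_nonneg _) (by positivity)).trans (le_of_eq ?_))
      simp only [hP]; ring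
    refine (Finset.sum_le_sum this).trans (le_of_eq ?_)
    rw [← Finset.sum_mul]; ring
  have hC : 0 ≤ inner ℝ (bmul (aesm_top c) (ae_abs_le_top hc) v.1.fn) r.fn := by
    rw [inner_eq_integral]
    refine integral_nonneg_of_ae ?_
    filter_upwards [coeFn_bmul (aesm_top c) (ae_abs_le_top hc) v.1.fn, r1, p1, hc] with s e1 e2 e3 e4
    rw [e1, e2, e3, Pi.zero_apply]
    have := mul_nonneg e4.1 (mul_self_nonneg (d.fn s * v.1.fn s))
    linarith
  have hG : inner ℝ g r.fn ≤ 4 * sobolevConst * (M * ‖d‖) * ‖p‖ := by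
    -- Viewing `d² v` as `d` times `p ∈ H¹₀` bounds it in `L²` by `‖d‖₁ ‖p‖₁` and avoids the bound
    -- `D`.
    have er : r.fn = mulL hΩ d P := Lp.ext (by
      filter_upwards [r1, coeFn_mulL hΩ d P] with s e1 e2
      rw [e1, e2, mul_comm])
    refine (real_inner_le_norm _ _).trans ?_
    rw [er]
    refine (mul_le_mul hgM (norm_mulL_le' hΩ d P) (norm_nonneg _) hM0).trans (le_of_eq ?_)
    simp only [hP]; ring
  have hAs : q₀ * X ^ 2 - 4 * (q₁ * X * (M * ‖d‖)) ≤
      ∑ i, inner ℝ (bmul (aesm q.fn) (ae_abs_le hq₀.le hq) (v.1.grad i)) (r.grad i) := by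
    refine le_trans (le_of_eq ?_) (Finset.sum_le_sum fun i _ => hA i)
    rw [Finset.sum_sub_distrib, ← Finset.mul_sum, ← hXsq]
    simp; ring
  simp only [hB, Finset.sum_add_distrib] at h
  refine le_of_sq_le_quadratic hq₀ (by positivity) hy0 ?_
  have hfin : (6 * β * sobolevConst + 4 * sobolevConst) * (M * ‖d‖) * ‖p‖ ≤
      (6 * β * sobolevConst + 4 * sobolevConst) * (M * ‖d‖) * (2 * X + 3 * (M * ‖d‖)) :=
    mul_le_mul_of_nonneg_left hpH (by positivity)
  have n1 : 0 ≤ β * sobolevConst * (M * ‖d‖) * X := by positivity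
  have n2 : 0 ≤ sobolevConst * (M * ‖d‖) * X := by positivity
  have n3 : 0 ≤ q₁ * (M * ‖d‖) ^ 2 := by positivity
  nlinarith

/-- For a solution `v` of the elliptic equation, `d∇v` is controlled by the `H¹` norm of `d`. -/
theorem exists_bmul_grad_bound (hΩ : IsOpen Ω) (b : Fin 2 → H1 Ω) {c : LInf Ω}
    {q₀ q₁ c₁ : ℝ} (hq₀ : 0 < q₀) (hq₁ : 0 ≤ q₁) (hc : ∀ᵐ x ∂(vol Ω), 0 ≤ c x ∧ c x ≤ c₁) :
    ∃ K, 0 ≤ K ∧ ∀ q ∈ Conductivities Ω q₀ q₁, ∀ (v : H10 Ω) (g : L2 Ω),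
      (∀ φ ∈ H10 Ω, form q b c v φ = inner ℝ g φ.fn) →
      ∀ (d : H1 Ω) (D : ℝ) (hD : ∀ᵐ x ∂(vol Ω), |d.fn x| ≤ D) (φ : H1 Ω),
        |∑ i, inner ℝ (bmul (aesm d.fn) hD (v.1.grad i)) (φ.grad i)| ≤
          K * ‖d‖ * (‖g‖ + ‖v.1.fn‖) * ‖φ‖ := by
  have hs := stampConst_nonneg b hq₀
  have hS := sobolevConst_nonneg
  have hβ0 : 0 ≤ ∑ i, ‖b i‖ := Finset.sum_nonneg fun i _ => norm_nonneg _
  set L := 1 + 2 * (4 * q₁ + 18 * (∑ i, ‖b i‖) * sobolevConst + 12 * sobolevConst) / q₀ with hL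
  have hL0 : 0 ≤ L := by positivity
  refine ⟨2 * L * (stampConst b q₀ + 1), by positivity, fun q hq v g hv d D hD φ => ?_⟩
  have hM := ae_abs_le_of_form_eq hΩ hq₀ hq hc hv
  have hX := sqrt_sum_norm_sq_bmul_grad_le hΩ hq₀ hq₁ hq hc hv hM
    (le_add_of_nonneg_right (by positivity)) hD
  rw [← hL] at hX
  have hM' : ‖g‖ + (stampConst b q₀ + 1) * ‖v.1.fn‖ ≤
      (stampConst b q₀ + 1) * (‖g‖ + ‖v.1.fn‖) := by
    nlinarith [mul_nonneg hs (norm_nonneg g)]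
  have h : ∀ i ∈ Finset.univ, |inner ℝ (bmul (aesm d.fn) hD (v.1.grad i)) (φ.grad i)| ≤
      L * ((stampConst b q₀ + 1) * (‖g‖ + ‖v.1.fn‖) * ‖d‖) * ‖φ‖ := fun i _ => by
    refine (abs_real_inner_le_norm _ _).trans
      (mul_le_mul ?_ (φ.norm_grad_le i) (norm_nonneg _) (by positivity))
    have h1 : ‖bmul (aesm d.fn) hD (v.1.grad i)‖ ≤
        √(∑ i, ‖bmul (aesm d.fn) hD (v.1.grad i)‖ ^ 2) := Real.le_sqrt_of_sq_le
      (Finset.single_le_sum (f := fun i => ‖bmul (aesm d.fn) hD (v.1.grad i)‖ ^ 2)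
        (fun i _ => sq_nonneg _) (Finset.mem_univ i))
    refine h1.trans (hX.trans ?_)
    gcongr
  refine (Finset.abs_sum_le_sum_abs _ _).trans ((Finset.sum_le_sum h).trans (le_of_eq ?_))
  simp; ring

end WeightedGradient

/-! ### The Hilbert space `H¹₀` and the passage to the abstract equation. -/

section Forms

variable {Ω : Set Plane}

instance : InnerProductSpace ℝ (H1 Ω) := Submodule.innerProductSpace _

instance : CompleteSpace (H10 Ω) := H10_isClosed.completeSpace_coe

/-- `H¹₀(Ω)` as a Hilbert space. -/
def H10Space (Ω : Set Plane) : Type := H10 Ω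

namespace H10Space

instance : NormedAddCommGroup (H10Space Ω) := Submodule.normedAddCommGroup (H10 Ω)

instance : InnerProductSpace ℝ (H10Space Ω) := Submodule.innerProductSpace (H10 Ω)

instance : CompleteSpace (H10Space Ω) := (inferInstance : CompleteSpace (H10 Ω))

/-- An element of the Hilbert space `H¹₀(Ω)` as a member of the subspace. -/
def val (v : H10Space Ω) : H10 Ω := v

theorem norm_eq (v : H10Space Ω) : ‖v‖ = ‖v.val.1‖ := rfl

end H10Space

/-- The embedding `H¹₀(Ω) → H¹(Ω)`. -/
def iL (Ω : Set Plane) : H10Space Ω →L[ℝ] H1 Ω :=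
  LinearMap.mkContinuous { toFun := fun v => v.val.1, map_add' := fun _ _ => rfl,
                           map_smul' := fun _ _ => rfl } 1 fun v => (one_mul ‖v‖).symm ▸ v.norm_eq.ge

/-- The embedding `H¹₀(Ω) → L²(Ω)`. -/
def jL (Ω : Set Plane) : H10Space Ω →L[ℝ] L2 Ω := (fnL Ω).comp (iL Ω)

/-- The weak partial derivative on `H¹₀(Ω)`. -/
def dL (Ω : Set Plane) (i : Fin 2) : H10Space Ω →L[ℝ] L2 Ω := (gradL Ω i).comp (iL Ω)

@[simp] theorem jL_apply (v : H10Space Ω) : jL Ω v = v.val.1.fn := rfl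
@[simp] theorem dL_apply (i : Fin 2) (v : H10Space Ω) : dL Ω i v = v.val.1.grad i := rfl

/-- The orthogonal projection of `H¹(Ω)` onto `H¹₀(Ω)`. -/
def projL (Ω : Set Plane) : H1 Ω →L[ℝ] H10Space Ω :=
  LinearMap.mkContinuous
    { toFun := fun w => (H10 Ω).orthogonalProjectionOnto w
      map_add' := fun w w' => (H10 Ω).orthogonalProjectionOnto.map_add w w'
      map_smul' := fun c w => (H10 Ω).orthogonalProjectionOnto.map_smul c w }
    1 fun w => by
      rw [one_mul]
      exact (H10 Ω).norm_orthogonalProjectionOnto_apply_le w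

theorem val_projL {w : H1 Ω} (hw : w ∈ H10 Ω) : (projL Ω w).val.1 = w :=
  congrArg Subtype.val (Submodule.orthogonalProjectionOnto_mem_subspace_eq_self (⟨w, hw⟩ : H10 Ω))

variable [IsFiniteMeasure (vol Ω)]

/-- Multiplication by an `H¹` function, on the Hilbert space `H¹₀(Ω)`. -/
def mulL' (hΩ : IsOpen Ω) (b : H1 Ω) : H10Space Ω →L[ℝ] L2 Ω :=
  LinearMap.mkContinuous
    { toFun := fun v => mulL hΩ b v.val
      map_add' := fun v w => (mulL hΩ b).map_add v.val w.val
      map_smul' := fun c v => (mulL hΩ b).map_smul c v.val }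
    (4 * sobolevConst * ‖b‖) fun v => norm_mulL_le' hΩ b v.val

@[simp] theorem mulL'_apply (hΩ : IsOpen Ω) (b : H1 Ω) (v : H10Space Ω) :
    mulL' hΩ b v = mulL hΩ b v.val := rfl

/-- The elliptic form plus a bounded zeroth-order operator, as a bounded bilinear form. -/
def formL (hΩ : IsOpen Ω) {q : H1 Ω} {Q : ℝ} (hq : ∀ᵐ x ∂(vol Ω), |q.fn x| ≤ Q)
    (b : Fin 2 → H1 Ω) {c : LInf Ω} {c₁ : ℝ} (hc : ∀ᵐ x ∂(vol Ω), |c x| ≤ c₁)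
    (R : L2 Ω →L[ℝ] L2 Ω) : H10Space Ω →L[ℝ] H10Space Ω →L[ℝ] ℝ :=
  (∑ i, (innerSL ℝ).bilinearComp ((bmul (aesm q.fn) hq).comp (dL Ω i)) (dL Ω i))
    - (∑ i, (innerSL ℝ).bilinearComp (mulL' hΩ (b i)) (dL Ω i))
    + (innerSL ℝ).bilinearComp ((bmul (aesm_top c) hc).comp (jL Ω)) (jL Ω)
    + (innerSL ℝ).bilinearComp (R.comp (jL Ω)) (jL Ω)

section

variable (hΩ : IsOpen Ω) {q : H1 Ω} {Q : ℝ} (hq : ∀ᵐ x ∂(vol Ω), |q.fn x| ≤ Q)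
    (b : Fin 2 → H1 Ω) {c : LInf Ω} {c₁ : ℝ} (hc : ∀ᵐ x ∂(vol Ω), |c x| ≤ c₁)
    (R : L2 Ω →L[ℝ] L2 Ω)

theorem formL_apply (v φ : H10Space Ω) : formL hΩ hq b hc R v φ =
    form q b c v.val.1 φ.val.1 + inner ℝ (R v.val.1.fn) φ.val.1.fn := by
  rw [form_eq hΩ hq b hc]
  simp only [formL, add_apply, sub_apply,
    sum_apply, ContinuousLinearMap.bilinearComp_apply, innerSL_apply_apply,
    ContinuousLinearMap.comp_apply, dL_apply, jL_apply, mulL'_apply]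

theorem abs_formL_le (hQ : 0 ≤ Q) (v φ : H10Space Ω) : |formL hΩ hq b hc R v φ| ≤
    (2 * Q + 4 * sobolevConst * (∑ i, ‖b i‖) + |c₁| + ‖R‖) * ‖v‖ * ‖φ‖ := by
  have hS := sobolevConst_nonneg
  have hv : ‖v.val.1‖ = ‖v‖ := rfl
  have hφ : ‖φ.val.1‖ = ‖φ‖ := rfl
  rw [formL_apply, form_eq hΩ hq b hc]
  have h1 : |∑ i, inner ℝ (bmul (aesm q.fn) hq (v.val.1.grad i)) (φ.val.1.grad i)| ≤ 2 * Q * ‖v‖ * ‖φ‖ := by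
    have : ∀ i ∈ Finset.univ, |inner ℝ (bmul (aesm q.fn) hq (v.val.1.grad i)) (φ.val.1.grad i)| ≤
        Q * ‖v‖ * ‖φ‖ := fun i _ =>
      (abs_real_inner_le_norm _ _).trans (mul_le_mul ((norm_bmul_le _ _ _).trans
        (mul_le_mul_of_nonneg_left (v.val.1.norm_grad_le i) hQ)) (φ.val.1.norm_grad_le i)
        (norm_nonneg _) (by positivity))
    refine (Finset.abs_sum_le_sum_abs _ _).trans ((Finset.sum_le_sum this).trans (le_of_eq ?_))
    simp; ring
  have h2 : |∑ i, inner ℝ (mulL hΩ (b i) v.val) (φ.val.1.grad i)| ≤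
      4 * sobolevConst * (∑ i, ‖b i‖) * ‖v‖ * ‖φ‖ := by
    have : ∀ i ∈ Finset.univ, |inner ℝ (mulL hΩ (b i) v.val) (φ.val.1.grad i)| ≤
        ‖b i‖ * (4 * sobolevConst * ‖v‖ * ‖φ‖) := fun i _ =>
      (abs_real_inner_le_norm _ _).trans ((mul_le_mul (norm_mulL_le' hΩ (b i) v.val)
        (φ.val.1.norm_grad_le i) (norm_nonneg _) (by positivity)).trans
          (le_of_eq (by rw [hv, hφ]; ring)))
    refine (Finset.abs_sum_le_sum_abs _ _).trans ((Finset.sum_le_sum this).trans (le_of_eq ?_))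
    rw [← Finset.sum_mul]; ring
  have h3 : |inner ℝ (bmul (aesm_top c) hc v.val.1.fn) φ.val.1.fn| ≤ |c₁| * ‖v‖ * ‖φ‖ :=
    (abs_real_inner_le_norm _ _).trans (mul_le_mul ((norm_bmul_le _ _ _).trans
      (mul_le_mul (le_abs_self c₁) v.val.1.norm_fn_le (norm_nonneg _) (abs_nonneg _))) φ.val.1.norm_fn_le
      (norm_nonneg _) (mul_nonneg (abs_nonneg _) (norm_nonneg _)))
  have h4 : |inner ℝ (R v.val.1.fn) φ.val.1.fn| ≤ ‖R‖ * ‖v‖ * ‖φ‖ :=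
    (abs_real_inner_le_norm _ _).trans (mul_le_mul ((R.le_opNorm _).trans
      (mul_le_mul_of_nonneg_left v.val.1.norm_fn_le (norm_nonneg _))) φ.val.1.norm_fn_le
      (norm_nonneg _) (mul_nonneg (norm_nonneg _) (norm_nonneg _)))
  refine (abs_add_le _ _).trans ?_
  refine (add_le_add_left ((abs_add_le _ _).trans (add_le_add_left (abs_sub _ _) _)) _).trans ?_
  linarith

/-- Gårding's inequality: half of the diffusion absorbs the convection term by Young, and the terms
with `c` and `R` are nonnegative and dropped. The constants involve the conductivity only through
its lower bound `q₀`. -/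
theorem coercive_formL {q₀ : ℝ} (hq₀ : 0 < q₀) (hq' : ∀ᵐ x ∂(vol Ω), q₀ ≤ q.fn x)
    (hc0 : ∀ᵐ x ∂(vol Ω), 0 ≤ c x) (hR : ∀ g, 0 ≤ inner ℝ (R g) g) (v : H10Space Ω) :
    q₀ / 2 * ‖v‖ ^ 2 ≤ formL hΩ hq b hc R v v +
      (q₀ / 2 + 2 * (divNorm b * sobolevConst) ^ 2 / q₀) * ‖jL Ω v‖ ^ 2 := by
  rw [formL_apply, form_eq hΩ hq b hc, jL_apply]
  have e : ‖v‖ ^ 2 = ‖v.val.1.fn‖ ^ 2 + v.val.1.seminorm ^ 2 := v.val.1.norm_sq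
  have h1 : q₀ * v.val.1.seminorm ^ 2 ≤
      ∑ i, inner ℝ (bmul (aesm q.fn) hq (v.val.1.grad i)) (v.val.1.grad i) := by
    rw [H1.seminorm_sq, Finset.mul_sum]
    refine Finset.sum_le_sum fun i _ => ?_
    rw [← real_inner_self_eq_norm_sq, inner_eq_integral, inner_eq_integral, ← integral_const_mul]
    refine integral_mono_ae ((integrable_mul _ _).const_mul _) (integrable_mul _ _) ?_
    filter_upwards [hq', coeFn_bmul (aesm q.fn) hq (v.val.1.grad i)] with x e1 e2
    simp only [e2]
    nlinarith [mul_self_nonneg (v.val.1.grad i x)]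
  have h2 := (le_abs_self _).trans (abs_sum_inner_mulL_grad_le hΩ b v.val)
  have h3 : 0 ≤ inner ℝ (bmul (aesm_top c) hc v.val.1.fn) v.val.1.fn := by
    rw [inner_eq_integral]
    refine integral_nonneg_of_ae ?_
    filter_upwards [coeFn_bmul (aesm_top c) hc v.val.1.fn, hc0] with x e1 e2
    rw [e1, Pi.zero_apply, mul_assoc]
    exact mul_nonneg e2 (mul_self_nonneg _)
  have h4 := hR v.val.1.fn
  have h5 : 2 * (divNorm b * sobolevConst) * ‖v.val.1.fn‖ * v.val.1.seminorm ≤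
      q₀ / 2 * v.val.1.seminorm ^ 2 + 2 * (divNorm b * sobolevConst) ^ 2 / q₀ * ‖v.val.1.fn‖ ^ 2 := by
    have : 0 ≤ (q₀ * v.val.1.seminorm - 2 * (divNorm b * sobolevConst) * ‖v.val.1.fn‖) ^ 2 / (2 * q₀) := by
      positivity
    have e' : (q₀ * v.val.1.seminorm - 2 * (divNorm b * sobolevConst) * ‖v.val.1.fn‖) ^ 2 / (2 * q₀) =
        q₀ / 2 * v.val.1.seminorm ^ 2 + 2 * (divNorm b * sobolevConst) ^ 2 / q₀ * ‖v.val.1.fn‖ ^ 2 -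
          2 * (divNorm b * sobolevConst) * ‖v.val.1.fn‖ * v.val.1.seminorm := by
      field_simp; ring
    linarith
  rw [e]
  linarith

theorem form_sub_form {q' : H1 Ω} {Q' D : ℝ} (hq' : ∀ᵐ x ∂(vol Ω), |q'.fn x| ≤ Q')
    (hD : ∀ᵐ x ∂(vol Ω), |(q' - q).fn x| ≤ D) (v φ : H10Space Ω) :
    formL hΩ hq' b hc R v φ - formL hΩ hq b hc R v φ =
      ∑ i, inner ℝ (bmul (aesm (q' - q).fn) hD (v.val.1.grad i)) (φ.val.1.grad i) := by
  rw [formL_apply, formL_apply, form_eq hΩ hq b hc, form_eq hΩ hq' b hc]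
  have : ∀ i, bmul (aesm (q' - q).fn) hD (v.val.1.grad i) =
      bmul (aesm q'.fn) hq' (v.val.1.grad i) - bmul (aesm q.fn) hq (v.val.1.grad i) := fun i => Lp.ext (by
    filter_upwards [coeFn_bmul (aesm (q' - q).fn) hD (v.val.1.grad i),
      coeFn_bmul (aesm q'.fn) hq' (v.val.1.grad i), coeFn_bmul (aesm q.fn) hq (v.val.1.grad i),
      Lp.coeFn_sub (bmul (aesm q'.fn) hq' (v.val.1.grad i)) (bmul (aesm q.fn) hq (v.val.1.grad i)),
      Lp.coeFn_sub q'.fn q.fn] with x e1 e2 e3 e4 e5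
    rw [e1, e4, Pi.sub_apply, e2, e3, H1.fn_sub, e5, Pi.sub_apply]; ring)
  simp only [this, inner_sub_left, Finset.sum_sub_distrib]
  ring

end

/-! ### From weak solutions to the abstract evolution equation -/

/-- The part `R y` of the source is transferred to the form. Membership in `H¹₀` is known only at
almost every time; since the projection onto the closed subspace fixes `y` there, continuity extends
this to every time in `[0,T]`. -/
theorem IsSolution.exists_isEvol (hΩ : IsOpen Ω) {T : ℝ} (hT : 0 < T) {q : H1 Ω} {Q : ℝ}
    (hq : ∀ᵐ x ∂(vol Ω), |q.fn x| ≤ Q) {b : Fin 2 → H1 Ω} {c : LInf Ω} {c₁ : ℝ}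
    (hc : ∀ᵐ x ∂(vol Ω), |c x| ≤ c₁) {F : ℝ → L2 Ω} {y₀ : L2 Ω} {y : ℝ → H1 Ω}
    (hy : IsSolution T q b c F y₀ y) {R : L2 Ω →L[ℝ] L2 Ω} {G : ℝ → L2 Ω}
    (hG : ∀ s ∈ Icc 0 T, F s = G s - R (y s).fn) :
    ∃ z z' : ℝ → H10Space Ω, IsEvol (jL Ω) (formL hΩ hq b hc R) (fun s => srcFn (jL Ω) (G s)) T z z' ∧
      ∀ s ∈ Icc 0 T, (z s).val.1 = y s := by
  obtain ⟨y', m, hm, hint, heq⟩ := hy.equation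
  rw [restrict_Ioo_eq_restrict_Ioc] at m hm heq
  -- A trivial evolution equation with zero form and source, introduced to reuse the integrability
  -- and continuity facts for `y` as an `H¹`-valued function.
  have hev : IsEvol (0 : H1 Ω →L[ℝ] ℝ) 0 (fun _ => 0) T y y' :=
    ⟨m, hint, Eventually.of_forall fun s _ φ => by simp⟩
  have hmem : ∀ s ∈ Icc 0 T, (projL Ω (y s)).val.1 = y s := by
    have hae : (fun s => iL Ω (projL Ω (y s))) =ᵐ[volume.restrict (Icc 0 T)] y := by
      rw [← restrict_Ioo_eq_restrict_Icc]
      filter_upwards [hy.mem_H10] with s hs using val_projL hs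
    exact Measure.eqOn_Icc_of_ae_eq volume hT.ne hae
      (((iL Ω).continuous.comp (projL Ω).continuous).comp_continuousOn hev.continuousOn)
      hev.continuousOn
  refine ⟨fun s => projL Ω (y s), fun s => projL Ω (y' s),
    ⟨(projL Ω).comp_memLp' m, fun s hs => ?_, ?_⟩, hmem⟩
  · rw [(projL Ω).intervalIntegral_comp_comm (hev.intervalIntegrable ⟨le_rfl, hT.le⟩ hs),
      ← map_add, ← hint s hs]
  · rw [ae_restrict_iff' measurableSet_Ioc] at hm heq
    filter_upwards [hm, heq] with s h1 h2 hs φ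
    have hs' : s ∈ Icc 0 T := ⟨hs.1.le, hs.2⟩
    have h3 := h2 hs φ.val.1 φ.val.2
    rw [hG s hs', inner_sub_left] at h3
    rw [formL_apply, jL_apply, jL_apply, val_projL (h1 hs), hmem s hs', srcFn_apply, jL_apply]
    linarith

end Forms

/-! ### Continuous dependence on the conductivity and the conclusion. -/

section ContinuousDependence

theorem isOpen_of_isConvexPolygonalDomain {Ω : Set Plane} (hΩ : IsConvexPolygonalDomain Ω) :
    IsOpen Ω := by
  obtain ⟨-, S, rfl⟩ := hΩ
  exact isOpen_interior

theorem isFiniteMeasure_of_isConvexPolygonalDomain {Ω : Set Plane}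
    (hΩ : IsConvexPolygonalDomain Ω) : IsFiniteMeasure (vol Ω) := by
  obtain ⟨-, S, rfl⟩ := hΩ
  refine ⟨?_⟩
  rw [Measure.restrict_apply_univ]
  exact ((isBounded_convexHull.2 S.finite_toSet.isBounded).subset interior_subset).measure_lt_top

theorem ae_le_of_mem_conductivities {Ω : Set Plane} {q : H1 Ω} {q₀ q₁ : ℝ}
    (hq : q ∈ Conductivities Ω q₀ q₁) : ∀ᵐ x ∂(vol Ω), q₀ ≤ q.fn x := by
  filter_upwards [hq] with x hx using hx.1

theorem le_of_mem_conductivities {Ω : Set Plane} (hΩ : IsConvexPolygonalDomain Ω) {q : H1 Ω}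
    {q₀ q₁ : ℝ} (hq : q ∈ Conductivities Ω q₀ q₁) : q₀ ≤ q₁ := by
  have hpos : vol Ω ≠ 0 := by
    rw [Ne, Measure.restrict_eq_zero]
    exact ((isOpen_of_isConvexPolygonalDomain hΩ).measure_pos volume hΩ.1).ne'
  have : NeBot (ae (vol Ω)) := ae_neBot.2 hpos
  have hq' : ∀ᵐ x ∂(vol Ω), q₀ ≤ q.fn x ∧ q.fn x ≤ q₁ := hq
  obtain ⟨x, hx⟩ := hq'.exists
  exact hx.1.trans hx.2

theorem dq_const_add_comp {V H : Type*} [NormedAddCommGroup V] [NormedSpace ℝ V]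
    [NormedAddCommGroup H] [NormedSpace ℝ H] (f : H) (L : V →L[ℝ] H) (u : ℝ → V) (h s : ℝ) :
    dq h (fun s => f + L (u s)) s = L (dq h u s) := by
  simp [dq]

theorem dq_comp {V H : Type*} [NormedAddCommGroup V] [NormedSpace ℝ V]
    [NormedAddCommGroup H] [NormedSpace ℝ H] (L : V →L[ℝ] H) (u : ℝ → V) (h s : ℝ) :
    dq h (fun s => L (u s)) s = L (dq h u s) := by
  simp [dq]

variable {Ω : Set Plane} [IsFiniteMeasure (vol Ω)]

/-- The two halves meet here: the weighted gradient estimate supplies the perturbation hypothesis of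
the abstract theorem, and the equation of `u` supplies the time regularity of the forcing `ft + R
u`. The constant is fixed before the two conductivities are chosen. -/
theorem IsSolution.exists_lipschitz_bound (hΩ : IsOpen Ω) {q₀ q₁ c₁ T t : ℝ} (hq₀ : 0 < q₀)
    (hq₁ : 0 ≤ q₁) (ht : t ∈ Ioc 0 T) {q : H1 Ω} (hq : q ∈ Conductivities Ω q₀ q₁)
    {b : Fin 2 → H1 Ω} {c : LInf Ω} (hc : ∀ᵐ x ∂(vol Ω), 0 ≤ c x ∧ c x ≤ c₁) {f u₀ : L2 Ω}
    {u : ℝ → H1 Ω} (hu : IsSolution T q b c (fun _ => f) u₀ u) (bt : Fin 2 → H1 Ω) {ct : LInf Ω}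
    (hct : ∀ᵐ x ∂(vol Ω), 0 ≤ ct x ∧ ct x ≤ c₁) (ft : L2 Ω) {R : L2 Ω →L[ℝ] L2 Ω}
    (hR : ∀ g, 0 ≤ inner ℝ (R g) g) :
    ∃ C, 0 ≤ C ∧ ∀ qt₁ ∈ Conductivities Ω q₀ q₁, ∀ qt₂ ∈ Conductivities Ω q₀ q₁,
      ∀ v₁ v₂ : ℝ → H1 Ω,
      IsSolution T qt₁ bt ct (fun s => ft + R ((u s).fn - (v₁ s).fn)) 0 v₁ →
      IsSolution T qt₂ bt ct (fun s => ft + R ((u s).fn - (v₂ s).fn)) 0 v₂ →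
      ‖v₁ t - v₂ t‖ ^ 2 ≤ C * ‖qt₁ - qt₂‖ ^ 2 := by
  have hT : 0 < T := ht.1.trans_le ht.2
  have hQ : ∀ {p : H1 Ω}, p ∈ Conductivities Ω q₀ q₁ → ∀ᵐ x ∂(vol Ω), |p.fn x| ≤ q₁ :=
    fun hp => ae_abs_le hq₀.le hp
  -- The equation of `u` contains no feedback, so `R = 0`, and its source is constant in time as the
  -- second-quotient bound requires.
  obtain ⟨z, z', hz, hzu⟩ := hu.exists_isEvol hΩ hT (hQ hq) (ae_abs_le_top hc) (R := 0)
    (G := fun _ => f) fun s _ => by simp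
  obtain ⟨C₂, hC₂0, hC₂⟩ := hz.exists_second_dq_bound (half_pos hq₀)
    (by positivity : 0 ≤ q₀ / 2 + 2 * (divNorm b * sobolevConst) ^ 2 / q₀)
    (coercive_formL hΩ (hQ hq) b (ae_abs_le_top hc) 0 hq₀ (ae_le_of_mem_conductivities hq)
      (hc.mono fun x hx => hx.1) fun g => by simp)
    (abs_formL_le hΩ (hQ hq) b (ae_abs_le_top hc) 0 hq₁)
  set L : H10Space Ω →L[ℝ] L2 Ω := R.comp (jL Ω) with hL
  set F : ℝ → L2 Ω := fun s => ft + L (z s) with hFdef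
  have hF : ContinuousOn F (Icc 0 T) :=
    continuousOn_const.add (L.continuous.comp_continuousOn hz.continuousOn)
  obtain ⟨B, hB⟩ := isCompact_Icc.exists_bound_of_continuousOn hF
  have hD₁ : ∀ h, 0 < h → h ≤ T → ∫ s in (0:ℝ)..(T - h), ‖dq h F s‖ ^ 2 ≤
      ‖L‖ ^ 2 * ∫ r in (0:ℝ)..T, ‖z' r‖ ^ 2 := fun h hh hhT => by
    refine le_trans ?_ (mul_le_mul_of_nonneg_left (hz.integral_norm_dq_sq_le hh hhT) (sq_nonneg _))
    rw [← intervalIntegral.integral_const_mul]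
    have hcd : ContinuousOn (dq h z) (Icc 0 (T - h)) := by
      refine ContinuousOn.const_smul (g := fun s => z (s + h) - z s) (ContinuousOn.sub ?_ ?_) h⁻¹
      · exact hz.continuousOn.comp (by fun_prop) fun s hs => ⟨by linarith [hs.1], by linarith [hs.2]⟩
      · exact hz.continuousOn.mono (Icc_subset_Icc_right (by linarith))
    have hTh : (0:ℝ) ≤ T - h := by linarith
    simp only [hFdef, dq_const_add_comp]
    refine intervalIntegral.integral_mono_on hTh ?_ ?_ fun s _ => ?_
    · exact ContinuousOn.intervalIntegrable_of_Icc hTh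
        ((L.continuous.comp_continuousOn hcd).norm.pow 2)
    · exact ContinuousOn.intervalIntegrable_of_Icc hTh (continuousOn_const.mul (hcd.norm.pow 2))
    · rw [← mul_pow]
      exact pow_le_pow_left₀ (norm_nonneg _) (L.le_opNorm _) 2
  have hD₂ : ∀ h k s, 0 < h → 0 < k → 0 ≤ s → s + h + k ≤ T →
      s * ‖dq k (dq h F) s‖ ≤ ‖R‖ * C₂ := fun h k s hh hk hs hT' => by
    have e : dq h F = fun s => L (dq h z s) := funext fun s => dq_const_add_comp ft L z h s
    rw [e, dq_comp]
    calc s * ‖L (dq k (dq h z) s)‖ ≤ s * (‖R‖ * ‖jL Ω (dq k (dq h z) s)‖) :=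
          mul_le_mul_of_nonneg_left (R.le_opNorm _) hs
      _ = ‖R‖ * (s * ‖jL Ω (dq k (dq h z) s)‖) := by ring
      _ ≤ ‖R‖ * C₂ := mul_le_mul_of_nonneg_left (hC₂ h k s hh hk hs hT') (norm_nonneg _)
  obtain ⟨C, hC0, hC⟩ := CDA.exists_lipschitz_bound (jL Ω) ht hF hB hD₁ hD₂
    (A := 2 * q₁ + 4 * sobolevConst * (∑ i, ‖bt i‖) + |c₁| + ‖R‖) (half_pos hq₀)
    (by positivity : 0 ≤ q₀ / 2 + 2 * (divNorm bt * sobolevConst) ^ 2 / q₀)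
  obtain ⟨K, hK0, hK⟩ := exists_bmul_grad_bound hΩ bt hq₀ hq₁ hct
  refine ⟨C * (K * (1 + ‖R‖)) ^ 2, by positivity, fun p₁ hp₁ p₂ hp₂ v₁ v₂ hv₁ hv₂ => ?_⟩
  have hsrc : ∀ v : ℝ → H1 Ω, ∀ s ∈ Icc 0 T,
      ft + R ((u s).fn - (v s).fn) = F s - R (v s).fn := fun v s hs => by
    simp only [hFdef, hL, ContinuousLinearMap.comp_apply, jL_apply, hzu s hs, map_sub]
    abel
  obtain ⟨y₁, y₁', hy₁, e₁⟩ := hv₁.exists_isEvol hΩ hT (hQ hp₁) (ae_abs_le_top hct) (hsrc v₁)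
  obtain ⟨y₂, y₂', hy₂, e₂⟩ := hv₂.exists_isEvol hΩ hT (hQ hp₂) (ae_abs_le_top hct) (hsrc v₂)
  have coer : ∀ {p : H1 Ω} (hp : p ∈ Conductivities Ω q₀ q₁), ∀ v, q₀ / 2 * ‖v‖ ^ 2 ≤
      formL hΩ (hQ hp) bt (ae_abs_le_top hct) R v v +
      (q₀ / 2 + 2 * (divNorm bt * sobolevConst) ^ 2 / q₀) * ‖jL Ω v‖ ^ 2 := fun hp =>
    coercive_formL hΩ (hQ hp) bt (ae_abs_le_top hct) R hq₀ (ae_le_of_mem_conductivities hp)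
      (hct.mono fun x hx => hx.1) hR
  have h0 : (0:ℝ) ∈ Icc 0 T := ⟨le_rfl, hT.le⟩
  have hpert : ∀ v g, (∀ φ, formL hΩ (hQ hp₂) bt (ae_abs_le_top hct) R v φ =
      inner ℝ g (jL Ω φ)) → ∀ φ, |formL hΩ (hQ hp₂) bt (ae_abs_le_top hct) R v φ -
        formL hΩ (hQ hp₁) bt (ae_abs_le_top hct) R v φ| ≤
          K * (1 + ‖R‖) * ‖p₂ - p₁‖ * (‖g‖ + ‖jL Ω v‖) * ‖φ‖ := fun v g hv φ => by
    -- Any finite bound on the difference will do, because its size does not enter the weighted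
    -- gradient estimate.
    have hD : ∀ᵐ x ∂(vol Ω), |(p₂ - p₁).fn x| ≤ q₁ + q₁ := by
      filter_upwards [hQ hp₁, hQ hp₂, Lp.coeFn_sub p₂.fn p₁.fn] with x d1 d2 d3
      rw [H1.fn_sub, d3, Pi.sub_apply]
      exact (abs_sub _ _).trans (add_le_add d2 d1)
    rw [form_sub_form hΩ (hQ hp₁) bt (ae_abs_le_top hct) R (hQ hp₂) hD]
    -- The elliptic estimate concerns the form without feedback, so `R v` returns to the right-hand
    -- side; this produces the factor `1 + ‖R‖` in the Lipschitz modulus.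
    have hell : ∀ ψ ∈ H10 Ω, form p₂ bt ct v.val.1 ψ = inner ℝ (g - R v.val.1.fn) ψ.fn := by
      intro ψ hψ
      have h3 := hv (projL Ω ψ)
      rw [formL_apply, jL_apply, val_projL hψ] at h3
      rw [inner_sub_left]
      exact eq_sub_of_add_eq h3
    refine (hK p₂ hp₂ v.val _ hell (p₂ - p₁) _ hD φ.val.1).trans ?_
    have hn : ‖g - R v.val.1.fn‖ + ‖v.val.1.fn‖ ≤ (1 + ‖R‖) * (‖g‖ + ‖jL Ω v‖) := by
      have i1 := norm_sub_le g (R v.val.1.fn)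
      have i2 := R.le_opNorm v.val.1.fn
      have i3 := mul_nonneg (norm_nonneg R) (norm_nonneg g)
      rw [jL_apply]
      nlinarith
    calc K * ‖p₂ - p₁‖ * (‖g - R v.val.1.fn‖ + ‖v.val.1.fn‖) * ‖φ.val.1‖
        ≤ K * ‖p₂ - p₁‖ * ((1 + ‖R‖) * (‖g‖ + ‖jL Ω v‖)) * ‖φ.val.1‖ := by gcongr
      _ = K * (1 + ‖R‖) * ‖p₂ - p₁‖ * (‖g‖ + ‖jL Ω v‖) * ‖φ‖ := by rw [φ.norm_eq]; ring
  have main := hC _ _ (coer hp₁) (abs_formL_le hΩ (hQ hp₁) bt (ae_abs_le_top hct) R hq₁)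
    (coer hp₂) (abs_formL_le hΩ (hQ hp₂) bt (ae_abs_le_top hct) R hq₁)
    (K * (1 + ‖R‖) * ‖p₂ - p₁‖) (by positivity) hpert y₁ y₁' y₂ y₂' hy₁ hy₂
    (by rw [jL_apply, e₁ 0 h0, hv₁.initial]) (by rw [jL_apply, e₂ 0 h0, hv₂.initial])
  have e : ‖y₁ t - y₂ t‖ = ‖v₁ t - v₂ t‖ := by
    rw [← e₁ t ⟨ht.1.le, ht.2⟩, ← e₂ t ⟨ht.1.le, ht.2⟩]; rfl
  rw [e] at main
  refine main.trans (le_of_eq ?_)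
  rw [norm_sub_rev p₂ p₁]; ring
end ContinuousDependence

end CDA

end


theorem mainTheorem7
    {Ω : Set Plane} (hΩ : IsConvexPolygonalDomain Ω)
    -- the mesh and the finite element space
    (𝒯 : Triangulation Ω) (ρ : ℝ) (hρ : 0 < ρ) (hqu : 𝒯.IsQuasiUniform ρ)
    (hh : 𝒯.meshSize < 1) (k : ℕ) (hk : 1 ≤ k)
    -- the constants
    (C_P C_A : ℝ) (hCP : IsPoincareConst Ω C_P) (hCA : 𝒯.IsApproxConst k C_A)
    (q₀ q₁ c₁ μ T : ℝ) (hq₀ : 0 < q₀) (hμ : 0 < μ) (hT : 0 < T)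
    -- the exact equation and its solution `u`
    (q : H1 Ω) (hq : q ∈ Conductivities Ω q₀ q₁) (b : Fin 2 → H1 Ω)
    (c : LInf Ω) (hc : ∀ᵐ x ∂(vol Ω), 0 ≤ c x ∧ c x ≤ c₁) (f u₀ : L2 Ω)
    (u : ℝ → H1 Ω) (hu : IsSolution T q b c (fun _ => f) u₀ u)
    -- the data of the assimilation equation
    (bt : Fin 2 → H1 Ω) (ct : LInf Ω) (hct : ∀ᵐ x ∂(vol Ω), 0 ≤ ct x ∧ ct x ≤ c₁) (ft : L2 Ω)
    -- the condition on the mesh size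
    (hmesh : 𝒯.meshSize ^ 2 ≤ q₀ / (2 * C_A ^ 2 * μ ^ 2))
    (t : ℝ) (ht : t ∈ Set.Ioc 0 T) :
    ∀ qhat ∈ AdmissibleCoeffs Ω q₀ q₁ c₁ C_P μ bt,
      ∃ r > 0, ∃ C_t > 0,
        ∀ qt₁ ∈ AdmissibleCoeffs Ω q₀ q₁ c₁ C_P μ bt,
        ∀ qt₂ ∈ AdmissibleCoeffs Ω q₀ q₁ c₁ C_P μ bt,
          ‖qt₁ - qhat‖ < r → ‖qt₂ - qhat‖ < r →
          ∀ v₁ v₂ : ℝ → H1 Ω,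
            IsAssimilationSolution 𝒯 k T μ u bt ct ft qt₁ v₁ →
            IsAssimilationSolution 𝒯 k T μ u bt ct ft qt₂ v₂ →
            ‖v₁ t - v₂ t‖ ^ 2 ≤ (1 + C_A ^ 2) * C_t * ‖qt₁ - qt₂‖ ^ 2 / q₀ := by
  have hΩo := isOpen_of_isConvexPolygonalDomain hΩ
  have := isFiniteMeasure_of_isConvexPolygonalDomain hΩ
  have hq₁ : 0 ≤ q₁ := hq₀.le.trans (le_of_mem_conductivities hΩ hq)
  obtain ⟨C, hC0, hC⟩ := hu.exists_lipschitz_bound hΩo hq₀ hq₁ ht hq hc bt hct ft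
    -- An orthogonal projection is a nonnegative operator, so the feedback does not spoil
    -- coercivity.
    (R := μ • 𝒯.Ih k) fun g => by
      rw [smul_apply, real_inner_smul_left]
      exact mul_nonneg hμ.le ((𝒯.Vh k).re_inner_starProjection_nonneg g)
  intro qhat _
  have hA : 0 < 1 + C_A ^ 2 := by positivity
  -- The constant `C` is uniform over the conductivities, so the radius is arbitrary. The choice of
  -- `C_t` undoes the normalisation `(1 + C_A²) / q₀`, and the summand `1` makes it positive when `C
  -- = 0`.
  refine ⟨1, one_pos, C * q₀ / (1 + C_A ^ 2) + 1, by positivity,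
    fun p₁ hp₁ p₂ hp₂ _ _ v₁ v₂ hv₁ hv₂ => ?_⟩
  refine (hC p₁ hp₁.1 p₂ hp₂.1 v₁ v₂ hv₁ hv₂).trans ?_
  have e : (1 + C_A ^ 2) * (C * q₀ / (1 + C_A ^ 2) + 1) * ‖p₁ - p₂‖ ^ 2 / q₀ =
      C * ‖p₁ - p₂‖ ^ 2 + (1 + C_A ^ 2) * ‖p₁ - p₂‖ ^ 2 / q₀ := by
    field_simp
  rw [e]
  exact le_add_of_nonneg_right (by positivity)
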